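/- **Setting.** Let $\Gamma$ be the chain graph consisting of rings of circumference $2\pi$, indexed by $j\in\mathbb Z$, the $(j-1)$-th and the $j$-th ring touching at the $j$-th vertex. The upper and the lower half-circle of the $j$-th ring are both parametrized by $(j\pi,(j+1)\pi)$; the $j$-th vertex has coordinate $j\pi$. A function on $\Gamma$ consists of edge functions $\psi_j$ (upper) and $\varphi_j$ (lower), $j\in\mathbb Z$. For $A\in\mathbb R$ put $\mathcal D=\frac{d}{dx}+iA$ on upper and $\mathcal D=\frac{d}{dx}-iA$ on lower half-circles. For a real sequence $a=(a_j)_{j\in\mathbb Z}$ let $-\Delta_a$ be the self-adjoint operator in $L^2(\Gamma)$ acting as $-\mathcal D^2$ on each edge, whose domain consists of all $f\in L^2(\Gamma)$ that are in $H^2$ on every edge, with $\mathcal D^2 f\in L^2(\Gamma)$, and that satisfy at every vertex the $\delta$-coupling $$\psi_j(j\pi)=\varphi_j(j\pi)=\psi_{j-1}(j\pi)=\varphi_{j-1}(j\pi),\qquad \mathcal D\psi_j(j\pi)+\mathcal D\varphi_j(j\pi)-\mathcal D\psi_{j-1}(j\pi)-\mathcal D\varphi_{j-1}(j\pi)=a_j\,\psi_j(j\pi).$$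 For $\alpha\in\mathbb R$ let $-\Delta_\alpha$ be the operator with $a_j=\alpha$ for all $j$; for $m\in\mathbb N$, real $\gamma_1,\dots,\gamma_m$ and $\varepsilon\in\mathbb R$ let $-\Delta_{\alpha+\varepsilon\gamma}$ be the operator with $a_j=\alpha+\varepsilon\gamma_j$ for $1\le j\le m$ and $a_j=\alpha$ otherwise. Gaps are the connected components of the complement in $\mathbb R$ of the essential spectrum; the first gap is the one below the whole essential spectrum. The discrete spectrum is the set of eigenvalues outside the essential spectrum. **Theorem (non-magnetic case, weak coupling).** Let $A\in\mathbb Z$, and let $\alpha,\gamma_1,\dots,\gamma_m\in\mathbb R$. For every $\varepsilon$ the essential spectrum of $-\Delta_{\alpha+\varepsilon\gamma}$ coincides with that of $-\Delta_\alpha$. Moreover, there is $\varepsilon_0>0$ (depending on $A,\alpha,m,\gamma$ only) such that the following holds for all $\varepsilon\in(0,\varepsilon_0)$. 1. If $\alpha>0$ and $\sum_{j=1}^m\gamma_j>0$, then $-\Delta_{\alpha+\varepsilon\gamma}$ has empty discrete spectrum, and it has no eigenvalues at all other than possibly the numbers $n^2$, $n=1,2,3,\dots$ 2. If $\alpha>0$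 and $\sum_{j=1}^m\gamma_j<0$, then $-\Delta_{\alpha+\varepsilon\gamma}$ has precisely one eigenvalue in every gap of its essential spectrum, and this eigenvalue is simple. 3. If $\alpha<0$ and $\sum_{j=1}^m\gamma_j>0$, then $-\Delta_{\alpha+\varepsilon\gamma}$ has precisely one eigenvalue in every gap of its essential spectrum except the first one, this eigenvalue is simple, and there is no eigenvalue in the first gap. 4. If $\alpha<0$ and $\sum_{j=1}^m\gamma_j<0$, then $-\Delta_{\alpha+\varepsilon\gamma}$ has precisely one eigenvalue $E$ below its essential spectrum, $E$ is simple, the discrete spectrum is $\{E\}$, and there are no eigenvalues at all other than $E$ and possibly the numbers $n^2$, $n=1,2,3,\dots$ -/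

import Mathlib

open MeasureTheory Filter Topology

noncomputable section

namespace ChainGraph

/-- The state space `L²(Γ)`.  The chain graph `Γ` is parametrized by two copies of the real line:
copy `0` runs along the upper half-circles, copy `1` along the lower ones; the half-circles of the
`j`-th ring are `(jπ, (j+1)π)`, and the `j`-th vertex is the common point with coordinate `jπ`. -/
abbrev StateSpace : Type := PiLp 2 (fun _ : Fin 2 => Lp ℂ 2 (volume : Measure ℝ))

/-- The open interval `(jπ, (j+1)π)` parametrizing both half-circles of the `j`-th ring. -/
def edge (j : ℤ) : Set ℝ := Set.Ioo (j * Real.pi) ((j + 1) * Real.pi)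

/-- `u` is (the continuously differentiable representative, on the closed edge, of) a function in
the Sobolev space `H²` of the `j`-th edge, with first derivative `u'` (absolutely continuous) and
second derivative `u''` (square integrable). -/
structure IsSobolevTwo (j : ℤ) (u u' u'' : ℝ → ℂ) : Prop where
  memLp : MemLp u'' 2 (volume.restrict (edge j))
  deriv_one : ∀ x ∈ Set.Icc (j * Real.pi) ((j + 1) * Real.pi),
    u x = u (j * Real.pi) + ∫ t in (j * Real.pi)..x, u' t
  deriv_two : ∀ x ∈ Set.Icc (j * Real.pi) ((j + 1) * Real.pi),
    u' x = u' (j * Real.pi) + ∫ t in (j * Real.pi)..x, u'' t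

theorem vertex_le (j : ℤ) : (j : ℝ) * Real.pi ≤ ((j : ℝ) + 1) * Real.pi := by
  nlinarith [Real.pi_pos]

theorem IsSobolevTwo.intervalIntegrable_two {j : ℤ} {u u' u'' : ℝ → ℂ}
    (h : IsSobolevTwo j u u' u'') :
    IntervalIntegrable u'' volume (j * Real.pi) ((j + 1) * Real.pi) := by
  rw [intervalIntegrable_iff_integrableOn_Ioo_of_le (vertex_le j)]
  have hf : IsFiniteMeasure ((volume : Measure ℝ).restrict (edge j)) :=
    ⟨by simp [edge]⟩
  exact h.memLp.integrable (by norm_num)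

theorem continuousOn_of_primitive {a b : ℝ} (hab : a ≤ b) {F f : ℝ → ℂ}
    (hf : IntervalIntegrable f volume a b)
    (hF : ∀ x ∈ Set.Icc a b, F x = F a + ∫ t in a..x, f t) : ContinuousOn F (Set.Icc a b) := by
  have h1 := intervalIntegral.continuousOn_primitive_interval' hf Set.left_mem_uIcc
  rw [Set.uIcc_of_le hab] at h1
  exact (continuousOn_const.add h1).congr hF

theorem IsSobolevTwo.intervalIntegrable_one {j : ℤ} {u u' u'' : ℝ → ℂ}
    (h : IsSobolevTwo j u u' u'') :
    IntervalIntegrable u' volume (j * Real.pi) ((j + 1) * Real.pi) := by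
  have h1 := continuousOn_of_primitive (vertex_le j) h.intervalIntegrable_two h.deriv_two
  rw [← Set.uIcc_of_le (vertex_le j)] at h1
  exact h1.intervalIntegrable

theorem uIcc_sub {a b x : ℝ} (hx : x ∈ Set.Icc a b) : Set.uIcc a x ⊆ Set.uIcc a b := by
  rw [Set.uIcc_of_le hx.1, Set.uIcc_of_le (hx.1.trans hx.2)]
  exact Set.Icc_subset_Icc_right hx.2

theorem IsSobolevTwo.add {j : ℤ} {u u' u'' v v' v'' : ℝ → ℂ}
    (hu : IsSobolevTwo j u u' u'') (hv : IsSobolevTwo j v v' v'') :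
    IsSobolevTwo j (fun x => u x + v x) (fun x => u' x + v' x) (fun x => u'' x + v'' x) where
  memLp := hu.memLp.add hv.memLp
  deriv_one x hx := by
    rw [intervalIntegral.integral_add (hu.intervalIntegrable_one.mono_set (uIcc_sub hx))
      (hv.intervalIntegrable_one.mono_set (uIcc_sub hx)), hu.deriv_one x hx, hv.deriv_one x hx]
    ring
  deriv_two x hx := by
    rw [intervalIntegral.integral_add (hu.intervalIntegrable_two.mono_set (uIcc_sub hx))
      (hv.intervalIntegrable_two.mono_set (uIcc_sub hx)), hu.deriv_two x hx, hv.deriv_two x hx]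
    ring

theorem IsSobolevTwo.const_mul {j : ℤ} {u u' u'' : ℝ → ℂ}
    (hu : IsSobolevTwo j u u' u'') (c : ℂ) :
    IsSobolevTwo j (fun x => c * u x) (fun x => c * u' x) (fun x => c * u'' x) where
  memLp := hu.memLp.const_mul c
  deriv_one x hx := by
    rw [intervalIntegral.integral_const_mul, hu.deriv_one x hx]
    ring
  deriv_two x hx := by
    rw [intervalIntegral.integral_const_mul, hu.deriv_two x hx]
    ring

theorem primitive_eq_zero {a b : ℝ} (hab : a ≤ b) {F f : ℝ → ℂ}
    (hf : IntervalIntegrable f volume a b)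
    (hF : ∀ x ∈ Set.Icc a b, F x = F a + ∫ t in a..x, f t)
    (h0 : F =ᵐ[volume.restrict (Set.Ioo a b)] 0) :
    f =ᵐ[volume.restrict (Set.Ioo a b)] 0 := by
  have hz : Set.EqOn F 0 (Set.Ioo a b) := Measure.eqOn_Ioo_of_ae_eq (μ := volume) h0
    ((continuousOn_of_primitive hab hf hF).mono Set.Ioo_subset_Icc_self) continuousOn_const
  have hd := IntervalIntegrable.ae_hasDerivAt_integral hf
  rw [Filter.EventuallyEq, ae_restrict_iff' measurableSet_Ioo]
  filter_upwards [hd] with x hx hxab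
  have h1 := hx (by rw [Set.uIcc_of_le hab]; exact Set.Ioo_subset_Icc_self hxab) a
    Set.left_mem_uIcc
  have h2 : (fun y => ∫ t in a..y, f t) =ᶠ[𝓝 x] fun _ => -F a := by
    filter_upwards [Ioo_mem_nhds hxab.1 hxab.2] with y hy
    have h3 := hF y (Set.Ioo_subset_Icc_self hy)
    have h4 : F y = 0 := hz hy
    rw [h4] at h3
    linear_combination -h3
  exact h1.unique ((hasDerivAt_const x (-F a)).congr_of_eventuallyEq h2)

theorem ae_of_ae_edge {p : ℝ → Prop} (h : ∀ j, ∀ᵐ x ∂(volume.restrict (edge j)), p x) :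
    ∀ᵐ x ∂(volume : Measure ℝ), p x := by
  have h1 : ∀ᵐ x ∂(volume : Measure ℝ), ∀ j, x ∈ edge j → p x :=
    ae_all_iff.2 fun j => (ae_restrict_iff' measurableSet_Ioo).1 (h j)
  have h2 : ∀ᵐ x ∂(volume : Measure ℝ), x ∉ Set.range fun j : ℤ => (j : ℝ) * Real.pi :=
    (Set.countable_range _).ae_notMem _
  filter_upwards [h1, h2] with x hx hx2
  refine hx ⌊x / Real.pi⌋ ⟨lt_of_le_of_ne ?_ fun h => hx2 ⟨_, h⟩, ?_⟩
  · exact (le_div_iff₀ Real.pi_pos).1 (Int.floor_le _)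
  · exact (div_lt_iff₀ Real.pi_pos).1 (Int.lt_floor_add_one _)

/-- Orientation of the vector potential: `𝒟 = d/dx + iA` on the upper half-circles and
`𝒟 = d/dx - iA` on the lower ones. -/
def orientation : Fin 2 → ℝ := ![1, -1]

/-- The quasiderivative `𝒟u = u' ± iAu` of a function `u` with derivative `u'`. -/
def quasiDeriv (A : ℝ) (s : Fin 2) (u u' : ℝ → ℂ) (x : ℝ) : ℂ :=
  u' x + Complex.I * ((orientation s * A : ℝ) : ℂ) * u x

/-- `𝒟²u` for a function `u` with derivatives `u'`, `u''`: note that `𝒟u` has derivative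
`𝒟(u')`. -/
def quasiDerivTwo (A : ℝ) (s : Fin 2) (u u' u'' : ℝ → ℂ) : ℝ → ℂ :=
  quasiDeriv A s (quasiDeriv A s u u') (quasiDeriv A s u' u'')

/-- The edge functions `u s j` (with derivatives `u' s j`, `u'' s j`) are in `H²` of every edge and
satisfy the `δ`-coupling of strength `a j` at the `j`-th vertex, for all `j`: the four edge functions
meeting there have the same value, and the sum of the outgoing quasiderivatives is `a j` times that
value. -/
structure IsDeltaCoupled (A : ℝ) (a : ℤ → ℝ) (u u' u'' : Fin 2 → ℤ → ℝ → ℂ) : Prop where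
  sobolev : ∀ s j, IsSobolevTwo j (u s j) (u' s j) (u'' s j)
  continuous_right : ∀ s j, u s j (j * Real.pi) = u 0 j (j * Real.pi)
  continuous_left : ∀ s j, u s (j - 1) (j * Real.pi) = u 0 j (j * Real.pi)
  flux : ∀ j : ℤ, (∑ s, quasiDeriv A s (u s j) (u' s j) (j * Real.pi))
      - (∑ s, quasiDeriv A s (u s (j - 1)) (u' s (j - 1)) (j * Real.pi))
      = (a j : ℂ) * u 0 j (j * Real.pi)

/-- The graph of the Hamiltonian: pairs `(f, g)` in `L²(Γ) × L²(Γ)` such that `f` is in `H²` of every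
edge, satisfies the `δ`-couplings at all vertices, and `-𝒟²f = g` on every edge. -/
def hamiltonianGraph (A : ℝ) (a : ℤ → ℝ) : Submodule ℂ (StateSpace × StateSpace) where
  carrier := {p | ∃ u u' u'' : Fin 2 → ℤ → ℝ → ℂ, IsDeltaCoupled A a u u' u'' ∧
    (∀ s j, p.1 s =ᵐ[volume.restrict (edge j)] u s j) ∧
    (∀ s j, p.2 s =ᵐ[volume.restrict (edge j)]
      fun x => -quasiDerivTwo A s (u s j) (u' s j) (u'' s j) x)}
  zero_mem' := by
    refine ⟨0, 0, 0, ⟨fun s j => ⟨MemLp.zero, by simp, by simp⟩, by simp, by simp, ?_⟩, ?_, ?_⟩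
    · intro j
      simp [quasiDeriv]
    · intro s j
      exact ae_restrict_of_ae (Lp.coeFn_zero ℂ 2 volume)
    · intro s j
      filter_upwards [ae_restrict_of_ae (Lp.coeFn_zero ℂ 2 (volume : Measure ℝ))] with x hx
      simp only [quasiDerivTwo, quasiDeriv]
      simpa using hx
  add_mem' := by
    rintro p q ⟨u, u', u'', hu, hp1, hp2⟩ ⟨v, v', v'', hv, hq1, hq2⟩
    refine ⟨fun s j x => u s j x + v s j x, fun s j x => u' s j x + v' s j x,
      fun s j x => u'' s j x + v'' s j x,
      ⟨fun s j => (hu.sobolev s j).add (hv.sobolev s j), ?_, ?_, ?_⟩, ?_, ?_⟩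
    · intro s j
      exact congrArg₂ (· + ·) (hu.continuous_right s j) (hv.continuous_right s j)
    · intro s j
      exact congrArg₂ (· + ·) (hu.continuous_left s j) (hv.continuous_left s j)
    · intro j
      have h1 := hu.flux j
      have h2 := hv.flux j
      simp only [quasiDeriv, Fin.sum_univ_two] at h1 h2 ⊢
      linear_combination h1 + h2
    · intro s j
      filter_upwards [hp1 s j, hq1 s j, ae_restrict_of_ae (Lp.coeFn_add (p.1 s) (q.1 s))]
        with x h1 h2 h3
      rw [← h1, ← h2]
      exact h3
    · intro s j
      filter_upwards [hp2 s j, hq2 s j, ae_restrict_of_ae (Lp.coeFn_add (p.2 s) (q.2 s))]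
        with x h1 h2 h3
      refine h3.trans ?_
      rw [Pi.add_apply, h1, h2]
      simp only [quasiDerivTwo, quasiDeriv]
      ring
  smul_mem' := by
    rintro c p ⟨u, u', u'', hu, hp1, hp2⟩
    refine ⟨fun s j x => c * u s j x, fun s j x => c * u' s j x, fun s j x => c * u'' s j x,
      ⟨fun s j => (hu.sobolev s j).const_mul c, ?_, ?_, ?_⟩, ?_, ?_⟩
    · intro s j
      exact congrArg (c * ·) (hu.continuous_right s j)
    · intro s j
      exact congrArg (c * ·) (hu.continuous_left s j)
    · intro j
      have h1 := hu.flux j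
      simp only [quasiDeriv, Fin.sum_univ_two] at h1 ⊢
      linear_combination c * h1
    · intro s j
      filter_upwards [hp1 s j, ae_restrict_of_ae (Lp.coeFn_smul c (p.1 s))] with x h1 h3
      rw [← h1]
      exact h3
    · intro s j
      filter_upwards [hp2 s j, ae_restrict_of_ae (Lp.coeFn_smul c (p.2 s))] with x h1 h3
      refine h3.trans ?_
      rw [Pi.smul_apply, h1, smul_eq_mul]
      simp only [quasiDerivTwo, quasiDeriv]
      ring

/-- The function in the domain determines its image. -/
theorem hamiltonianGraph_singleValued (A : ℝ) (a : ℤ → ℝ) (p : StateSpace × StateSpace)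
    (hp : p ∈ hamiltonianGraph A a) (h0 : p.1 = 0) : p.2 = 0 := by
  obtain ⟨u, u', u'', hu, h1, h2⟩ := hp
  ext s : 1
  refine Lp.ext ?_
  refine EventuallyEq.trans ?_ (Lp.coeFn_zero ℂ 2 (volume : Measure ℝ)).symm
  refine ae_of_ae_edge fun j => ?_
  have hs := hu.sobolev s j
  have hz : u s j =ᵐ[volume.restrict (edge j)] 0 := by
    refine (h1 s j).symm.trans ?_
    rw [h0]
    exact ae_restrict_of_ae (Lp.coeFn_zero ℂ 2 (volume : Measure ℝ))
  have hz' : u' s j =ᵐ[volume.restrict (edge j)] 0 :=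
    primitive_eq_zero (vertex_le j) hs.intervalIntegrable_one hs.deriv_one hz
  have hz'' : u'' s j =ᵐ[volume.restrict (edge j)] 0 :=
    primitive_eq_zero (vertex_le j) hs.intervalIntegrable_two hs.deriv_two hz'
  filter_upwards [h2 s j, hz, hz', hz''] with x a b c d
  rw [a]
  simp only [Pi.zero_apply] at b c d ⊢
  simp [quasiDerivTwo, quasiDeriv, b, c, d]

/-- The Hamiltonian of the chain with vector potential `A` and vertex couplings `a j`, as an unbounded
operator in `L²(Γ)`. -/
def hamiltonian (A : ℝ) (a : ℤ → ℝ) : StateSpace →ₗ.[ℂ] StateSpace :=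
  (hamiltonianGraph A a).toLinearPMap

theorem hamiltonian_graph (A : ℝ) (a : ℤ → ℝ) :
    (hamiltonian A a).graph = hamiltonianGraph A a :=
  Submodule.toLinearPMap_graph_eq _ (hamiltonianGraph_singleValued A a)

/-- The couplings `α + γ_j` for `1 ≤ j ≤ m` and `α` at all other vertices. -/
def perturbed (α : ℝ) (m : ℕ) (γ : ℤ → ℝ) (j : ℤ) : ℝ :=
  if 1 ≤ j ∧ j ≤ m then α + γ j else α

/-- The eigenspace `ker (T - E)` of an unbounded operator. -/
def eigenspace (T : StateSpace →ₗ.[ℂ] StateSpace) (E : ℝ) : Submodule ℂ StateSpace :=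
  T.graph.comap (LinearMap.prod LinearMap.id ((E : ℂ) • LinearMap.id))

/-- The eigenvalues of a self-adjoint operator. -/
def pointSpectrum (T : StateSpace →ₗ.[ℂ] StateSpace) : Set ℝ :=
  {E | eigenspace T E ≠ ⊥}

/-- The simple eigenvalues of a self-adjoint operator. -/
def simpleEigenvalues (T : StateSpace →ₗ.[ℂ] StateSpace) : Set ℝ :=
  {E | Module.finrank ℂ (eigenspace T E) = 1}

/-- The essential spectrum of a self-adjoint operator: `E` belongs to it iff there is a singular
(Weyl) sequence for `E`, that is, normalized vectors of the domain that converge weakly to zero and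
along which `T - E` converges to zero. -/
def essentialSpectrum (T : StateSpace →ₗ.[ℂ] StateSpace) : Set ℝ :=
  {E | ∃ u : ℕ → T.domain, (∀ n, ‖(u n : StateSpace)‖ = 1) ∧
    (∀ v : StateSpace, Tendsto (fun n => inner ℂ v (u n : StateSpace)) atTop (𝓝 0)) ∧
    Tendsto (fun n => T (u n) - (E : ℂ) • (u n : StateSpace)) atTop (𝓝 0)}

/-- The discrete spectrum of a self-adjoint operator: the eigenvalues outside the essential
spectrum. -/
def discreteSpectrum (T : StateSpace →ₗ.[ℂ] StateSpace) : Set ℝ :=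
  pointSpectrum T \ essentialSpectrum T

/-- The gaps of a set `S` of energies: the connected components of its complement (including the
unbounded ones). -/
def gaps (S : Set ℝ) : Set (Set ℝ) :=
  {G | ∃ E ∈ Sᶜ, G = connectedComponentIn Sᶜ E}

/-- The first gap of an essential spectrum `S`: the energies below all of `S`. -/
def firstGap (S : Set ℝ) : Set ℝ :=
  {E | ∀ x ∈ S, E < x}

/-- The energies `k²`, `k = 1, 2, 3, …`, which are infinitely degenerate eigenvalues of every chain
Hamiltonian with integer `A`. -/
def ringEnergies : Set ℝ :=
  {E | ∃ k : ℕ, 1 ≤ k ∧ E = (k : ℝ) ^ 2}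

end ChainGraph

end

noncomputable section

namespace ChainGraph

/-- The solution of `-c'' = E c` with `c 0 = 1`, `c' 0 = 0`. -/
def cosE (E x : ℝ) : ℝ := if 0 ≤ E then Real.cos (√E * x) else Real.cosh (√(-E) * x)

/-- The solution of `-s'' = E s` with `s 0 = 0`, `s' 0 = 1`. -/
def sinE (E x : ℝ) : ℝ :=
  if 0 < E then Real.sin (√E * x) / √E else if E = 0 then x else Real.sinh (√(-E) * x) / √(-E)

theorem energy_cases (E : ℝ) :
    (∃ k : ℝ, 0 < k ∧ E = k ^ 2) ∨ E = 0 ∨ ∃ k : ℝ, 0 < k ∧ E = -k ^ 2 := by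
  rcases lt_trichotomy E 0 with h | h | h
  · exact Or.inr (Or.inr ⟨√(-E), Real.sqrt_pos.2 (by linarith), by
      rw [Real.sq_sqrt (by linarith)]; ring⟩)
  · exact Or.inr (Or.inl h)
  · exact Or.inl ⟨√E, Real.sqrt_pos.2 h, (Real.sq_sqrt h.le).symm⟩

theorem cosE_sq {k : ℝ} (hk : 0 < k) (x : ℝ) : cosE (k ^ 2) x = Real.cos (k * x) := by
  rw [cosE, if_pos (by positivity), Real.sqrt_sq hk.le]

theorem cosE_zero (x : ℝ) : cosE 0 x = 1 := by simp [cosE]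

theorem cosE_neg_sq {k : ℝ} (hk : 0 < k) (x : ℝ) : cosE (-k ^ 2) x = Real.cosh (k * x) := by
  have : 0 < k ^ 2 := by positivity
  rw [cosE, if_neg (by linarith), neg_neg, Real.sqrt_sq hk.le]

theorem sinE_sq {k : ℝ} (hk : 0 < k) (x : ℝ) : sinE (k ^ 2) x = Real.sin (k * x) / k := by
  rw [sinE, if_pos (by positivity), Real.sqrt_sq hk.le]

theorem sinE_zero (x : ℝ) : sinE 0 x = x := by simp [sinE]

theorem sinE_neg_sq {k : ℝ} (hk : 0 < k) (x : ℝ) :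
    sinE (-k ^ 2) x = Real.sinh (k * x) / k := by
  have : 0 < k ^ 2 := by positivity
  rw [sinE, if_neg (by linarith), if_neg (by linarith), neg_neg, Real.sqrt_sq hk.le]

theorem hasDerivAt_cosE (E x : ℝ) : HasDerivAt (cosE E) (-E * sinE E x) x := by
  rcases energy_cases E with ⟨k, hk, rfl⟩ | rfl | ⟨k, hk, rfl⟩
  · rw [show cosE (k ^ 2) = fun x => Real.cos (k * x) from funext (cosE_sq hk), sinE_sq hk]
    refine HasDerivAt.congr_deriv (((hasDerivAt_id' x).const_mul k).cos) ?_
    field_simp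
  · rw [show cosE 0 = fun _ => 1 from funext cosE_zero, neg_zero, zero_mul]
    exact hasDerivAt_const _ _
  · rw [show cosE (-k ^ 2) = fun x => Real.cosh (k * x) from funext (cosE_neg_sq hk),
      sinE_neg_sq hk]
    refine HasDerivAt.congr_deriv (((hasDerivAt_id' x).const_mul k).cosh) ?_
    field_simp

theorem hasDerivAt_sinE (E x : ℝ) : HasDerivAt (sinE E) (cosE E x) x := by
  rcases energy_cases E with ⟨k, hk, rfl⟩ | rfl | ⟨k, hk, rfl⟩
  · rw [show sinE (k ^ 2) = fun x => Real.sin (k * x) / k from funext (sinE_sq hk), cosE_sq hk]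
    refine HasDerivAt.congr_deriv (((hasDerivAt_id' x).const_mul k).sin.div_const k) ?_
    field_simp
  · rw [show sinE 0 = fun x => x from funext sinE_zero, cosE_zero]
    exact hasDerivAt_id x
  · rw [show sinE (-k ^ 2) = fun x => Real.sinh (k * x) / k from funext (sinE_neg_sq hk),
      cosE_neg_sq hk]
    refine HasDerivAt.congr_deriv (((hasDerivAt_id' x).const_mul k).sinh.div_const k) ?_
    field_simp

theorem cosE_at_zero (E : ℝ) : cosE E 0 = 1 := by simp [cosE]

theorem sinE_at_zero (E : ℝ) : sinE E 0 = 0 := by simp [sinE]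

theorem cosE_sq_add (E x : ℝ) : cosE E x ^ 2 + E * sinE E x ^ 2 = 1 := by
  rcases energy_cases E with ⟨k, hk, rfl⟩ | rfl | ⟨k, hk, rfl⟩
  · rw [cosE_sq hk, sinE_sq hk]
    field_simp
    linarith [Real.sin_sq_add_cos_sq (k * x)]
  · simp [cosE_zero]
  · rw [cosE_neg_sq hk, sinE_neg_sq hk]
    field_simp
    linarith [Real.cosh_sq (k * x)]

theorem sinE_add (E x y : ℝ) : sinE E (x + y) = sinE E x * cosE E y + cosE E x * sinE E y := by
  rcases energy_cases E with ⟨k, hk, rfl⟩ | rfl | ⟨k, hk, rfl⟩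
  · simp only [cosE_sq hk, sinE_sq hk, mul_add, Real.sin_add]
    field_simp
  · simp [cosE_zero, sinE_zero]
  · simp only [cosE_neg_sq hk, sinE_neg_sq hk, mul_add, Real.sinh_add]
    field_simp

theorem continuous_sinE (E : ℝ) : Continuous (sinE E) :=
  continuous_iff_continuousAt.2 fun x => (hasDerivAt_sinE E x).continuousAt

theorem continuous_cosE (E : ℝ) : Continuous (cosE E) :=
  continuous_iff_continuousAt.2 fun x => (hasDerivAt_cosE E x).continuousAt

theorem continuous_cosE_uncurry : Continuous (Function.uncurry cosE) := by
  have h : Function.uncurry cosE = fun p : ℝ × ℝ =>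
      if 0 ≤ p.1 then Real.cos (√p.1 * p.2) else Real.cosh (√(-p.1) * p.2) := by
    ext p; rfl
  rw [h]
  refine Continuous.if_le (by fun_prop) (by fun_prop) (by fun_prop) (by fun_prop) ?_
  intro p hp
  simp [← hp]

theorem sinE_eq_integral (E x : ℝ) : sinE E x = ∫ t in (0 : ℝ)..x, cosE E t := by
  rw [intervalIntegral.integral_eq_sub_of_hasDerivAt (fun t _ => hasDerivAt_sinE E t)
    ((continuous_cosE E).intervalIntegrable _ _), sinE_at_zero, sub_zero]

/-- The value at the far end of an edge of `cosE`, as a function of the energy. -/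
def edgeCos (E : ℝ) : ℝ := cosE E Real.pi

/-- The value at the far end of an edge of `sinE`, as a function of the energy. -/
def edgeSin (E : ℝ) : ℝ := sinE E Real.pi

theorem continuous_edgeCos : Continuous edgeCos :=
  continuous_cosE_uncurry.comp (by fun_prop : Continuous fun E : ℝ => (E, Real.pi))

theorem continuous_edgeSin : Continuous edgeSin := by
  have h : edgeSin = fun E => ∫ t in (0 : ℝ)..Real.pi, cosE E t :=
    funext fun E => sinE_eq_integral E Real.pi
  rw [h]
  exact intervalIntegral.continuous_parametric_intervalIntegral_of_continuous'
    continuous_cosE_uncurry 0 Real.pi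

theorem edgeCos_sq_add (E : ℝ) : edgeCos E ^ 2 + E * edgeSin E ^ 2 = 1 := cosE_sq_add E Real.pi

theorem edgeSin_eq_zero_iff (E : ℝ) : edgeSin E = 0 ↔ E ∈ ringEnergies := by
  unfold edgeSin ringEnergies
  rcases energy_cases E with ⟨k, hk, rfl⟩ | rfl | ⟨k, hk, rfl⟩
  · rw [sinE_sq hk, div_eq_zero_iff, or_iff_left hk.ne', Real.sin_eq_zero_iff]
    constructor
    · rintro ⟨n, hn⟩
      have h1 : (n : ℝ) = k := mul_right_cancel₀ Real.pi_ne_zero hn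
      have h2 : 0 < n := by exact_mod_cast h1 ▸ hk
      refine ⟨n.toNat, by omega, ?_⟩
      rw [← h1]
      have h3 : ((n.toNat : ℤ) : ℝ) = n := by rw [Int.toNat_of_nonneg h2.le]
      rw [← h3]
      norm_cast
    · rintro ⟨n, hn, h⟩
      have h1 : k = n := by
        have := (sq_eq_sq₀ hk.le (Nat.cast_nonneg n)).1 h
        exact this
      exact ⟨n, by rw [h1]; simp⟩
  · rw [sinE_zero]
    refine iff_of_false Real.pi_ne_zero ?_
    rintro ⟨n, hn, h⟩
    have : (1 : ℝ) ≤ n := by exact_mod_cast hn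
    nlinarith
  · rw [sinE_neg_sq hk]
    refine iff_of_false (div_ne_zero (Real.sinh_eq_zero.not.2 (by positivity)) hk.ne') ?_
    rintro ⟨n, hn, h⟩
    nlinarith

theorem pi_le_edgeSin {E : ℝ} (hE : E ≤ 0) : Real.pi ≤ edgeSin E := by
  unfold edgeSin
  rcases energy_cases E with ⟨k, hk, rfl⟩ | rfl | ⟨k, hk, rfl⟩
  · nlinarith
  · rw [sinE_zero]
  · rw [sinE_neg_sq hk, le_div_iff₀ hk, mul_comm]
    exact Real.self_le_sinh_iff.2 (by positivity)

theorem pi_lt_edgeSin {E : ℝ} (hE : E < 0) : Real.pi < edgeSin E := by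
  unfold edgeSin
  rcases energy_cases E with ⟨k, hk, rfl⟩ | rfl | ⟨k, hk, rfl⟩
  · nlinarith
  · exact absurd hE (lt_irrefl _)
  · rw [sinE_neg_sq hk, lt_div_iff₀ hk, mul_comm]
    exact Real.self_lt_sinh_iff.2 (by positivity)

theorem abs_edgeSin_lt {E : ℝ} (hE : 0 < E) : |edgeSin E| < Real.pi := by
  unfold edgeSin
  rcases energy_cases E with ⟨k, hk, rfl⟩ | rfl | ⟨k, hk, rfl⟩
  · rw [sinE_sq hk, abs_div, abs_of_pos hk, div_lt_iff₀ hk]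
    have h1 := Real.sin_lt (x := k * Real.pi) (by positivity)
    have h2 : -(k * Real.pi) < Real.sin (k * Real.pi) := by
      have h0 : 0 < k * Real.pi := by positivity
      by_cases h : k * Real.pi < Real.pi
      · linarith [Real.sin_pos_of_pos_of_lt_pi h0 h]
      · linarith [Real.neg_one_le_sin (k * Real.pi), Real.pi_gt_three]
    rw [abs_lt]
    constructor <;> linarith
  · exact absurd hE (lt_irrefl _)
  · nlinarith

theorem one_le_edgeCos {E : ℝ} (hE : E ≤ 0) : 1 ≤ edgeCos E := by
  unfold edgeCos
  rcases energy_cases E with ⟨k, hk, rfl⟩ | rfl | ⟨k, hk, rfl⟩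
  · nlinarith
  · rw [cosE_zero]
  · rw [cosE_neg_sq hk]
    exact Real.one_le_cosh _

theorem one_lt_edgeCos {E : ℝ} (hE : E < 0) : 1 < edgeCos E := by
  have h := edgeCos_sq_add E
  have h1 := one_le_edgeCos hE.le
  have h2 := pi_lt_edgeSin hE
  have h3 : 0 < edgeSin E ^ 2 := by have := Real.pi_pos; exact pow_pos (by linarith) 2
  nlinarith

theorem abs_edgeCos_lt {E : ℝ} (hE : 0 < E) (hS : edgeSin E ≠ 0) : |edgeCos E| < 1 := by
  have h := edgeCos_sq_add E
  have h2 : 0 < edgeSin E ^ 2 := by positivity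
  rw [← sq_lt_one_iff_abs_lt_one]
  nlinarith

theorem hasDerivAt_edgeCos {E : ℝ} (hE : E ≠ 0) :
    HasDerivAt edgeCos (-Real.pi * edgeSin E / 2) E := by
  rcases energy_cases E with ⟨k, hk, rfl⟩ | rfl | ⟨k, hk, rfl⟩
  · have h1 : HasDerivAt (fun E => Real.cos (√E * Real.pi)) (-Real.pi * edgeSin (k ^ 2) / 2)
        (k ^ 2) := by
      refine HasDerivAt.congr_deriv (((Real.hasDerivAt_sqrt hE).mul_const Real.pi).cos) ?_
      rw [edgeSin, sinE_sq hk, Real.sqrt_sq hk.le]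
      field_simp
    refine h1.congr_of_eventuallyEq ?_
    filter_upwards [lt_mem_nhds (show 0 < k ^ 2 by positivity)] with E hE
    rw [edgeCos, cosE, if_pos hE.le]
  · exact absurd rfl hE
  · have h0 : (0 : ℝ) < k ^ 2 := by positivity
    have h2 : HasDerivAt (fun E : ℝ => √(-E)) (1 / (2 * √(- -k ^ 2)) * (-1)) (-k ^ 2) :=
      (Real.hasDerivAt_sqrt (by rw [neg_neg]; exact h0.ne')).comp (-k ^ 2)
        (hasDerivAt_neg (-k ^ 2))
    have h1 : HasDerivAt (fun E => Real.cosh (√(-E) * Real.pi))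
        (-Real.pi * edgeSin (-k ^ 2) / 2) (-k ^ 2) := by
      refine HasDerivAt.congr_deriv (h2.mul_const Real.pi).cosh ?_
      rw [edgeSin, sinE_neg_sq hk, neg_neg, Real.sqrt_sq hk.le]
      field_simp
    refine h1.congr_of_eventuallyEq ?_
    filter_upwards [gt_mem_nhds (show -k ^ 2 < 0 by linarith)] with E hE
    rw [edgeCos, cosE, if_neg hE.not_ge]

theorem hasDerivAt_edgeSin {E : ℝ} (hE : E ≠ 0) :
    HasDerivAt edgeSin ((Real.pi * edgeCos E - edgeSin E) / (2 * E)) E := by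
  rcases energy_cases E with ⟨k, hk, rfl⟩ | rfl | ⟨k, hk, rfl⟩
  · have h1 : HasDerivAt (fun E => Real.sin (√E * Real.pi) / √E)
        ((Real.pi * edgeCos (k ^ 2) - edgeSin (k ^ 2)) / (2 * k ^ 2)) (k ^ 2) := by
      refine HasDerivAt.congr_deriv (((Real.hasDerivAt_sqrt hE).mul_const Real.pi).sin.fun_div
        (Real.hasDerivAt_sqrt hE)
        (by rw [Real.sqrt_sq hk.le]; exact hk.ne')) ?_
      rw [edgeSin, sinE_sq hk, edgeCos, cosE_sq hk, Real.sqrt_sq hk.le]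
      field_simp
    refine h1.congr_of_eventuallyEq ?_
    filter_upwards [lt_mem_nhds (show 0 < k ^ 2 by positivity)] with E hE
    rw [edgeSin, sinE, if_pos hE]
  · exact absurd rfl hE
  · have h0 : (0 : ℝ) < k ^ 2 := by positivity
    have h2 : HasDerivAt (fun E : ℝ => √(-E)) (1 / (2 * √(- -k ^ 2)) * (-1)) (-k ^ 2) :=
      (Real.hasDerivAt_sqrt (by rw [neg_neg]; exact h0.ne')).comp (-k ^ 2)
        (hasDerivAt_neg (-k ^ 2))
    have h1 : HasDerivAt (fun E => Real.sinh (√(-E) * Real.pi) / √(-E))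
        ((Real.pi * edgeCos (-k ^ 2) - edgeSin (-k ^ 2)) / (2 * (-k ^ 2))) (-k ^ 2) := by
      refine HasDerivAt.congr_deriv ((h2.mul_const Real.pi).sinh.fun_div h2
        (by rw [neg_neg, Real.sqrt_sq hk.le]; exact hk.ne')) ?_
      rw [edgeSin, sinE_neg_sq hk, edgeCos, cosE_neg_sq hk, neg_neg, Real.sqrt_sq hk.le]
      field_simp
      ring
    refine h1.congr_of_eventuallyEq ?_
    filter_upwards [gt_mem_nhds (show -k ^ 2 < 0 by linarith)] with E hE
    rw [edgeSin, sinE, if_neg hE.not_gt, if_neg hE.ne]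

/-- A function on an interval, continuous there and with negative derivative off the origin, is
strictly decreasing. -/
theorem strictAntiOn_of_hasDerivAt_neg {f f' : ℝ → ℝ} {s : Set ℝ} (hs : s.OrdConnected)
    (hf : ContinuousOn f s) (hd : ∀ x ∈ s, x ≠ 0 → HasDerivAt f (f' x) x)
    (hneg : ∀ x ∈ s, x ≠ 0 → f' x < 0) : StrictAntiOn f s := by
  have key : ∀ t : Set ℝ, t.OrdConnected → t ⊆ s → (0 : ℝ) ∉ interior t → StrictAntiOn f t := by
    intro t ht hts h0
    refine strictAntiOn_of_hasDerivWithinAt_neg ht.convex (hf.mono hts) (f' := f')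
      (fun x hx => ?_) (fun x hx => ?_)
    · exact (hd x (hts (interior_subset hx)) (fun h => h0 (h ▸ hx))).hasDerivWithinAt
    · exact hneg x (hts (interior_subset hx)) (fun h => h0 (h ▸ hx))
  by_cases h0 : (0 : ℝ) ∈ s
  · have h1 := key (s ∩ Set.Iic 0) (hs.inter Set.ordConnected_Iic) Set.inter_subset_left
      (fun h => by
        have := interior_mono (Set.inter_subset_right) h
        rw [interior_Iic] at this
        exact lt_irrefl (0 : ℝ) this)
    have h2 := key (s ∩ Set.Ici 0) (hs.inter Set.ordConnected_Ici) Set.inter_subset_left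
      (fun h => by
        have := interior_mono (Set.inter_subset_right) h
        rw [interior_Ici] at this
        exact lt_irrefl (0 : ℝ) this)
    have h3 := h1.union h2 (c := 0) ⟨⟨h0, Set.mem_Iic.2 le_rfl⟩, fun x hx => hx.2⟩
      ⟨⟨h0, Set.mem_Ici.2 le_rfl⟩, fun x hx => hx.2⟩
    rwa [← Set.inter_union_distrib_left, Set.Iic_union_Ici, Set.inter_univ] at h3
  · exact key s hs subset_rfl (fun h => h0 (interior_subset h))

/-- `(1 + C) / S` is strictly decreasing. -/
theorem strictAntiOn_cot {s : Set ℝ} (hs : s.OrdConnected) (hS : ∀ E ∈ s, edgeSin E ≠ 0) :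
    StrictAntiOn (fun E => (1 + edgeCos E) / edgeSin E) s := by
  refine strictAntiOn_of_hasDerivAt_neg hs
    (f' := fun E => (1 + edgeCos E) * (edgeSin E - Real.pi) / (2 * E * edgeSin E ^ 2))
    (fun E hE => ?_) (fun E hE hE0 => ?_) (fun E hE hE0 => ?_)
  · exact ((continuous_const.add continuous_edgeCos).continuousAt.div
      continuous_edgeSin.continuousAt (hS E hE)).continuousWithinAt
  · have hS0 := hS E hE
    refine HasDerivAt.congr_deriv (((hasDerivAt_edgeCos hE0).const_add 1).fun_div
      (hasDerivAt_edgeSin hE0) hS0) ?_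
    have h := edgeCos_sq_add E
    field_simp
    linear_combination (-Real.pi) * h
  · have hS0 : 0 < edgeSin E ^ 2 := by have := hS E hE; positivity
    rcases lt_or_gt_of_ne hE0 with h | h
    · exact div_neg_of_pos_of_neg (mul_pos (by linarith [one_lt_edgeCos h])
        (by linarith [pi_lt_edgeSin h])) (by nlinarith)
    · have h1 := abs_lt.1 (abs_edgeSin_lt h)
      have h2 := abs_lt.1 (abs_edgeCos_lt h (hS E hE))
      exact div_neg_of_neg_of_pos (mul_neg_of_pos_of_neg (by linarith) (by linarith))
        (by positivity)

/-- `(C - 1) / S` is strictly decreasing. -/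
theorem strictAntiOn_neg_tan {s : Set ℝ} (hs : s.OrdConnected) (hS : ∀ E ∈ s, edgeSin E ≠ 0) :
    StrictAntiOn (fun E => (edgeCos E - 1) / edgeSin E) s := by
  refine strictAntiOn_of_hasDerivAt_neg hs
    (f' := fun E => (edgeCos E - 1) * (edgeSin E + Real.pi) / (2 * E * edgeSin E ^ 2))
    (fun E hE => ?_) (fun E hE hE0 => ?_) (fun E hE hE0 => ?_)
  · exact ((continuous_edgeCos.sub continuous_const).continuousAt.div
      continuous_edgeSin.continuousAt (hS E hE)).continuousWithinAt
  · have hS0 := hS E hE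
    refine HasDerivAt.congr_deriv (((hasDerivAt_edgeCos hE0).sub_const 1).fun_div
      (hasDerivAt_edgeSin hE0) hS0) ?_
    have h := edgeCos_sq_add E
    field_simp
    linear_combination (-Real.pi) * h
  · have hS0 : 0 < edgeSin E ^ 2 := by have := hS E hE; positivity
    rcases lt_or_gt_of_ne hE0 with h | h
    · exact div_neg_of_pos_of_neg (mul_pos (by linarith [one_lt_edgeCos h])
        (by linarith [pi_lt_edgeSin h, Real.pi_pos])) (by nlinarith)
    · have h1 := abs_lt.1 (abs_edgeSin_lt h)
      have h2 := abs_lt.1 (abs_edgeCos_lt h (hS E hE))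
      exact div_neg_of_neg_of_pos (mul_neg_of_neg_of_pos (by linarith) (by linarith))
        (by positivity)

/-! ### Quadratic forms of square summable sequences -/

theorem hasSum_of_eq {ι : Type*} {f g : ι → ℝ} {a b : ℝ} (h : HasSum f a) (hfg : ∀ i, f i = g i)
    (hab : a = b) : HasSum g b := by
  obtain rfl := funext hfg
  exact hab ▸ h

/-- Real square summable two-sided sequences. -/
def SqSummable (y : ℤ → ℝ) : Prop := Summable fun j => y j ^ 2

theorem SqSummable.mul {y v : ℤ → ℝ} (hy : SqSummable y) (hv : SqSummable v) :
    Summable fun j => y j * v j := by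
  refine Summable.of_norm_bounded (Summable.add hy hv) fun j => ?_
  rw [Real.norm_eq_abs, abs_le]
  constructor <;> nlinarith [sq_nonneg (y j + v j), sq_nonneg (y j - v j)]

theorem SqSummable.shift {y : ℤ → ℝ} (hy : SqSummable y) (k : ℤ) :
    SqSummable fun j => y (j + k) :=
  (Equiv.addRight k).summable_iff (f := fun j => y j ^ 2) |>.2 hy

theorem SqSummable.add {y v : ℤ → ℝ} (hy : SqSummable y) (hv : SqSummable v) :
    SqSummable fun j => y j + v j := by
  refine (((Summable.add hy hv).add ((hy.mul hv).mul_left 2))).congr fun j => ?_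
  ring

theorem SqSummable.sub {y v : ℤ → ℝ} (hy : SqSummable y) (hv : SqSummable v) :
    SqSummable fun j => y j - v j := by
  refine (((Summable.add hy hv).sub ((hy.mul hv).mul_left 2))).congr fun j => ?_
  ring

theorem SqSummable.const_mul {y : ℤ → ℝ} (hy : SqSummable y) (c : ℝ) :
    SqSummable fun j => c * y j := by
  refine (Summable.mul_left (c ^ 2) hy).congr fun j => ?_
  ring

/-- Summation by parts for the form `Q ⟨∇y, ∇v⟩ + P ⟨∇₊y, ∇₊v⟩ + ⟨W y, v⟩`. -/
def energyForm (P Q : ℝ) (m : ℕ) (W y v : ℤ → ℝ) : ℝ :=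
  Q * (∑' j, (y (j + 1) - y j) * (v (j + 1) - v j))
    + P * (∑' j, (y (j + 1) + y j) * (v (j + 1) + v j))
    + ∑ j ∈ Finset.Icc (1 : ℤ) m, W j * y j * v j

/-- The Euler-Lagrange equation of `energyForm`. -/
def IsStationary (P Q : ℝ) (W y : ℤ → ℝ) : Prop :=
  ∀ j, Q * (2 * y j - y (j + 1) - y (j - 1)) + P * (2 * y j + y (j + 1) + y (j - 1)) + W j * y j = 0

theorem energyForm_eq_zero {P Q : ℝ} {m : ℕ} {W y v : ℤ → ℝ}
    (hW : ∀ j, ¬ (1 ≤ j ∧ j ≤ (m : ℤ)) → W j = 0) (hy : SqSummable y) (hv : SqSummable v)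
    (h : IsStationary P Q W y) : energyForm P Q m W y v = 0 := by
  have h0 : HasSum (fun j => y j * v j) (∑' j, y j * v j) := (hy.mul hv).hasSum
  have h0' : HasSum (fun j => y (j + 1) * v (j + 1)) (∑' j, y j * v j) :=
    (Equiv.addRight (1 : ℤ)).hasSum_iff (f := fun j => y j * v j) |>.2 h0
  have h1 : HasSum (fun j => y (j + 1) * v j) (∑' j, y (j + 1) * v j) :=
    ((hy.shift 1).mul hv).hasSum
  have h2 : HasSum (fun j => y j * v (j + 1)) (∑' j, y j * v (j + 1)) :=
    (hy.mul (hv.shift 1)).hasSum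
  have h2' : HasSum (fun j => y (j - 1) * v j) (∑' j, y j * v (j + 1)) := by
    refine hasSum_of_eq
      ((Equiv.subRight (1 : ℤ)).hasSum_iff (f := fun j => y j * v (j + 1)) |>.2 h2)
      (fun j => ?_) rfl
    simp
  have h3 : HasSum (fun j => W j * y j * v j) (∑ j ∈ Finset.Icc (1 : ℤ) m, W j * y j * v j) := by
    refine hasSum_sum_of_ne_finset_zero fun j hj => ?_
    rw [hW j (by simpa using hj)]
    ring
  have e1 : (∑' j, (y (j + 1) - y j) * (v (j + 1) - v j))
      = 2 * (∑' j, y j * v j) - (∑' j, y (j + 1) * v j) - ∑' j, y j * v (j + 1) := by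
    refine HasSum.tsum_eq ?_
    exact hasSum_of_eq (((h0.add h0').sub h1).sub h2) (fun j => by ring) (by ring)
  have e2 : (∑' j, (y (j + 1) + y j) * (v (j + 1) + v j))
      = 2 * (∑' j, y j * v j) + (∑' j, y (j + 1) * v j) + ∑' j, y j * v (j + 1) := by
    refine HasSum.tsum_eq ?_
    exact hasSum_of_eq (((h0.add h0').add h1).add h2) (fun j => by ring) (by ring)
  have h4 := (((h0.mul_left (2 * (Q + P))).add (h1.mul_left (P - Q))).add
    (h2'.mul_left (P - Q))).add h3
  have h5 : HasSum (fun _ : ℤ => (0 : ℝ)) _ :=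
    hasSum_of_eq h4 (fun j => by linear_combination v j * h j) rfl
  have h6 := h5.unique hasSum_zero
  rw [energyForm, e1, e2]
  linear_combination h6

theorem energyForm_sub {P Q : ℝ} {m : ℕ} {W y v : ℤ → ℝ} (hy : SqSummable y)
    (hv : SqSummable v) :
    energyForm P Q m W (fun j => y j - v j) (fun j => y j - v j)
      = energyForm P Q m W y y - 2 * energyForm P Q m W v y + energyForm P Q m W v v := by
  have key : ∀ a b : ℤ → ℝ, SqSummable a → SqSummable b →
      (∑' j, (a j - b j) * (a j - b j)) = (∑' j, a j * a j) - 2 * (∑' j, b j * a j)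
        + ∑' j, b j * b j := by
    intro a b ha hb
    refine HasSum.tsum_eq ?_
    exact hasSum_of_eq
      (((ha.mul ha).hasSum.sub ((hb.mul ha).hasSum.mul_left 2)).add (hb.mul hb).hasSum)
      (fun j => by ring) rfl
  have k1 := key _ _ ((hy.shift 1).sub hy) ((hv.shift 1).sub hv)
  have k2 := key _ _ ((hy.shift 1).add hy) ((hv.shift 1).add hv)
  have k3 : ∑ j ∈ Finset.Icc (1 : ℤ) m, W j * (y j - v j) * (y j - v j)
      = (∑ j ∈ Finset.Icc (1 : ℤ) m, W j * y j * y j)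
        - 2 * (∑ j ∈ Finset.Icc (1 : ℤ) m, W j * v j * y j)
        + ∑ j ∈ Finset.Icc (1 : ℤ) m, W j * v j * v j := by
    rw [Finset.mul_sum, ← Finset.sum_sub_distrib, ← Finset.sum_add_distrib]
    exact Finset.sum_congr rfl fun j _ => by ring
  have k1' : (∑' j, (y (j + 1) - v (j + 1) - (y j - v j)) * (y (j + 1) - v (j + 1) - (y j - v j)))
      = _ := Eq.trans (tsum_congr fun j => by ring) k1
  have k2' : (∑' j, (y (j + 1) - v (j + 1) + (y j - v j)) * (y (j + 1) - v (j + 1) + (y j - v j)))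
      = _ := Eq.trans (tsum_congr fun j => by ring) k2
  simp only [energyForm]
  rw [k1', k2', k3]
  ring

/-- `∑ (y_{j+1} + y_j)²`. -/
def plusEnergy (y : ℤ → ℝ) : ℝ := ∑' j, (y (j + 1) + y j) * (y (j + 1) + y j)

/-- `∑ (y_{j+1} - y_j)²`. -/
def minusEnergy (y : ℤ → ℝ) : ℝ := ∑' j, (y (j + 1) - y j) * (y (j + 1) - y j)

theorem minusEnergy_nonneg (y : ℤ → ℝ) : 0 ≤ minusEnergy y :=
  tsum_nonneg fun _ => mul_self_nonneg _

theorem SqSummable.tendsto {y : ℤ → ℝ} (hy : SqSummable y) :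
    Tendsto (fun n : ℕ => y n ^ 2) atTop (𝓝 0) := by
  have h1 : Summable fun n : ℕ => y n ^ 2 :=
    Summable.comp_injective (i := fun n : ℕ => (n : ℤ)) hy Nat.cast_injective
  exact h1.tendsto_atTop_zero

theorem plusEnergy_pos {y : ℤ → ℝ} (hy : SqSummable y) {i : ℤ} (hi : y i ≠ 0) :
    0 < plusEnergy y := by
  have hs := ((hy.shift 1).add hy).mul ((hy.shift 1).add hy)
  refine lt_of_le_of_ne (tsum_nonneg fun _ => mul_self_nonneg _) fun h => hi ?_
  have h1 : ∀ j, y (j + 1) + y j = 0 := by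
    intro j
    have := (hasSum_zero_iff_of_nonneg (fun j => mul_self_nonneg (y (j + 1) + y j))).1
      (by rw [show (0 : ℝ) = plusEnergy y from h]; exact hs.hasSum)
    exact mul_self_eq_zero.1 (congrFun this j)
  have h2 : ∀ n : ℕ, y (i + n) ^ 2 = y i ^ 2 := by
    intro n
    induction n with
    | zero => simp
    | succ n ih =>
      have := h1 (i + n)
      rw [← ih, show i + ((n + 1 : ℕ) : ℤ) = i + n + 1 by push_cast; ring,
        eq_neg_of_add_eq_zero_left this]
      ring
  have h3 := (hy.shift i).tendsto
  have h4 : Tendsto (fun _ : ℕ => y i ^ 2) atTop (𝓝 0) :=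
    h3.congr fun n => by rw [add_comm, h2]
  have h5 := tendsto_nhds_unique h4 tendsto_const_nhds
  nlinarith

theorem minusEnergy_add_plusEnergy {y : ℤ → ℝ} (hy : SqSummable y) :
    minusEnergy y + plusEnergy y = 4 * ∑' j, y j ^ 2 := by
  have hs := ((hy.shift 1).add hy).mul ((hy.shift 1).add hy)
  have hs' := ((hy.shift 1).sub hy).mul ((hy.shift 1).sub hy)
  have h1 : HasSum (fun j => y j ^ 2) (∑' j, y j ^ 2) := Summable.hasSum hy
  have h2 : HasSum (fun j => y (j + 1) ^ 2) (∑' j, y j ^ 2) :=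
    (Equiv.addRight (1 : ℤ)).hasSum_iff (f := fun j => y j ^ 2) |>.2 h1
  refine (hs'.hasSum.add hs.hasSum).unique ?_
  exact hasSum_of_eq ((h1.add h2).mul_left 4 |>.div_const 2) (fun j => by ring) (by ring)

theorem sq_sub_le_minusEnergy {y : ℤ → ℝ} (hy : SqSummable y) {m : ℕ} {j : ℤ}
    (hj : j ∈ Finset.Icc (1 : ℤ) m) : (y j - y 1) ^ 2 ≤ m * minusEnergy y := by
  obtain ⟨h1, h2⟩ := Finset.mem_Icc.1 hj
  obtain ⟨n, rfl⟩ := Int.le.dest h1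
  have hs := ((hy.shift 1).sub hy).mul ((hy.shift 1).sub hy)
  have h3 : y (1 + n) - y 1 = ∑ i ∈ Finset.range n, (y (1 + i + 1) - y (1 + i)) := by
    have := Finset.sum_range_sub (fun i : ℕ => y (1 + (i : ℤ))) n
    simp only [Nat.cast_zero, add_zero] at this
    rw [← this]
    refine Finset.sum_congr rfl fun i _ => ?_
    push_cast
    rw [add_assoc]
  have h4 := sq_sum_le_card_mul_sum_sq (s := Finset.range n)
    (f := fun i : ℕ => y (1 + i + 1) - y (1 + i))
  rw [← h3, Finset.card_range] at h4
  have h5 : ∑ i ∈ Finset.range n, (y (1 + i + 1) - y (1 + i)) ^ 2 ≤ minusEnergy y := by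
    have hinj : Function.Injective fun i : ℕ => (1 : ℤ) + i := fun a b h => by
      have : (1 : ℤ) + a = 1 + b := h
      omega
    have h6 := hs.sum_le_tsum ((Finset.range n).map ⟨_, hinj⟩)
      (fun i _ => mul_self_nonneg _)
    rw [Finset.sum_map] at h6
    refine le_trans (le_of_eq (Finset.sum_congr rfl fun i _ => ?_)) h6
    exact sq _
  have h7 : (n : ℝ) ≤ m := by
    have : (n : ℤ) ≤ m := by omega
    exact_mod_cast this
  have h8 := minusEnergy_nonneg y
  calc _ ≤ _ := h4
    _ ≤ n * minusEnergy y := by gcongr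
    _ ≤ _ := by gcongr

/-- The form is positive on sequences vanishing at the first perturbed vertex. -/
theorem energyForm_pos_of_node {P Q : ℝ} {m : ℕ} {W y : ℤ → ℝ} (hP : 0 < P)
    (hQ : m * ∑ j ∈ Finset.Icc (1 : ℤ) m, |W j| ≤ Q) (hy : SqSummable y) (h1 : y 1 = 0)
    {i : ℤ} (hi : y i ≠ 0) : 0 < energyForm P Q m W y y := by
  have h2 : -((∑ j ∈ Finset.Icc (1 : ℤ) m, |W j|) * (m * minusEnergy y))
      ≤ ∑ j ∈ Finset.Icc (1 : ℤ) m, W j * y j * y j := by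
    rw [Finset.sum_mul, ← Finset.sum_neg_distrib]
    refine Finset.sum_le_sum fun j hj => ?_
    have h3 := sq_sub_le_minusEnergy hy hj
    rw [h1, sub_zero] at h3
    have h4 := mul_le_mul_of_nonneg_left h3 (abs_nonneg (W j))
    nlinarith [neg_abs_le (W j), sq_nonneg (y j)]
  have h5 := mul_pos hP (plusEnergy_pos hy hi)
  have h6 := mul_le_mul_of_nonneg_right hQ (minusEnergy_nonneg y)
  change 0 < Q * minusEnergy y + P * plusEnergy y + _
  nlinarith

/-- The form is positive if the perturbation has positive mean and is weak. -/
theorem energyForm_pos_of_sum_pos {P Q ε : ℝ} {m : ℕ} {γ y : ℤ → ℝ} (hP : 0 < P) (hε : 0 < ε)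
    (hγ : 0 < ∑ j ∈ Finset.Icc (1 : ℤ) m, γ j)
    (hQ : ε * ((∑ j ∈ Finset.Icc (1 : ℤ) m, |γ j|) ^ 2 / (∑ j ∈ Finset.Icc (1 : ℤ) m, γ j)
      + ∑ j ∈ Finset.Icc (1 : ℤ) m, |γ j|) * m ≤ Q)
    (hy : SqSummable y) {i : ℤ} (hi : y i ≠ 0) :
    0 < energyForm P Q m (fun j => ε * γ j) y y := by
  set σ := ∑ j ∈ Finset.Icc (1 : ℤ) m, γ j with hσ
  set G := ∑ j ∈ Finset.Icc (1 : ℤ) m, |γ j| with hG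
  have hM := minusEnergy_nonneg y
  set r := √(m * minusEnergy y) with hr
  have hr2 : r ^ 2 = m * minusEnergy y := Real.sq_sqrt (by positivity)
  have hr0 : 0 ≤ r := Real.sqrt_nonneg _
  have h2 : σ * y 1 ^ 2 - G * (2 * |y 1| * r + r ^ 2)
      ≤ ∑ j ∈ Finset.Icc (1 : ℤ) m, γ j * y j ^ 2 := by
    rw [hσ, hG, Finset.sum_mul, Finset.sum_mul, ← Finset.sum_sub_distrib]
    refine Finset.sum_le_sum fun j hj => ?_
    have h3 : |y j - y 1| ≤ r := Real.abs_le_sqrt (sq_sub_le_minusEnergy hy hj)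
    have h4 : |(2 * y 1) * (y j - y 1) + (y j - y 1) ^ 2| ≤ 2 * |y 1| * r + r ^ 2 := by
      refine (abs_add_le _ _).trans (add_le_add ?_ ?_)
      · rw [abs_mul, abs_mul, abs_two]
        gcongr
      · rw [abs_of_nonneg (sq_nonneg _), ← sq_abs]
        gcongr
    have h5 : -(|γ j| * (2 * |y 1| * r + r ^ 2))
        ≤ γ j * ((2 * y 1) * (y j - y 1) + (y j - y 1) ^ 2) := by
      refine (neg_le_neg ?_).trans (neg_abs_le _)
      rw [abs_mul]
      gcongr
    nlinarith
  have h6 : -((G ^ 2 / σ + G) * r ^ 2) ≤ σ * y 1 ^ 2 - G * (2 * |y 1| * r + r ^ 2) := by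
    have h7 : 0 ≤ (σ * |y 1| - G * r) ^ 2 / σ := by positivity
    have h8 : (σ * |y 1| - G * r) ^ 2 / σ = σ * y 1 ^ 2 - G * (2 * |y 1| * r) + G ^ 2 / σ * r ^ 2 := by
      rw [← sq_abs (y 1)]
      field_simp
      ring
    linarith
  have h9 := mul_pos hP (plusEnergy_pos hy hi)
  have h10 := mul_le_mul_of_nonneg_right hQ hM
  have h11 : ∑ j ∈ Finset.Icc (1 : ℤ) m, ε * γ j * y j * y j
      = ε * ∑ j ∈ Finset.Icc (1 : ℤ) m, γ j * y j ^ 2 := by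
    rw [Finset.mul_sum]
    exact Finset.sum_congr rfl fun j _ => by ring
  have h12 := mul_le_mul_of_nonneg_left (h6.trans h2) hε.le
  change 0 < Q * minusEnergy y + P * plusEnergy y + _
  rw [h11]
  rw [hr2] at h12
  linarith

/-- The form is positive if its unperturbed part is large. -/
theorem energyForm_pos_of_large {P Q κ : ℝ} {m : ℕ} {W y : ℤ → ℝ} (hP : κ ≤ P) (hQ : κ ≤ Q)
    (hW : ∑ j ∈ Finset.Icc (1 : ℤ) m, |W j| < 4 * κ)
    (hy : SqSummable y) {i : ℤ} (hi : y i ≠ 0) : 0 < energyForm P Q m W y y := by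
  have hN : 0 < ∑' j, y j ^ 2 :=
    Summable.tsum_pos hy (fun _ => sq_nonneg _) i (by positivity)
  have h1 := minusEnergy_add_plusEnergy hy
  have h2 : -((∑ j ∈ Finset.Icc (1 : ℤ) m, |W j|) * ∑' j, y j ^ 2)
      ≤ ∑ j ∈ Finset.Icc (1 : ℤ) m, W j * y j * y j := by
    rw [Finset.sum_mul, ← Finset.sum_neg_distrib]
    refine Finset.sum_le_sum fun j hj => ?_
    have h3 : y j ^ 2 ≤ ∑' j, y j ^ 2 := Summable.le_tsum hy j fun _ _ => sq_nonneg _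
    have h4 := mul_le_mul_of_nonneg_left h3 (abs_nonneg (W j))
    nlinarith [neg_abs_le (W j), sq_nonneg (y j)]
  have h5 := mul_le_mul_of_nonneg_right hP
    (show 0 ≤ plusEnergy y from tsum_nonneg fun j => mul_self_nonneg (y (j + 1) + y j))
  have h6 := mul_le_mul_of_nonneg_right hQ (minusEnergy_nonneg y)
  have h7 := mul_lt_mul_of_pos_right hW hN
  have h8 : κ * (minusEnergy y + plusEnergy y) = κ * (4 * ∑' j, y j ^ 2) := by rw [h1]
  change 0 < Q * minusEnergy y + P * plusEnergy y + _
  nlinarith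

/-- Strict monotonicity of the form excludes two stationary sequences at different parameters. -/
theorem not_stationary_of_lt {P₁ Q₁ P₂ Q₂ : ℝ} {m : ℕ} {W y v : ℤ → ℝ}
    (hW : ∀ j, ¬ (1 ≤ j ∧ j ≤ (m : ℤ)) → W j = 0)
    (hP : P₂ < P₁) (hQ : Q₂ ≤ Q₁) (hP₂ : 0 < P₂)
    (hQ₂ : m * ∑ j ∈ Finset.Icc (1 : ℤ) m, |W j| ≤ Q₂)
    (hy : SqSummable y) (hv : SqSummable v) (hy1 : y 1 = 1) (hv1 : v 1 = 1)
    (hys : IsStationary P₁ Q₁ W y) : ¬ IsStationary P₂ Q₂ W v := by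
  intro hvs
  have h1 : energyForm P₂ Q₂ m W (fun j => y j - v j) (fun j => y j - v j)
      = energyForm P₂ Q₂ m W y y := by
    rw [energyForm_sub hy hv, energyForm_eq_zero hW hv hy hvs, energyForm_eq_zero hW hv hv hvs]
    ring
  have h2 : energyForm P₂ Q₂ m W y y < 0 := by
    have h3 : energyForm P₁ Q₁ m W y y = 0 := energyForm_eq_zero hW hy hy hys
    have h4 := mul_lt_mul_of_pos_right hP (plusEnergy_pos hy (i := 1) (by rw [hy1]; norm_num))
    have h5 := mul_le_mul_of_nonneg_right hQ (minusEnergy_nonneg y)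
    change Q₁ * minusEnergy y + P₁ * plusEnergy y + _ = 0 at h3
    change Q₂ * minusEnergy y + P₂ * plusEnergy y + _ < 0
    linarith
  rw [← h1] at h2
  by_cases h : ∃ i, y i - v i ≠ 0
  · obtain ⟨i, hi⟩ := h
    exact absurd (energyForm_pos_of_node hP₂ hQ₂ (hy.sub hv) (by rw [hy1, hv1, sub_self]) hi)
      h2.not_gt
  · push Not at h
    simp [energyForm, h] at h2

/-! ### The Jost solution -/

theorem isStationary_iff {P Q : ℝ} (hPQ : P < Q) {W y : ℤ → ℝ} :
    IsStationary P Q W y ↔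
      ∀ j, y (j + 1) + y (j - 1) = (2 * ((P + Q) / (Q - P)) + W j / (Q - P)) * y j := by
  have h0 : Q - P ≠ 0 := by linarith
  refine forall_congr' fun j => ?_
  rw [show (2 * ((P + Q) / (Q - P)) + W j / (Q - P)) * y j
    = ((2 * (P + Q) + W j) * y j) / (Q - P) by field_simp, eq_div_iff h0]
  constructor <;> intro h <;> linarith

/-- The solution of `y (n + 1) + y (n - 1) = (z + z⁻¹ + β n) y n` with `y 0 = z`, `y 1 = 1`. -/
def jostSeq (z : ℝ) (β : ℤ → ℝ) : ℕ → ℝ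
  | 0 => z
  | 1 => 1
  | n + 2 => (z + z⁻¹ + β (n + 1)) * jostSeq z β (n + 1) - jostSeq z β n

/-- The Jost function: it vanishes iff the solution decaying to the left also decays to the
right. -/
def jostFun (z : ℝ) (β : ℤ → ℝ) (m : ℕ) : ℝ := jostSeq z β (m + 1) - z * jostSeq z β m

theorem continuousOn_jostSeq {X : Type*} [TopologicalSpace X] {s : Set X} {z : X → ℝ}
    {β : X → ℤ → ℝ} (hz : ContinuousOn z s) (hz0 : ∀ x ∈ s, z x ≠ 0)
    (hβ : ∀ j, ContinuousOn (fun x => β x j) s) :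
    ∀ n, ContinuousOn (fun x => jostSeq (z x) (β x) n) s
  | 0 => hz
  | 1 => continuousOn_const
  | n + 2 => ((hz.add (hz.inv₀ hz0)).add (hβ _)).mul
      (continuousOn_jostSeq hz hz0 hβ (n + 1)) |>.sub (continuousOn_jostSeq hz hz0 hβ n)

theorem continuousOn_jostFun {X : Type*} [TopologicalSpace X] {s : Set X} {z : X → ℝ}
    {β : X → ℤ → ℝ} (hz : ContinuousOn z s) (hz0 : ∀ x ∈ s, z x ≠ 0)
    (hβ : ∀ j, ContinuousOn (fun x => β x j) s) (m : ℕ) :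
    ContinuousOn (fun x => jostFun (z x) (β x) m) s :=
  (continuousOn_jostSeq hz hz0 hβ (m + 1)).sub (hz.mul (continuousOn_jostSeq hz hz0 hβ m))

theorem jostSeq_zero_potential {z : ℝ} (hz : z ≠ 0) :
    ∀ n, jostSeq z (fun _ => 0) n = z * (z⁻¹) ^ n
  | 0 => by simp [jostSeq]
  | 1 => by simp [jostSeq, hz]
  | n + 2 => by
    rw [jostSeq, jostSeq_zero_potential hz (n + 1), jostSeq_zero_potential hz n]
    linear_combination z * z⁻¹ ^ n * mul_inv_cancel₀ hz

theorem jostFun_zero_potential_pos {z : ℝ} (hz : 0 < z) (hz1 : z < 1) (m : ℕ) :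
    0 < jostFun z (fun _ => 0) m := by
  rw [jostFun, jostSeq_zero_potential hz.ne', jostSeq_zero_potential hz.ne', pow_succ]
  have h1 : 1 < z⁻¹ := (one_lt_inv₀ hz).2 hz1
  have h2 : 0 < z⁻¹ ^ m := by positivity
  have : 0 < z * z⁻¹ ^ m * (z⁻¹ - z) := mul_pos (mul_pos hz h2) (by linarith)
  linarith

theorem exists_decaying_of_jostFun_eq_zero {z : ℝ} (hz : 0 < z) (hz1 : z < 1) {β : ℤ → ℝ} {m : ℕ}
    (hm : 1 ≤ m) (hβ : ∀ j, ¬ (1 ≤ j ∧ j ≤ (m : ℤ)) → β j = 0) (h : jostFun z β m = 0) :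
    ∃ y : ℤ → ℝ, SqSummable y ∧ y 1 = 1 ∧
      ∀ j, y (j + 1) + y (j - 1) = (z + z⁻¹ + β j) * y j := by
  set c := jostSeq z β m with hc
  set y : ℤ → ℝ := fun j => if j ≤ 0 then z * z ^ (-j).toNat else
    if j ≤ m then jostSeq z β j.toNat else c * z ^ (j - m).toNat with hy
  have y_neg : ∀ n : ℕ, y (-(n : ℤ)) = z * z ^ n := by
    intro n
    simp [hy]
  have y_mid : ∀ n : ℕ, n ≤ m + 1 → y n = jostSeq z β n := by
    intro n hn
    rcases Nat.eq_zero_or_pos n with rfl | h0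
    · simp [hy, jostSeq]
    · rcases hn.lt_or_eq with h1 | rfl
      · have h2 : ¬ ((n : ℤ) ≤ 0) := by omega
        have h3 : (n : ℤ) ≤ m := by omega
        simp [hy, h3, h0.ne']
      · have h2 : ¬ (((m + 1 : ℕ) : ℤ) ≤ 0) := by omega
        have h3 : ¬ (((m + 1 : ℕ) : ℤ) ≤ m) := by omega
        have h4 : (((m + 1 : ℕ) : ℤ) - m).toNat = 1 := by omega
        simp only [hy]
        rw [if_neg h2, if_neg h3, h4, pow_one]
        rw [jostFun] at h
        linarith
  have y_right : ∀ n : ℕ, y (m + n) = c * z ^ n := by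
    intro n
    rcases Nat.eq_zero_or_pos n with rfl | h0
    · rw [Nat.cast_zero, add_zero, y_mid m (by omega), pow_zero, mul_one]
    · have h2 : ¬ ((m : ℤ) + n ≤ 0) := by omega
      have h3 : ¬ ((m : ℤ) + n ≤ m) := by omega
      have h4 : ((m : ℤ) + n - m).toNat = n := by omega
      simp only [hy]
      rw [if_neg h2, if_neg h3, h4]
  have hgeom : ∀ d : ℝ, Summable fun n : ℕ => (d * z ^ n) ^ 2 := by
    intro d
    refine ((summable_geometric_of_lt_one (sq_nonneg z) (by nlinarith : z ^ 2 < 1)).mul_left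
      (d ^ 2)).congr fun n => ?_
    rw [mul_pow, ← pow_mul, ← pow_mul, mul_comm 2 n]
  refine ⟨y, ?_, ?_, ?_⟩
  · refine Summable.of_nat_of_neg ?_ ?_
    · rw [← summable_nat_add_iff m]
      refine (hgeom c).congr fun n => ?_
      rw [← y_right n]
      push_cast
      rw [add_comm]
    · refine (hgeom z).congr fun n => ?_
      rw [y_neg n]
  · have := y_mid 1 (by omega)
    simpa [jostSeq] using this
  · intro j
    rcases le_or_gt j 0 with hj | hj
    · obtain ⟨n, hn⟩ := Int.eq_ofNat_of_zero_le (show 0 ≤ -j by omega)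
      obtain rfl : j = -(n : ℤ) := by omega
      rw [hβ _ (by omega), add_zero, y_neg, show -(n : ℤ) - 1 = -((n + 1 : ℕ) : ℤ) by
        push_cast; ring, y_neg]
      rcases Nat.eq_zero_or_pos n with rfl | h0
      · have h1 := y_mid 1 (by omega)
        simp only [Nat.cast_one, jostSeq] at h1
        simp only [Nat.cast_zero, neg_zero, zero_add, h1]
        field_simp
        ring
      · obtain ⟨k, rfl⟩ := Nat.exists_eq_succ_of_ne_zero h0.ne'
        rw [show -((k.succ : ℕ) : ℤ) + 1 = -(k : ℤ) by push_cast; ring, y_neg]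
        rw [Nat.succ_eq_add_one]
        field_simp
        ring
    · rcases le_or_gt j m with hjm | hjm
      · obtain ⟨n, hn⟩ := Int.eq_ofNat_of_zero_le (show 0 ≤ j - 1 by omega)
        obtain rfl : j = ((n + 1 : ℕ) : ℤ) := by push_cast; omega
        rw [show ((n + 1 : ℕ) : ℤ) + 1 = ((n + 2 : ℕ) : ℤ) by push_cast; ring,
          show ((n + 1 : ℕ) : ℤ) - 1 = (n : ℤ) by push_cast; ring, y_mid _ (by omega),
          y_mid _ (by omega), y_mid _ (by omega), jostSeq]
        push_cast
        ring
      · obtain ⟨n, hn⟩ := Int.eq_ofNat_of_zero_le (show 0 ≤ j - m - 1 by omega)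
        obtain rfl : j = m + ((n + 1 : ℕ) : ℤ) := by push_cast; omega
        rw [hβ _ (by omega), add_zero, y_right,
          show (m : ℤ) + ((n + 1 : ℕ) : ℤ) + 1 = m + ((n + 2 : ℕ) : ℤ) by push_cast; ring,
          show (m : ℤ) + ((n + 1 : ℕ) : ℤ) - 1 = m + (n : ℤ) by push_cast; ring, y_right, y_right]
        field_simp
        ring

/-- The Jost function is positive where the form is. -/
theorem jostFun_pos {P Q z : ℝ} {m : ℕ} {W : ℤ → ℝ} (hm : 1 ≤ m)
    (hW : ∀ j, ¬ (1 ≤ j ∧ j ≤ (m : ℤ)) → W j = 0) (hz : 0 < z) (hz1 : z < 1) (hPQ : P < Q)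
    (hzPQ : z + z⁻¹ = 2 * ((P + Q) / (Q - P)))
    (hP : ∑ j ∈ Finset.Icc (1 : ℤ) m, |W j| < 4 * P) :
    0 < jostFun z (fun j => W j / (Q - P)) m := by
  by_contra! hneg
  have hcont : ContinuousOn (fun t : ℝ => jostFun z (fun j => t * W j / (Q - P)) m)
      (Set.uIcc 0 1) :=
    continuousOn_jostFun continuousOn_const (fun _ _ => hz.ne')
      (fun j => Continuous.continuousOn (by fun_prop)) m
  have h0 : 0 < jostFun z (fun j => (0 : ℝ) * W j / (Q - P)) m := by
    simpa using jostFun_zero_potential_pos hz hz1 m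
  have h1 : jostFun z (fun j => (1 : ℝ) * W j / (Q - P)) m ≤ 0 := by simpa using hneg
  obtain ⟨t, ht, hjt⟩ := intermediate_value_uIcc hcont (Set.mem_uIcc.2 (Or.inr ⟨h1, h0.le⟩))
  rw [Set.uIcc_of_le zero_le_one] at ht
  obtain ⟨y, hy, hy1, hrec⟩ := exists_decaying_of_jostFun_eq_zero hz hz1 hm
    (fun j hj => by simp [hW j hj]) hjt
  have hst : IsStationary P Q (fun j => t * W j) y := by
    rw [isStationary_iff hPQ]
    intro j
    rw [← hzPQ]
    exact hrec j
  have h2 := energyForm_eq_zero (m := m) (fun j hj => by simp [hW j hj]) hy hy hst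
  have h3 : ∑ j ∈ Finset.Icc (1 : ℤ) m, |t * W j| < 4 * P := by
    refine lt_of_le_of_lt (Finset.sum_le_sum fun j _ => ?_) hP
    rw [abs_mul, abs_of_nonneg ht.1]
    exact mul_le_of_le_one_left (abs_nonneg _) ht.2
  exact (energyForm_pos_of_large le_rfl hPQ.le h3 hy (i := 1) (by rw [hy1]; norm_num)).ne' h2

theorem abs_jostSeq_one_sub_le {β : ℤ → ℝ} {m : ℕ}
    (hβ : 2 * m * ∑ j ∈ Finset.Icc (1 : ℤ) m, |β j| ≤ 1) (n : ℕ) (hn : n ≤ m) :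
    jostSeq 1 β (n + 1) - jostSeq 1 β n = ∑ j ∈ Finset.Icc (1 : ℤ) n, β j * jostSeq 1 β j.toNat ∧
    |jostSeq 1 β (n + 1) - jostSeq 1 β n| ≤ 2 * ∑ j ∈ Finset.Icc (1 : ℤ) m, |β j| ∧
    |jostSeq 1 β n - 1| ≤ n * (2 * ∑ j ∈ Finset.Icc (1 : ℤ) m, |β j|) := by
  set g := ∑ j ∈ Finset.Icc (1 : ℤ) m, |β j| with hg
  have hg0 : 0 ≤ g := Finset.sum_nonneg fun _ _ => abs_nonneg _
  induction n using Nat.strong_induction_on with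
  | _ n ih =>
  have h3 : |jostSeq 1 β n - 1| ≤ n * (2 * g) := by
    rcases Nat.eq_zero_or_pos n with rfl | h0
    · simp [jostSeq]
    · obtain ⟨k, rfl⟩ := Nat.exists_eq_succ_of_ne_zero h0.ne'
      obtain ⟨-, h1, h2⟩ := ih k (Nat.lt_succ_self k) (by omega)
      have : |jostSeq 1 β (k + 1) - 1| ≤ |jostSeq 1 β (k + 1) - jostSeq 1 β k|
          + |jostSeq 1 β k - 1| := by
        refine le_trans (le_of_eq ?_) (abs_add_le _ _)
        congr 1
        ring
      push_cast
      rw [Nat.succ_eq_add_one]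
      linarith
  have h1 : jostSeq 1 β (n + 1) - jostSeq 1 β n
      = ∑ j ∈ Finset.Icc (1 : ℤ) n, β j * jostSeq 1 β j.toNat := by
    rcases Nat.eq_zero_or_pos n with rfl | h0
    · simp [jostSeq]
    · obtain ⟨k, rfl⟩ := Nat.exists_eq_succ_of_ne_zero h0.ne'
      obtain ⟨h1, -, -⟩ := ih k (Nat.lt_succ_self k) (by omega)
      have h4 : Finset.Icc (1 : ℤ) ((k.succ : ℕ) : ℤ)
          = insert ((k.succ : ℕ) : ℤ) (Finset.Icc (1 : ℤ) k) := by
        ext j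
        simp only [Finset.mem_insert, Finset.mem_Icc]
        push_cast
        omega
      rw [h4, Finset.sum_insert (by simp), ← h1, Int.toNat_natCast]
      rw [Nat.succ_eq_add_one, jostSeq]
      push_cast
      ring
  refine ⟨h1, ?_, h3⟩
  rw [h1, hg, Finset.mul_sum]
  refine (Finset.abs_sum_le_sum_abs _ _).trans ?_
  have hsub : Finset.Icc (1 : ℤ) n ⊆ Finset.Icc (1 : ℤ) m :=
    Finset.Icc_subset_Icc_right (by exact_mod_cast hn)
  refine le_trans (Finset.sum_le_sum fun j hj => ?_)
    (Finset.sum_le_sum_of_subset_of_nonneg hsub fun j _ _ => by positivity)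
  obtain ⟨hj1, hj2⟩ := Finset.mem_Icc.1 hj
  have hle : |jostSeq 1 β j.toNat - 1| ≤ 1 := by
    have hnm : (m : ℝ) * (2 * g) ≤ 1 := by linarith
    have hmono : ∀ k : ℕ, k ≤ m → (k : ℝ) * (2 * g) ≤ 1 := fun k hk =>
      le_trans (by gcongr) hnm
    rcases (show j.toNat ≤ n by omega).lt_or_eq with h | h
    · exact (ih _ h (by omega)).2.2.trans (hmono _ (by omega))
    · rw [h]
      exact h3.trans (hmono n hn)
  rw [abs_mul, mul_comm]
  have : |jostSeq 1 β j.toNat| ≤ 2 := by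
    have := abs_le.1 hle
    rw [abs_le]
    constructor <;> linarith [this.1, this.2]
  gcongr

/-- At the edge of a band the Jost function has the sign of the mean of a weak perturbation. -/
theorem jostFun_one_neg {γ : ℤ → ℝ} {m : ℕ} {l : ℝ} (hl : 0 < l)
    (h1 : l * (2 * m * ∑ j ∈ Finset.Icc (1 : ℤ) m, |γ j|) ≤ 1)
    (h2 : l * (2 * m * (∑ j ∈ Finset.Icc (1 : ℤ) m, |γ j|) ^ 2)
      < -∑ j ∈ Finset.Icc (1 : ℤ) m, γ j) :
    jostFun 1 (fun j => l * γ j) m < 0 := by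
  have hg : ∑ j ∈ Finset.Icc (1 : ℤ) m, |l * γ j| = l * ∑ j ∈ Finset.Icc (1 : ℤ) m, |γ j| := by
    rw [Finset.mul_sum]
    exact Finset.sum_congr rfl fun j _ => by rw [abs_mul, abs_of_pos hl]
  set G := ∑ j ∈ Finset.Icc (1 : ℤ) m, |γ j| with hG
  have hG0 : 0 ≤ G := Finset.sum_nonneg fun _ _ => abs_nonneg _
  have key := abs_jostSeq_one_sub_le (β := fun j => l * γ j) (m := m)
    (by rw [hg]; linarith)
  rw [jostFun, one_mul, (key m le_rfl).1]
  have h3 : ∑ j ∈ Finset.Icc (1 : ℤ) m, l * γ j * jostSeq 1 (fun j => l * γ j) j.toNat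
      ≤ ∑ j ∈ Finset.Icc (1 : ℤ) m, (l * γ j + l * (|γ j| * (m * (2 * (l * G))))) := by
    refine Finset.sum_le_sum fun j hj => ?_
    obtain ⟨hj1, hj2⟩ := Finset.mem_Icc.1 hj
    have h4 := (key j.toNat (by omega)).2.2
    rw [hg] at h4
    have h5 : |jostSeq 1 (fun j => l * γ j) j.toNat - 1| ≤ m * (2 * (l * G)) := by
      refine h4.trans ?_
      have : j.toNat ≤ m := by omega
      gcongr
    have h6 : γ j * (jostSeq 1 (fun j => l * γ j) j.toNat - 1) ≤ |γ j| * (m * (2 * (l * G))) := by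
      refine (le_abs_self _).trans ?_
      rw [abs_mul]
      gcongr
    nlinarith
  refine h3.trans_lt ?_
  rw [Finset.sum_add_distrib, ← Finset.mul_sum, ← Finset.mul_sum, ← Finset.sum_mul, ← hG]
  have : l * ((∑ j ∈ Finset.Icc (1 : ℤ) m, γ j) + l * (2 * m * G ^ 2)) < 0 :=
    mul_neg_of_pos_of_neg hl (by linarith)
  linarith

/-! ### Integration by parts -/

theorem absolutelyContinuousOnInterval_const (c : ℂ) (a b : ℝ) :
    AbsolutelyContinuousOnInterval (fun _ : ℝ => c) a b :=
  (LipschitzWith.const' (K := 0) c).lipschitzOnWith.absolutelyContinuousOnInterval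

theorem absolutelyContinuousOnInterval_integral {f : ℝ → ℂ} {a b : ℝ}
    (hf : IntervalIntegrable f volume a b) :
    AbsolutelyContinuousOnInterval (fun x => ∫ t in a..x, f t) a b := by
  have hre : IntervalIntegrable (fun x => (f x).re) volume a b := ⟨hf.1.re, hf.2.re⟩
  have him : IntervalIntegrable (fun x => (f x).im) volume a b := ⟨hf.1.im, hf.2.im⟩
  have h1 := (hre.absolutelyContinuousOnInterval_intervalIntegral Set.left_mem_uIcc).fun_smul
    (absolutelyContinuousOnInterval_const 1 a b)
  have h2 := (him.absolutelyContinuousOnInterval_intervalIntegral Set.left_mem_uIcc).fun_smul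
    (absolutelyContinuousOnInterval_const Complex.I a b)
  have h3 := h1.add h2
  rw [absolutelyContinuousOnInterval_iff] at h3 ⊢
  intro ε hε
  obtain ⟨δ, hδ, h⟩ := h3 ε hε
  refine ⟨δ, hδ, fun E hE hlt => ?_⟩
  have hval : ∀ x ∈ Set.uIcc a b, ∫ t in a..x, f t =
      (∫ t in a..x, (f t).re) • (1 : ℂ) + (∫ t in a..x, (f t).im) • Complex.I := by
    intro x hx
    have hsub : Set.uIcc a x ⊆ Set.uIcc a b := Set.uIcc_subset_uIcc_left hx
    have hr : IntervalIntegrable (fun x => ((f x).re : ℂ)) volume a x :=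
      ⟨(hre.mono_set hsub).1.ofReal, (hre.mono_set hsub).2.ofReal⟩
    have hi : IntervalIntegrable (fun x => ((f x).im : ℂ)) volume a x :=
      ⟨(him.mono_set hsub).1.ofReal, (him.mono_set hsub).2.ofReal⟩
    rw [Complex.real_smul, Complex.real_smul, ← intervalIntegral.integral_ofReal,
      ← intervalIntegral.integral_ofReal, mul_one, ← intervalIntegral.integral_mul_const,
      ← intervalIntegral.integral_add hr (hi.mul_const _)]
    exact intervalIntegral.integral_congr fun t _ => (Complex.re_add_im (f t)).symm
  refine lt_of_eq_of_lt (Finset.sum_congr rfl fun i hi => ?_) (h E hE hlt)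
  rw [hval _ (hE.1 i hi).1, hval _ (hE.1 i hi).2]
  rfl

/-- The product of a primitive with a continuously differentiable function. -/
theorem primitive_mul {a b : ℝ} (hab : a ≤ b) {F f φ φ' : ℝ → ℂ}
    (hf : IntervalIntegrable f volume a b)
    (hF : ∀ x ∈ Set.Icc a b, F x = F a + ∫ t in a..x, f t)
    (hφ : ∀ x, HasDerivAt φ (φ' x) x) (hφ' : Continuous φ') :
    ∀ x ∈ Set.Icc a b, F x * φ x = F a * φ a + ∫ t in a..x, (f t * φ t + F t * φ' t) := by
  have hφc : Continuous φ := continuous_iff_continuousAt.2 fun x => (hφ x).continuousAt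
  have hFc : ContinuousOn F (Set.uIcc a b) := by
    rw [Set.uIcc_of_le hab]
    exact continuousOn_of_primitive hab hf hF
  set g : ℝ → ℂ := fun t => f t * φ t + F t * φ' t with hg
  have hgi : IntervalIntegrable g volume a b :=
    (hf.mul_continuousOn hφc.continuousOn).add
      ((hFc.mul hφ'.continuousOn).intervalIntegrable)
  have hφi : ∀ x, φ x = φ a + ∫ t in a..x, φ' t := by
    intro x
    rw [intervalIntegral.integral_eq_sub_of_hasDerivAt (fun t _ => hφ t)
      (hφ'.intervalIntegrable _ _)]
    ring
  have ac1 : AbsolutelyContinuousOnInterval (fun x => F a + ∫ t in a..x, f t) a b :=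
    (absolutelyContinuousOnInterval_const (F a) a b).add (absolutelyContinuousOnInterval_integral hf)
  have ac2 : AbsolutelyContinuousOnInterval φ a b := by
    rw [show φ = fun x => φ a + ∫ t in a..x, φ' t from funext hφi]
    exact (absolutelyContinuousOnInterval_const (φ a) a b).add
      (absolutelyContinuousOnInterval_integral (hφ'.intervalIntegrable _ _))
  have ac := (ac1.fun_smul ac2).sub (absolutelyContinuousOnInterval_integral hgi)
  obtain ⟨C, hC⟩ := ac.const_of_ae_hasDerivAt_zero (by
    filter_upwards [hf.ae_hasDerivAt_integral, hgi.ae_hasDerivAt_integral] with x h1 h2 hx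
    have d1 := (h1 hx a Set.left_mem_uIcc).const_add (F a)
    have d2 := h2 hx a Set.left_mem_uIcc
    refine ((d1.fun_mul (hφ x)).sub d2).congr_deriv ?_
    rw [Set.uIcc_of_le hab] at hx
    simp only [hg]
    rw [hF x hx]
    ring)
  intro x hx
  have e1 := hC x (by rwa [Set.uIcc_of_le hab])
  have e2 := hC a Set.left_mem_uIcc
  simp only [Pi.sub_apply, smul_eq_mul, intervalIntegral.integral_same, add_zero, sub_zero]
    at e1 e2
  rw [← hF x hx, ← e2] at e1
  rw [← e1]
  ring

/-- Green's formula on a part of an edge. -/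
theorem IsSobolevTwo.green {j : ℤ} {u u' u'' : ℝ → ℂ} (h : IsSobolevTwo j u u' u'')
    {φ φ' φ'' : ℝ → ℂ} (hφ : ∀ x, HasDerivAt φ (φ' x) x) (hφ' : ∀ x, HasDerivAt φ' (φ'' x) x)
    (hφ'' : Continuous φ'') {x : ℝ} (hx : x ∈ Set.Icc (j * Real.pi) ((j + 1) * Real.pi)) :
    ∫ t in (j * Real.pi)..x, (u'' t * φ t - u t * φ'' t)
      = (u' x * φ x - u x * φ' x) - (u' (j * Real.pi) * φ (j * Real.pi)
        - u (j * Real.pi) * φ' (j * Real.pi)) := by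
  have hφc : Continuous φ := continuous_iff_continuousAt.2 fun x => (hφ x).continuousAt
  have hφc' : Continuous φ' := continuous_iff_continuousAt.2 fun x => (hφ' x).continuousAt
  have e1 := primitive_mul (vertex_le j) h.intervalIntegrable_two h.deriv_two hφ hφc' x hx
  have e2 := primitive_mul (vertex_le j) h.intervalIntegrable_one h.deriv_one hφ' hφ'' x hx
  have hu := continuousOn_of_primitive (vertex_le j) h.intervalIntegrable_one h.deriv_one
  have hu' := continuousOn_of_primitive (vertex_le j) h.intervalIntegrable_two h.deriv_two
  rw [← Set.uIcc_of_le (vertex_le j)] at hu hu'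
  have hi2 := h.intervalIntegrable_two.mono_set (uIcc_sub hx)
  have hi1 := h.intervalIntegrable_one.mono_set (uIcc_sub hx)
  have i1 : IntervalIntegrable (fun t => u'' t * φ t + u' t * φ' t) volume (j * Real.pi) x :=
    (hi2.mul_continuousOn hφc.continuousOn).add (hi1.mul_continuousOn hφc'.continuousOn)
  have i2 : IntervalIntegrable (fun t => u' t * φ' t + u t * φ'' t) volume (j * Real.pi) x :=
    (hi1.mul_continuousOn hφc'.continuousOn).add
      ((hu.mono (uIcc_sub hx)).mul hφ''.continuousOn).intervalIntegrable
  have e3 := intervalIntegral.integral_sub i1 i2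
  rw [intervalIntegral.integral_congr (g := fun t => u'' t * φ t - u t * φ'' t)
    (fun t _ => by ring)] at e3
  rw [e3]
  linear_combination e2 - e1

/-! ### Gauge transformations -/

theorem IsSobolevTwo.memLp_zero_one {j : ℤ} {u u' u'' : ℝ → ℂ} (h : IsSobolevTwo j u u' u'') :
    MemLp u 2 (volume.restrict (edge j)) ∧ MemLp u' 2 (volume.restrict (edge j)) := by
  have hf : IsFiniteMeasure ((volume : Measure ℝ).restrict (edge j)) := ⟨by simp [edge]⟩
  have key : ∀ v : ℝ → ℂ, ContinuousOn v (Set.Icc (j * Real.pi) ((j + 1) * Real.pi)) →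
      MemLp v 2 (volume.restrict (edge j)) := by
    intro v hv
    obtain ⟨C, hC⟩ := isCompact_Icc.exists_bound_of_continuousOn hv
    refine MemLp.of_bound ((hv.mono Set.Ioo_subset_Icc_self).aestronglyMeasurable
      measurableSet_Ioo) C ?_
    exact (ae_restrict_iff' measurableSet_Ioo).2
      (Eventually.of_forall fun x hx => hC x (Set.Ioo_subset_Icc_self hx))
  exact ⟨key u (continuousOn_of_primitive (vertex_le j) h.intervalIntegrable_one h.deriv_one),
    key u' (continuousOn_of_primitive (vertex_le j) h.intervalIntegrable_two h.deriv_two)⟩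

/-- The phase `exp(iθx)`. -/
def phase (θ x : ℝ) : ℂ := Complex.exp (Complex.I * (θ * x : ℝ))

theorem norm_phase (θ x : ℝ) : ‖phase θ x‖ = 1 := by
  rw [phase, mul_comm]
  exact Complex.norm_exp_ofReal_mul_I _

theorem hasDerivAt_phase (θ x : ℝ) : HasDerivAt (phase θ) (Complex.I * θ * phase θ x) x := by
  have h1 : HasDerivAt (fun x : ℝ => Complex.I * ((θ * x : ℝ) : ℂ)) (Complex.I * θ) x := by
    have := (((hasDerivAt_id' x).const_mul θ).ofReal_comp).const_mul Complex.I
    simpa using this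
  refine h1.cexp.congr_deriv ?_
  rw [phase]
  ring

theorem continuous_phase (θ : ℝ) : Continuous (phase θ) :=
  continuous_iff_continuousAt.2 fun x => (hasDerivAt_phase θ x).continuousAt

theorem phase_neg_mul (θ x : ℝ) : phase (-θ) x * phase θ x = 1 := by
  rw [phase, phase, ← Complex.exp_add]
  simp

theorem phase_vertex (n : ℤ) (s : Fin 2) (j : ℤ) :
    phase (orientation s * n) (j * Real.pi) = phase n (j * Real.pi) := by
  fin_cases s
  · simp [orientation]
  · simp only [orientation, phase]
    rw [Complex.exp_eq_exp_iff_exists_int]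
    refine ⟨-(n * j), ?_⟩
    simp
    ring

theorem IsSobolevTwo.phase_mul {j : ℤ} {u u' u'' : ℝ → ℂ} (h : IsSobolevTwo j u u' u'')
    (θ : ℝ) :
    IsSobolevTwo j (fun x => phase θ x * u x)
      (fun x => phase θ x * (u' x + Complex.I * θ * u x))
      (fun x => phase θ x * (u'' x + 2 * (Complex.I * θ) * u' x + (Complex.I * θ) ^ 2 * u x)) := by
  have hp : Continuous fun x => Complex.I * θ * phase θ x :=
    continuous_const.mul (continuous_phase θ)
  refine ⟨?_, ?_, ?_⟩
  · have h1 := (h.memLp.add (h.memLp_zero_one.2.const_mul (2 * (Complex.I * θ)))).add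
      (h.memLp_zero_one.1.const_mul ((Complex.I * θ) ^ 2))
    refine h1.congr_norm ((continuous_phase θ).aestronglyMeasurable.mul h1.1)
      (Eventually.of_forall fun x => ?_)
    rw [norm_mul, norm_phase, one_mul]
    rfl
  · intro x hx
    have e := primitive_mul (vertex_le j) h.intervalIntegrable_one h.deriv_one
      (hasDerivAt_phase θ) hp x hx
    rw [mul_comm, e, mul_comm]
    congr 1
    exact intervalIntegral.integral_congr fun t _ => by ring
  · intro x hx
    have hF : ∀ x ∈ Set.Icc (j * Real.pi) ((j + 1) * Real.pi),
        u' x + Complex.I * θ * u x = (u' (j * Real.pi) + Complex.I * θ * u (j * Real.pi))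
          + ∫ t in (j * Real.pi)..x, (u'' t + Complex.I * θ * u' t) := by
      intro x hx
      rw [intervalIntegral.integral_add (h.intervalIntegrable_two.mono_set (uIcc_sub hx))
        ((h.intervalIntegrable_one.mono_set (uIcc_sub hx)).const_mul _),
        intervalIntegral.integral_const_mul, h.deriv_two x hx, h.deriv_one x hx]
      ring
    have e := primitive_mul (vertex_le j)
      (h.intervalIntegrable_two.add (h.intervalIntegrable_one.const_mul (Complex.I * θ))) hF
      (hasDerivAt_phase θ) hp x hx
    rw [mul_comm, e, mul_comm]
    congr 1
    exact intervalIntegral.integral_congr fun t _ => by ring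

theorem memLp_phase_mul (θ : ℝ) (f : Lp ℂ 2 (volume : Measure ℝ)) :
    MemLp (fun x => phase θ x * f x) 2 (volume : Measure ℝ) :=
  (Lp.memLp f).congr_norm ((continuous_phase θ).aestronglyMeasurable.mul (Lp.memLp f).1)
    (Eventually.of_forall fun x => by rw [norm_mul, norm_phase, one_mul])

/-- Multiplication by `exp(iθx)` on `L²(ℝ)`. -/
def phaseLp (θ : ℝ) : Lp ℂ 2 (volume : Measure ℝ) →ₗ[ℂ] Lp ℂ 2 (volume : Measure ℝ) where
  toFun f := MemLp.toLp (fun x => phase θ x * f x)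
    (memLp_phase_mul θ f)
  map_add' f g := by
    rw [← MemLp.toLp_add]
    refine MemLp.toLp_congr _ _ ?_
    filter_upwards [Lp.coeFn_add f g] with x hx
    rw [hx]
    exact mul_add _ _ _
  map_smul' c f := by
    rw [RingHom.id_apply, ← MemLp.toLp_const_smul]
    refine MemLp.toLp_congr _ _ ?_
    filter_upwards [Lp.coeFn_smul c f] with x hx
    rw [hx]
    simp only [Pi.smul_apply, smul_eq_mul]
    ring

theorem coeFn_phaseLp (θ : ℝ) (f : Lp ℂ 2 (volume : Measure ℝ)) :
    phaseLp θ f =ᵐ[volume] fun x => phase θ x * f x :=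
  MemLp.coeFn_toLp (memLp_phase_mul θ f)

theorem phaseLp_neg (θ : ℝ) (f : Lp ℂ 2 (volume : Measure ℝ)) :
    phaseLp (-θ) (phaseLp θ f) = f := by
  refine Lp.ext ?_
  filter_upwards [coeFn_phaseLp (-θ) (phaseLp θ f), coeFn_phaseLp θ f] with x h1 h2
  rw [h1, h2, ← mul_assoc, phase_neg_mul, one_mul]

/-- Multiplication by `exp(iθx)` as a unitary operator. -/
def phaseEquiv (θ : ℝ) : Lp ℂ 2 (volume : Measure ℝ) ≃ₗᵢ[ℂ] Lp ℂ 2 (volume : Measure ℝ) where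
  toLinearEquiv := LinearEquiv.ofLinearMap (phaseLp θ) (phaseLp (-θ))
    (by ext1 f; have := phaseLp_neg (-θ) f; rw [neg_neg] at this; exact this)
    (by ext1 f; exact phaseLp_neg θ f)
  norm_map' f := by
    change ‖phaseLp θ f‖ = ‖f‖
    rw [Lp.norm_def, Lp.norm_def]
    congr 1
    refine eLpNorm_congr_norm_ae ?_
    filter_upwards [coeFn_phaseLp θ f] with x hx
    rw [hx, norm_mul, norm_phase, one_mul]

/-- The gauge transformation removing an integer part of the vector potential. -/
def gauge (n : ℤ) : StateSpace ≃ₗᵢ[ℂ] StateSpace :=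
  LinearIsometryEquiv.piLpCongrRight 2 fun s => phaseEquiv (orientation s * n)

theorem coeFn_gauge (n : ℤ) (f : StateSpace) (s : Fin 2) :
    gauge n f s =ᵐ[volume] fun x => phase (orientation s * n) x * f s x :=
  coeFn_phaseLp _ (f s)

theorem gauge_neg (n : ℤ) (f : StateSpace) : gauge (-n) (gauge n f) = f := by
  ext s : 1
  refine Lp.ext ?_
  filter_upwards [coeFn_gauge (-n) (gauge n f) s, coeFn_gauge n f s] with x h1 h2
  rw [h1, h2, ← mul_assoc]
  push_cast
  rw [mul_neg, phase_neg_mul, one_mul]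

theorem IsDeltaCoupled.gauge {A : ℝ} {a : ℤ → ℝ} {u u' u'' : Fin 2 → ℤ → ℝ → ℂ}
    (h : IsDeltaCoupled A a u u' u'') (n : ℤ) :
    IsDeltaCoupled (A - n) a (fun s j x => phase (orientation s * n) x * u s j x)
      (fun s j x => phase (orientation s * n) x
        * (u' s j x + Complex.I * (orientation s * n : ℝ) * u s j x))
      (fun s j x => phase (orientation s * n) x
        * (u'' s j x + 2 * (Complex.I * (orientation s * n : ℝ)) * u' s j x
          + (Complex.I * (orientation s * n : ℝ)) ^ 2 * u s j x)) where
  sobolev s j := (h.sobolev s j).phase_mul _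
  continuous_right s j := by
    simp only [phase_vertex]
    rw [h.continuous_right s j]
  continuous_left s j := by
    simp only [phase_vertex]
    rw [h.continuous_left s j]
  flux j := by
    have hf := h.flux j
    simp only [quasiDeriv, phase_vertex, Fin.sum_univ_two] at hf ⊢
    push_cast at hf ⊢
    linear_combination phase n (j * Real.pi) * hf

theorem gauge_mem {A : ℝ} {a : ℤ → ℝ} {p : StateSpace × StateSpace}
    (hp : p ∈ hamiltonianGraph A a) (n : ℤ) :
    (gauge n p.1, gauge n p.2) ∈ hamiltonianGraph (A - n) a := by
  obtain ⟨u, u', u'', hu, h1, h2⟩ := hp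
  refine ⟨_, _, _, hu.gauge n, fun s j => ?_, fun s j => ?_⟩
  · filter_upwards [h1 s j, ae_restrict_of_ae (coeFn_gauge n p.1 s)] with x e1 e2
    rw [e2, e1]
  · filter_upwards [h2 s j, ae_restrict_of_ae (coeFn_gauge n p.2 s)] with x e1 e2
    rw [e2, e1]
    simp only [quasiDerivTwo, quasiDeriv]
    push_cast
    ring

theorem mem_graph_iff_gauge (A : ℤ) (a : ℤ → ℝ) (p : StateSpace × StateSpace) :
    p ∈ hamiltonianGraph A a ↔ (gauge A p.1, gauge A p.2) ∈ hamiltonianGraph 0 a := by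
  constructor
  · intro h
    have := gauge_mem h A
    rwa [sub_self] at this
  · intro h
    have := gauge_mem h (-A)
    simp only [gauge_neg] at this
    push_cast at this
    rwa [zero_sub, neg_neg] at this

theorem mem_essentialSpectrum_iff {A : ℝ} {a : ℤ → ℝ} {E : ℝ} :
    E ∈ essentialSpectrum (hamiltonian A a) ↔ ∃ p : ℕ → StateSpace × StateSpace,
      (∀ n, p n ∈ hamiltonianGraph A a) ∧ (∀ n, ‖(p n).1‖ = 1) ∧
      (∀ v : StateSpace, Tendsto (fun n => inner ℂ v (p n).1) atTop (𝓝 0)) ∧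
      Tendsto (fun n => (p n).2 - (E : ℂ) • (p n).1) atTop (𝓝 0) := by
  rw [← hamiltonian_graph]
  constructor
  · rintro ⟨u, h1, h2, h3⟩
    exact ⟨fun n => (u n, hamiltonian A a (u n)), fun n => LinearPMap.mem_graph _ _, h1, h2, h3⟩
  · rintro ⟨p, h0, h1, h2, h3⟩
    have h4 : ∀ n, ∃ y : (hamiltonian A a).domain, (y : StateSpace) = (p n).1 ∧
        hamiltonian A a y = (p n).2 := fun n => (LinearPMap.mem_graph_iff _).1 (h0 n)
    choose y hy1 hy2 using h4
    refine ⟨y, ?_, ?_, ?_⟩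
    · simpa only [hy1] using h1
    · simpa only [hy1] using h2
    · simpa only [hy1, hy2] using h3

theorem mem_eigenspace_iff {A : ℝ} {a : ℤ → ℝ} {E : ℝ} {f : StateSpace} :
    f ∈ eigenspace (hamiltonian A a) E ↔ (f, (E : ℂ) • f) ∈ hamiltonianGraph A a := by
  rw [← hamiltonian_graph]
  rfl

theorem mem_eigenspace_gauge (A : ℤ) (a : ℤ → ℝ) (E : ℝ) (f : StateSpace) :
    f ∈ eigenspace (hamiltonian A a) E ↔ gauge A f ∈ eigenspace (hamiltonian 0 a) E := by
  rw [mem_eigenspace_iff, mem_eigenspace_iff, mem_graph_iff_gauge, map_smul]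

theorem essentialSpectrum_gauge (A : ℤ) (a : ℤ → ℝ) :
    essentialSpectrum (hamiltonian A a) = essentialSpectrum (hamiltonian 0 a) := by
  have key : ∀ (B B' : ℝ) (n : ℤ), (∀ p ∈ hamiltonianGraph B a,
      (gauge n p.1, gauge n p.2) ∈ hamiltonianGraph B' a) →
      essentialSpectrum (hamiltonian B a) ⊆ essentialSpectrum (hamiltonian B' a) := by
    intro B B' n h E hE
    rw [mem_essentialSpectrum_iff] at hE ⊢
    obtain ⟨p, h0, h1, h2, h3⟩ := hE
    refine ⟨fun n' => (gauge n (p n').1, gauge n (p n').2), fun k => h _ (h0 k), fun k => ?_,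
      fun v => ?_, ?_⟩
    · rw [LinearIsometryEquiv.norm_map, h1 k]
    · refine (h2 ((gauge n).symm v)).congr fun k => ?_
      rw [← LinearIsometryEquiv.inner_map_map (gauge n), LinearIsometryEquiv.apply_symm_apply]
    · have := ((gauge n).continuous.tendsto 0).comp h3
      rw [map_zero] at this
      refine this.congr fun k => ?_
      rw [Function.comp_apply, map_sub, map_smul]
  refine Set.Subset.antisymm (key A 0 A fun p hp => (mem_graph_iff_gauge A a p).1 hp)
    (key 0 A (-A) fun p hp => ?_)
  have := gauge_mem hp (-A)
  push_cast at this
  rwa [zero_sub, neg_neg] at this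

/-- The gauge transformation identifies the eigenspaces. -/
def eigenspaceGauge (A : ℤ) (a : ℤ → ℝ) (E : ℝ) :
    eigenspace (hamiltonian A a) E ≃ₗ[ℂ] eigenspace (hamiltonian 0 a) E :=
  (gauge A).toLinearEquiv.ofSubmodules _ _ (by
    ext f
    rw [Submodule.mem_map]
    constructor
    · rintro ⟨g, hg, rfl⟩
      exact (mem_eigenspace_gauge A a E g).1 hg
    · intro hf
      refine ⟨(gauge A).symm f, (mem_eigenspace_gauge A a E _).2 ?_, ?_⟩
      · rwa [LinearIsometryEquiv.apply_symm_apply]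
      · exact LinearIsometryEquiv.apply_symm_apply _ _)

theorem simpleEigenvalues_gauge (A : ℤ) (a : ℤ → ℝ) :
    simpleEigenvalues (hamiltonian A a) = simpleEigenvalues (hamiltonian 0 a) := by
  ext E
  exact Eq.congr_left (eigenspaceGauge A a E).finrank_eq

theorem pointSpectrum_gauge (A : ℤ) (a : ℤ → ℝ) :
    pointSpectrum (hamiltonian A a) = pointSpectrum (hamiltonian 0 a) := by
  ext E
  refine not_congr ?_
  rw [← Submodule.subsingleton_iff_eq_bot, ← Submodule.subsingleton_iff_eq_bot]
  exact (eigenspaceGauge A a E).toEquiv.subsingleton_congr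

theorem discreteSpectrum_gauge (A : ℤ) (a : ℤ → ℝ) :
    discreteSpectrum (hamiltonian A a) = discreteSpectrum (hamiltonian 0 a) := by
  rw [discreteSpectrum, discreteSpectrum, pointSpectrum_gauge, essentialSpectrum_gauge]

/-! ### Vertex values of functions in the domain -/

theorem exists_bound_edge {φ : ℝ → ℝ} (hφ : Continuous φ) :
    ∃ K, 0 ≤ K ∧ ∀ x ∈ Set.Icc 0 Real.pi, |φ x| ≤ K := by
  obtain ⟨K, hK⟩ := isCompact_Icc.exists_bound_of_continuousOn (s := Set.Icc 0 Real.pi)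
    hφ.continuousOn
  exact ⟨K, (norm_nonneg _).trans (hK 0 ⟨le_rfl, Real.pi_pos.le⟩), hK⟩

theorem IsSobolevTwo.green_real {j : ℤ} {u u' u'' : ℝ → ℂ} (h : IsSobolevTwo j u u' u'')
    {φ φ' φ'' : ℝ → ℝ} (hφ : ∀ x, HasDerivAt φ (φ' x) x) (hφ' : ∀ x, HasDerivAt φ' (φ'' x) x)
    (hφ'' : Continuous φ'') {x : ℝ} (hx : x ∈ Set.Icc (j * Real.pi) ((j + 1) * Real.pi)) :
    ∫ t in (j * Real.pi)..x, (u'' t * φ t - u t * φ'' t)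
      = (u' x * φ x - u x * φ' x) - (u' (j * Real.pi) * φ (j * Real.pi)
        - u (j * Real.pi) * φ' (j * Real.pi)) :=
  h.green (φ := fun t => (φ t : ℂ)) (φ' := fun t => (φ' t : ℂ)) (φ'' := fun t => (φ'' t : ℂ))
    (fun x => (hφ x).ofReal_comp) (fun x => (hφ' x).ofReal_comp)
    (Complex.continuous_ofReal.comp hφ'') hx

theorem IsSobolevTwo.intervalIntegrable_zero {j : ℤ} {u u' u'' : ℝ → ℂ}
    (h : IsSobolevTwo j u u' u'') :
    IntervalIntegrable u volume (j * Real.pi) ((j + 1) * Real.pi) := by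
  have h1 := continuousOn_of_primitive (vertex_le j) h.intervalIntegrable_one h.deriv_one
  rw [← Set.uIcc_of_le (vertex_le j)] at h1
  exact h1.intervalIntegrable

theorem IsSobolevTwo.intervalIntegrable_source {j : ℤ} {u u' u'' : ℝ → ℂ}
    (h : IsSobolevTwo j u u' u'') (E : ℝ) :
    IntervalIntegrable (fun t => u'' t + E * u t) volume (j * Real.pi) ((j + 1) * Real.pi) :=
  h.intervalIntegrable_two.add (h.intervalIntegrable_zero.const_mul _)

theorem IsSobolevTwo.integral_mul_sinE {j : ℤ} {u u' u'' : ℝ → ℂ} (h : IsSobolevTwo j u u' u'')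
    (E : ℝ) {x : ℝ} (hx : x ∈ Set.Icc (j * Real.pi) ((j + 1) * Real.pi)) :
    ∫ t in (j * Real.pi)..x, (u'' t + E * u t) * sinE E (t - j * Real.pi)
      = u' x * sinE E (x - j * Real.pi) - u x * cosE E (x - j * Real.pi) + u (j * Real.pi) := by
  have h1 := h.green_real (φ := fun t => sinE E (t - j * Real.pi))
    (φ' := fun t => cosE E (t - j * Real.pi)) (φ'' := fun t => -E * sinE E (t - j * Real.pi))
    (fun x => (hasDerivAt_sinE E _).comp_sub_const x _)
    (fun x => (hasDerivAt_cosE E _).comp_sub_const x _)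
    (continuous_const.mul ((continuous_sinE E).comp (by fun_prop))) hx
  simp only [sub_self, sinE_at_zero, cosE_at_zero] at h1
  rw [intervalIntegral.integral_congr
    (g := fun t => (u'' t + E * u t) * sinE E (t - j * Real.pi))
    (fun t _ => by push_cast; ring)] at h1
  rw [h1]
  push_cast
  ring

theorem IsSobolevTwo.integral_mul_sinE_rev {j : ℤ} {u u' u'' : ℝ → ℂ}
    (h : IsSobolevTwo j u u' u'') (E : ℝ) {x : ℝ}
    (hx : x ∈ Set.Icc (j * Real.pi) ((j + 1) * Real.pi)) :
    ∫ t in (j * Real.pi)..x, (u'' t + E * u t) * sinE E ((j + 1) * Real.pi - t)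
      = u' x * sinE E ((j + 1) * Real.pi - x) + u x * cosE E ((j + 1) * Real.pi - x)
        - u' (j * Real.pi) * edgeSin E - u (j * Real.pi) * edgeCos E := by
  have h1 := h.green_real (φ := fun t => sinE E ((j + 1) * Real.pi - t))
    (φ' := fun t => -cosE E ((j + 1) * Real.pi - t))
    (φ'' := fun t => -E * sinE E ((j + 1) * Real.pi - t))
    (fun x => (hasDerivAt_sinE E _).comp_const_sub _ x)
    (fun x => ((hasDerivAt_cosE E _).comp_const_sub _ x).neg.congr_deriv (by ring))
    (continuous_const.mul ((continuous_sinE E).comp (by fun_prop))) hx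
  have h2 : ((j : ℝ) + 1) * Real.pi - j * Real.pi = Real.pi := by ring
  simp only [h2] at h1
  rw [intervalIntegral.integral_congr
    (g := fun t => (u'' t + E * u t) * sinE E ((j + 1) * Real.pi - t))
    (fun t _ => by push_cast; ring)] at h1
  rw [h1, edgeSin, edgeCos]
  push_cast
  ring

/-- A test function on the edge `(0, π)`: it picks out the value at the left end. -/
def testFun (t : ℝ) : ℝ := t * (Real.pi - t) ^ 2 / Real.pi ^ 2

/-- The derivative of `testFun`. -/
def testFunDeriv (t : ℝ) : ℝ := ((Real.pi - t) ^ 2 - 2 * t * (Real.pi - t)) / Real.pi ^ 2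

/-- The second derivative of `testFun`. -/
def testFunDerivTwo (t : ℝ) : ℝ := (6 * t - 4 * Real.pi) / Real.pi ^ 2

theorem hasDerivAt_testFun (t : ℝ) : HasDerivAt testFun (testFunDeriv t) t := by
  have h := ((hasDerivAt_id' t).mul (((hasDerivAt_id' t).const_sub Real.pi).pow 2)).div_const
    (Real.pi ^ 2)
  refine h.congr_deriv ?_
  rw [testFunDeriv]
  simp
  ring

theorem hasDerivAt_testFunDeriv (t : ℝ) : HasDerivAt testFunDeriv (testFunDerivTwo t) t := by
  have h := ((((hasDerivAt_id' t).const_sub Real.pi).pow 2).sub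
    (((hasDerivAt_id' t).const_mul 2).mul ((hasDerivAt_id' t).const_sub Real.pi))).div_const
    (Real.pi ^ 2)
  refine h.congr_deriv ?_
  rw [testFunDerivTwo]
  simp
  ring

theorem continuous_testFun : Continuous testFun := by unfold testFun; fun_prop

theorem continuous_testFunDerivTwo : Continuous testFunDerivTwo := by
  unfold testFunDerivTwo; fun_prop

theorem IsSobolevTwo.left_value {j : ℤ} {u u' u'' : ℝ → ℂ} (h : IsSobolevTwo j u u' u'')
    (E : ℝ) :
    u (j * Real.pi) = (∫ t in (j * Real.pi)..((j + 1) * Real.pi),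
        (u'' t + E * u t) * testFun (t - j * Real.pi))
      - ∫ t in (j * Real.pi)..((j + 1) * Real.pi),
        u t * (E * testFun (t - j * Real.pi) + testFunDerivTwo (t - j * Real.pi) : ℝ) := by
  have h1 := h.green_real (φ := fun t => testFun (t - j * Real.pi))
    (φ' := fun t => testFunDeriv (t - j * Real.pi))
    (φ'' := fun t => testFunDerivTwo (t - j * Real.pi))
    (fun x => (hasDerivAt_testFun _).comp_sub_const x _)
    (fun x => (hasDerivAt_testFunDeriv _).comp_sub_const x _)
    (continuous_testFunDerivTwo.comp (by fun_prop)) (Set.right_mem_Icc.2 (vertex_le j))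
  have h2 : ((j : ℝ) + 1) * Real.pi - j * Real.pi = Real.pi := by ring
  have h3 : Continuous fun t => testFun (t - j * Real.pi) :=
    continuous_testFun.comp (by fun_prop)
  have h4 : Continuous fun t => testFunDerivTwo (t - j * Real.pi) :=
    continuous_testFunDerivTwo.comp (by fun_prop)
  rw [← intervalIntegral.integral_sub]
  · rw [intervalIntegral.integral_congr
      (g := fun t => u'' t * testFun (t - j * Real.pi) - u t * testFunDerivTwo (t - j * Real.pi))
      (fun t _ => by push_cast; ring), h1, h2]
    have : Real.pi ≠ 0 := Real.pi_ne_zero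
    simp [testFun, testFunDeriv, this]
  · exact (h.intervalIntegrable_source E).mul_continuousOn
      (Complex.continuous_ofReal.comp h3).continuousOn
  · refine h.intervalIntegrable_zero.mul_continuousOn (Continuous.continuousOn ?_)
    exact Complex.continuous_ofReal.comp ((continuous_const.mul h3).add h4)

theorem norm_integral_mul_le {j : ℤ} {w : ℝ → ℂ} {φ : ℝ → ℝ}
    (hw : IntervalIntegrable w volume (j * Real.pi) ((j + 1) * Real.pi)) {K : ℝ}
    (hK : ∀ t ∈ Set.Icc (j * Real.pi) ((j + 1) * Real.pi), |φ t| ≤ K) {x y : ℝ}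
    (hx : x ∈ Set.Icc (j * Real.pi) ((j + 1) * Real.pi))
    (hy : y ∈ Set.Icc (j * Real.pi) ((j + 1) * Real.pi)) (hxy : x ≤ y) :
    ‖∫ t in x..y, w t * φ t‖ ≤ K * ∫ t in (j * Real.pi)..((j + 1) * Real.pi), ‖w t‖ := by
  have hK0 : 0 ≤ K := (abs_nonneg _).trans (hK _ hx)
  have hsub : Set.uIcc x y ⊆ Set.uIcc (j * Real.pi) ((j + 1) * Real.pi) := by
    rw [Set.uIcc_of_le hxy, Set.uIcc_of_le (vertex_le j)]
    exact Set.Icc_subset_Icc hx.1 hy.2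
  calc ‖∫ t in x..y, w t * φ t‖ ≤ ∫ t in x..y, K * ‖w t‖ := by
        refine intervalIntegral.norm_integral_le_of_norm_le hxy ?_
          ((hw.mono_set hsub).norm.const_mul K)
        refine Eventually.of_forall fun t ht => ?_
        rw [norm_mul, Complex.norm_real, Real.norm_eq_abs, mul_comm]
        exact mul_le_mul_of_nonneg_right (hK t ⟨hx.1.trans ht.1.le, ht.2.trans hy.2⟩)
          (norm_nonneg _)
    _ = K * ∫ t in x..y, ‖w t‖ := intervalIntegral.integral_const_mul _ _
    _ ≤ _ := by
        refine mul_le_mul_of_nonneg_left ?_ hK0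
        exact intervalIntegral.integral_mono_interval hx.1 hxy hy.2
          (Eventually.of_forall fun _ => norm_nonneg _) hw.norm

theorem IsSobolevTwo.norm_mul_edgeSin_le {j : ℤ} {u u' u'' : ℝ → ℂ}
    (h : IsSobolevTwo j u u' u'') (E : ℝ) {K : ℝ}
    (hK : ∀ x ∈ Set.Icc 0 Real.pi, |sinE E x| ≤ K) {x : ℝ}
    (hx : x ∈ Set.Icc (j * Real.pi) ((j + 1) * Real.pi)) :
    ‖u x‖ * |edgeSin E| ≤ K * (‖u (j * Real.pi)‖ + ‖u ((j + 1) * Real.pi)‖)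
      + 2 * K ^ 2 * ∫ t in (j * Real.pi)..((j + 1) * Real.pi), ‖u'' t + E * u t‖ := by
  set a := (j : ℝ) * Real.pi with ha
  set b := ((j : ℝ) + 1) * Real.pi with hb
  have hba : b - a = Real.pi := by rw [ha, hb]; ring
  have hab : a ≤ b := vertex_le j
  have hw := h.intervalIntegrable_source E
  rw [← ha, ← hb] at hw
  set L := ∫ t in a..b, ‖u'' t + E * u t‖ with hL
  have hbd1 : ∀ t ∈ Set.Icc a b, |sinE E (t - a)| ≤ K := fun t ht =>
    hK _ ⟨by linarith [ht.1], by linarith [ht.2]⟩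
  have hbd2 : ∀ t ∈ Set.Icc a b, |sinE E (b - t)| ≤ K := fun t ht =>
    hK _ ⟨by linarith [ht.2], by linarith [ht.1]⟩
  have hK0 : 0 ≤ K := (abs_nonneg _).trans (hbd1 x hx)
  have g1 := h.integral_mul_sinE E hx
  have g2 := h.integral_mul_sinE_rev E hx
  have g3 := h.integral_mul_sinE_rev E (Set.right_mem_Icc.2 hab)
  have hcont2 : Continuous fun t => ((sinE E (b - t) : ℝ) : ℂ) :=
    Complex.continuous_ofReal.comp ((continuous_sinE E).comp (by fun_prop))
  have hint := hw.mul_continuousOn (g := fun t => ((sinE E (b - t) : ℝ) : ℂ)) hcont2.continuousOn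
  have hsub1 : Set.uIcc a x ⊆ Set.uIcc a b := uIcc_sub hx
  have hsub2 : Set.uIcc x b ⊆ Set.uIcc a b := by
    rw [Set.uIcc_of_le hx.2, Set.uIcc_of_le hab]
    exact Set.Icc_subset_Icc_left hx.1
  have g4 := intervalIntegral.integral_add_adjacent_intervals (hint.mono_set hsub1)
    (hint.mono_set hsub2)
  rw [g2, g3] at g4
  rw [sub_self, sinE_at_zero, cosE_at_zero] at g4
  have n1 := norm_integral_mul_le (φ := fun t => sinE E (t - a)) hw hbd1
    (Set.left_mem_Icc.2 hab) hx hx.1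
  have n2 := norm_integral_mul_le (φ := fun t => sinE E (b - t)) hw hbd2 hx
    (Set.right_mem_Icc.2 hab) hx.2
  have hadd : (edgeSin E : ℂ) = sinE E (x - a) * cosE E (b - x)
      + cosE E (x - a) * sinE E (b - x) := by
    have := sinE_add E (x - a) (b - x)
    rw [show x - a + (b - x) = Real.pi by linarith] at this
    rw [edgeSin, this]
    push_cast
    ring
  have key : u x * edgeSin E = u a * sinE E (b - x) + u b * sinE E (x - a)
      - (sinE E (b - x) * ∫ t in a..x, (u'' t + E * u t) * sinE E (t - a))
      - sinE E (x - a) * ∫ t in x..b, (u'' t + E * u t) * sinE E (b - t) := by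
    have g5 : ∫ t in x..b, (u'' t + E * u t) * sinE E (b - t)
        = u b - u' x * sinE E (b - x) - u x * cosE E (b - x) := by
      simp only [Complex.ofReal_zero, Complex.ofReal_one, mul_zero, mul_one, zero_add] at g4
      linear_combination g4
    rw [g5, g1, hadd]
    ring
  have e1 : ‖u x * edgeSin E‖ = ‖u x‖ * |edgeSin E| := by
    rw [norm_mul, Complex.norm_real, Real.norm_eq_abs]
  rw [← e1, key]
  have m1 := hbd1 x hx
  have m2 := hbd2 x hx
  have hL0 : 0 ≤ L := intervalIntegral.integral_nonneg hab fun _ _ => norm_nonneg _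
  refine (norm_sub_le _ _).trans ?_
  have e2 : ‖sinE E (x - a) * ∫ t in x..b, (u'' t + E * u t) * sinE E (b - t)‖ ≤ K * (K * L) := by
    rw [norm_mul, Complex.norm_real, Real.norm_eq_abs]
    gcongr
  have e3 : ‖sinE E (b - x) * ∫ t in a..x, (u'' t + E * u t) * sinE E (t - a)‖ ≤ K * (K * L) := by
    rw [norm_mul, Complex.norm_real, Real.norm_eq_abs]
    gcongr
  have e4 : ‖u a * sinE E (b - x) + u b * sinE E (x - a)‖ ≤ ‖u a‖ * K + ‖u b‖ * K := by
    refine (norm_add_le _ _).trans ?_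
    rw [norm_mul, norm_mul, Complex.norm_real, Complex.norm_real, Real.norm_eq_abs,
      Real.norm_eq_abs]
    gcongr
  have e5 := norm_sub_le (u a * sinE E (b - x) + u b * sinE E (x - a))
    (sinE E (b - x) * ∫ t in a..x, (u'' t + E * u t) * sinE E (t - a))
  linarith

theorem IsDeltaCoupled.right_value {A : ℝ} {a : ℤ → ℝ} {u u' u'' : Fin 2 → ℤ → ℝ → ℂ}
    (h : IsDeltaCoupled A a u u' u'') (s : Fin 2) (j : ℤ) :
    u s j ((j + 1) * Real.pi) = u 0 (j + 1) ((j + 1 : ℤ) * Real.pi) := by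
  have := h.continuous_left s (j + 1)
  rw [add_sub_cancel_right] at this
  rw [← this]
  push_cast
  rfl

theorem IsDeltaCoupled.residual {a : ℤ → ℝ} {u u' u'' : Fin 2 → ℤ → ℝ → ℂ}
    (h : IsDeltaCoupled 0 a u u' u'') (E : ℝ) (j : ℤ) :
    2 * (u 0 (j + 1) ((j + 1 : ℤ) * Real.pi) + u 0 (j - 1) ((j - 1 : ℤ) * Real.pi)
      - (2 * edgeCos E + a j * edgeSin E / 2 : ℝ) * u 0 j (j * Real.pi))
    = ∑ s, ((∫ t in (j * Real.pi)..((j + 1) * Real.pi),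
          (u'' s j t + E * u s j t) * sinE E ((j + 1) * Real.pi - t))
        + ∫ t in ((j - 1 : ℤ) * Real.pi)..(((j - 1 : ℤ) + 1) * Real.pi),
          (u'' s (j - 1) t + E * u s (j - 1) t) * sinE E (t - (j - 1 : ℤ) * Real.pi)) := by
  have hf := h.flux j
  have g1 := fun s => (h.sobolev s j).integral_mul_sinE_rev E (Set.right_mem_Icc.2 (vertex_le j))
  have g2 := fun s => (h.sobolev s (j - 1)).integral_mul_sinE E
    (Set.right_mem_Icc.2 (vertex_le (j - 1)))
  have hpi : (j : ℝ) * Real.pi - ((j - 1 : ℤ) : ℝ) * Real.pi = Real.pi := by push_cast; ring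
  have hpi' : ((j - 1 : ℤ) : ℝ) + 1 = j := by push_cast; ring
  have r1 := fun s => h.right_value s j
  have r2 := fun s => h.continuous_right s j
  have r3 := fun s => h.continuous_left s j
  have r4 := fun s => h.continuous_right s (j - 1)
  have hq : ∀ (s : Fin 2) (v v' : ℝ → ℂ) (x : ℝ), quasiDeriv 0 s v v' x = v' x := by
    intro s v v' x
    simp [quasiDeriv]
  simp only [hq, Fin.sum_univ_two] at hf
  simp only [g1, g2]
  simp only [hpi', hpi, sub_self, sinE_at_zero, cosE_at_zero, r1, Fin.sum_univ_two]
  rw [r2 1, r3 0, r3 1, r4 1]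
  simp only [edgeSin, edgeCos] at *
  push_cast
  linear_combination (sinE E Real.pi : ℂ) * hf

/-! ### Decomposition of the norm into edge contributions -/

/-- The squared norm of a state on the `j`-th ring. -/
def edgeSq (F : StateSpace) (j : ℤ) : ℝ := ∑ s, ∫ x in edge j, ‖F s x‖ ^ 2

theorem edgeSq_nonneg (F : StateSpace) (j : ℤ) : 0 ≤ edgeSq F j :=
  Finset.sum_nonneg fun _ _ => integral_nonneg fun _ => sq_nonneg _

theorem measurableSet_edge (j : ℤ) : MeasurableSet (edge j) := measurableSet_Ioo

theorem pairwise_disjoint_edge : Pairwise (Function.onFun Disjoint edge) := by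
  have key : ∀ i j : ℤ, i < j → Disjoint (edge i) (edge j) := by
    intro i j hij
    refine Set.disjoint_left.2 fun x hx hx' => ?_
    have h1 : ((i : ℝ) + 1) ≤ j := by exact_mod_cast hij
    have h2 := mul_le_mul_of_nonneg_right h1 Real.pi_pos.le
    linarith [hx.2, hx'.1]
  intro i j hij
  rcases lt_or_gt_of_ne hij with h | h
  · exact key i j h
  · exact (key j i h).symm

theorem ae_mem_iUnion_edge : ∀ᵐ x ∂(volume : Measure ℝ), x ∈ ⋃ j, edge j :=
  ae_of_ae_edge fun j => (ae_restrict_iff' (measurableSet_edge j)).2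
    (Eventually.of_forall fun _ hx => Set.mem_iUnion.2 ⟨j, hx⟩)

theorem volume_restrict_iUnion_edge :
    (volume : Measure ℝ).restrict (⋃ j, edge j) = volume :=
  Measure.restrict_eq_self_of_ae_mem ae_mem_iUnion_edge

theorem hasSum_integral_edge {g : ℝ → ℝ} (hg : Integrable g) :
    HasSum (fun j => ∫ x in edge j, g x) (∫ x, g x) := by
  have h := hasSum_integral_iUnion (μ := volume) measurableSet_edge pairwise_disjoint_edge
    (f := g) hg.integrableOn
  rwa [volume_restrict_iUnion_edge] at h

theorem norm_sq_Lp (f : Lp ℂ 2 (volume : Measure ℝ)) : ‖f‖ ^ 2 = ∫ x, ‖f x‖ ^ 2 := by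
  have h1 : inner ℂ f f = ((‖f‖ ^ 2 : ℝ) : ℂ) := by
    rw [inner_self_eq_norm_sq_to_K]
    norm_cast
  rw [L2.inner_def] at h1
  have h2 : (∫ a, inner ℂ (f a) (f a)) = ((∫ x, ‖f x‖ ^ 2 : ℝ) : ℂ) := by
    rw [← integral_complex_ofReal]
    refine integral_congr_ae (Eventually.of_forall fun x => ?_)
    change inner ℂ (f x) (f x) = _
    rw [inner_self_eq_norm_sq_to_K]
    norm_cast
  rw [h2] at h1
  exact_mod_cast h1.symm

theorem integrable_norm_sq_Lp (f : Lp ℂ 2 (volume : Measure ℝ)) :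
    Integrable fun x => ‖f x‖ ^ 2 :=
  (memLp_two_iff_integrable_sq_norm (Lp.memLp f).1).1 (Lp.memLp f)

theorem hasSum_edgeSq (F : StateSpace) : HasSum (edgeSq F) (‖F‖ ^ 2) := by
  rw [PiLp.norm_sq_eq_of_L2]
  refine hasSum_sum fun s _ => ?_
  rw [norm_sq_Lp]
  exact hasSum_integral_edge (integrable_norm_sq_Lp (F s))

theorem volume_real_edge (j : ℤ) : (volume : Measure ℝ).real (edge j) = Real.pi := by
  rw [edge, Real.volume_real_Ioo_of_le (vertex_le j)]
  ring

theorem sq_integral_norm_le {j : ℤ} {w : ℝ → ℂ} (hw : MemLp w 2 (volume.restrict (edge j))) :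
    (∫ t in (j * Real.pi)..((j + 1) * Real.pi), ‖w t‖) ^ 2
      ≤ Real.pi * ∫ t in edge j, ‖w t‖ ^ 2 := by
  have hf : IsFiniteMeasure ((volume : Measure ℝ).restrict (edge j)) := ⟨by simp [edge]⟩
  have h1 : Integrable (fun t => ‖w t‖) (volume.restrict (edge j)) :=
    (hw.integrable (by norm_num)).norm
  have h2 : Integrable (fun t => ‖w t‖ ^ 2) (volume.restrict (edge j)) :=
    (memLp_two_iff_integrable_sq_norm hw.1).1 hw
  rw [intervalIntegral.integral_of_le (vertex_le j), integral_Ioc_eq_integral_Ioo]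
  change (∫ t in edge j, ‖w t‖) ^ 2 ≤ _
  set L := ∫ t in edge j, ‖w t‖ with hL
  have h3 : 0 ≤ ∫ t in edge j, (‖w t‖ - L / Real.pi) ^ 2 := integral_nonneg fun _ => sq_nonneg _
  have h4 : ∫ t in edge j, (‖w t‖ - L / Real.pi) ^ 2
      = (∫ t in edge j, ‖w t‖ ^ 2) - 2 * (L / Real.pi) * L + (L / Real.pi) ^ 2 * Real.pi := by
    rw [hL, ← integral_const_mul, ← integral_sub h2 (h1.const_mul _), ← hL]
    have h5 : (L / Real.pi) ^ 2 * Real.pi = ∫ t in edge j, (L / Real.pi) ^ 2 := by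
      rw [setIntegral_const, volume_real_edge, smul_eq_mul, mul_comm]
    have h6 : Integrable (fun t => ‖w t‖ ^ 2 - 2 * (L / Real.pi) * ‖w t‖)
        (volume.restrict (edge j)) := h2.sub (h1.const_mul _)
    rw [h5, ← integral_add h6 (integrable_const _)]
    exact integral_congr_ae (Eventually.of_forall fun t => by ring)
  rw [h4] at h3
  have hpi := Real.pi_pos
  have h6 : (L / Real.pi) ^ 2 * Real.pi = L ^ 2 / Real.pi := by field_simp
  have h7 : 2 * (L / Real.pi) * L = 2 * (L ^ 2 / Real.pi) := by field_simp
  rw [h6, h7] at h3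
  have h8 : L ^ 2 / Real.pi ≤ ∫ t in edge j, ‖w t‖ ^ 2 := by linarith
  rwa [div_le_iff₀ hpi, mul_comm] at h8

/-! ### Vertex values as functionals -/

theorem memLp_edgeTest {φ : ℝ → ℝ} (hφ : Continuous φ) (j : ℤ) :
    MemLp ((edge j).indicator fun x => ((φ (x - j * Real.pi) : ℝ) : ℂ)) 2
      (volume : Measure ℝ) := by
  have hc : Continuous fun x => ((φ (x - j * Real.pi) : ℝ) : ℂ) :=
    Complex.continuous_ofReal.comp (hφ.comp (by fun_prop))
  rw [memLp_indicator_iff_restrict (measurableSet_edge j)]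
  have hf : IsFiniteMeasure ((volume : Measure ℝ).restrict (edge j)) := ⟨by simp [edge]⟩
  obtain ⟨C, hC⟩ := (isCompact_Icc (a := (j : ℝ) * Real.pi)
    (b := ((j : ℝ) + 1) * Real.pi)).exists_bound_of_continuousOn hc.continuousOn
  exact MemLp.of_bound hc.aestronglyMeasurable C ((ae_restrict_iff' (measurableSet_edge j)).2
    (Eventually.of_forall fun x hx => hC x (Set.Ioo_subset_Icc_self hx)))

/-- The functional `F ↦ ∫ F₀ φ(· - jπ)` over the upper `j`-th edge, as a state. -/
def edgeTest (φ : ℝ → ℝ) (hφ : Continuous φ) (j : ℤ) : StateSpace :=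
  WithLp.toLp 2 ![(memLp_edgeTest hφ j).toLp, 0]

theorem inner_edgeTest {φ : ℝ → ℝ} (hφ : Continuous φ) (j : ℤ) (F : StateSpace) :
    inner ℂ (edgeTest φ hφ j) F
      = ∫ t in (j * Real.pi)..((j + 1) * Real.pi), F 0 t * φ (t - j * Real.pi) := by
  rw [PiLp.inner_apply, Fin.sum_univ_two]
  simp only [edgeTest, Matrix.cons_val_zero, Matrix.cons_val_one, inner_zero_left, add_zero]
  rw [L2.inner_def, intervalIntegral.integral_of_le (vertex_le j), integral_Ioc_eq_integral_Ioo]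
  change _ = ∫ t in edge j, _
  rw [← integral_indicator (measurableSet_edge j)]
  refine integral_congr_ae ?_
  filter_upwards [(memLp_edgeTest hφ j).coeFn_toLp] with x hx
  rw [hx]
  by_cases h : x ∈ edge j
  · simp [h]
  · simp [h]

theorem continuous_edgeTestFun (E : ℝ) :
    Continuous fun t => E * testFun t + testFunDerivTwo t :=
  (continuous_const.mul continuous_testFun).add continuous_testFunDerivTwo

/-- The value at the `j`-th vertex of the first component of `p = (f, h)` in the graph of the
Hamiltonian. -/
def vertexValue (E : ℝ) (p : StateSpace × StateSpace) (j : ℤ) : ℂ :=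
  -inner ℂ (edgeTest testFun continuous_testFun j) (p.2 - (E : ℂ) • p.1)
    - inner ℂ (edgeTest (fun t => E * testFun t + testFunDerivTwo t) (continuous_edgeTestFun E) j)
      p.1

theorem source_ae {p : StateSpace × StateSpace} {u u'' : Fin 2 → ℤ → ℝ → ℂ}
    {u' : Fin 2 → ℤ → ℝ → ℂ}
    (h1 : ∀ s j, p.1 s =ᵐ[volume.restrict (edge j)] u s j)
    (h2 : ∀ s j, p.2 s =ᵐ[volume.restrict (edge j)]
      fun x => -quasiDerivTwo 0 s (u s j) (u' s j) (u'' s j) x) (E : ℝ) (s : Fin 2) (j : ℤ) :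
    (p.2 - (E : ℂ) • p.1) s =ᵐ[volume.restrict (edge j)]
      fun x => -(u'' s j x + E * u s j x) := by
  filter_upwards [h1 s j, h2 s j, ae_restrict_of_ae (Lp.coeFn_sub (p.2 s) ((E : ℂ) • p.1 s)),
    ae_restrict_of_ae (Lp.coeFn_smul (E : ℂ) (p.1 s))] with x e1 e2 e3 e4
  refine e3.trans ?_
  rw [Pi.sub_apply, e4, Pi.smul_apply, e1, e2]
  simp [quasiDerivTwo, quasiDeriv]
  ring

theorem intervalIntegral_congr_edge {G : Type*} [NormedAddCommGroup G] [NormedSpace ℝ G]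
    {j : ℤ} {f g : ℝ → G} (h : f =ᵐ[volume.restrict (edge j)] g) :
    ∫ t in (j * Real.pi)..((j + 1) * Real.pi), f t
      = ∫ t in (j * Real.pi)..((j + 1) * Real.pi), g t := by
  rw [intervalIntegral.integral_of_le (vertex_le j), intervalIntegral.integral_of_le (vertex_le j),
    integral_Ioc_eq_integral_Ioo, integral_Ioc_eq_integral_Ioo]
  exact integral_congr_ae h

theorem vertexValue_eq {a : ℤ → ℝ} {p : StateSpace × StateSpace} {u u' u'' : Fin 2 → ℤ → ℝ → ℂ}
    (hu : IsDeltaCoupled 0 a u u' u'')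
    (h1 : ∀ s j, p.1 s =ᵐ[volume.restrict (edge j)] u s j)
    (h2 : ∀ s j, p.2 s =ᵐ[volume.restrict (edge j)]
      fun x => -quasiDerivTwo 0 s (u s j) (u' s j) (u'' s j) x) (E : ℝ) (j : ℤ) :
    vertexValue E p j = u 0 j (j * Real.pi) := by
  rw [(hu.sobolev 0 j).left_value E, vertexValue, inner_edgeTest, inner_edgeTest]
  congr 1
  · rw [← intervalIntegral.integral_neg]
    refine intervalIntegral_congr_edge ?_
    filter_upwards [source_ae h1 h2 E 0 j] with x hx
    rw [hx]
    ring
  · refine intervalIntegral_congr_edge ?_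
    filter_upwards [h1 0 j] with x hx
    rw [hx]

/-- The vertex values of a state in the domain of the Hamiltonian control the state, up to the
image of the state under `H - E`, and satisfy a second order recursion. -/
theorem exists_vertexValue_bounds {E : ℝ} (hS : edgeSin E ≠ 0) :
    ∃ K : ℝ, 0 ≤ K ∧ ∀ (a : ℤ → ℝ), ∀ p ∈ hamiltonianGraph 0 a, ∀ j,
      ‖vertexValue E p (j + 1) + vertexValue E p (j - 1)
        - (2 * edgeCos E + a j * edgeSin E / 2 : ℝ) * vertexValue E p j‖ ^ 2
        ≤ K * (edgeSq (p.2 - (E : ℂ) • p.1) j + edgeSq (p.2 - (E : ℂ) • p.1) (j - 1)) ∧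
      edgeSq p.1 j ≤ K * (‖vertexValue E p j‖ ^ 2 + ‖vertexValue E p (j + 1)‖ ^ 2
        + edgeSq (p.2 - (E : ℂ) • p.1) j) ∧
      ‖vertexValue E p j‖ ^ 2 ≤ K * (edgeSq p.1 j + edgeSq (p.2 - (E : ℂ) • p.1) j) := by
  obtain ⟨K₁, hK₁0, hK₁⟩ := exists_bound_edge (continuous_sinE E)
  obtain ⟨K₂, hK₂0, hK₂⟩ := exists_bound_edge continuous_testFun
  obtain ⟨K₃, hK₃0, hK₃⟩ := exists_bound_edge (continuous_edgeTestFun E)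
  have hpi := Real.pi_pos
  have hS2 : 0 < |edgeSin E| := abs_pos.2 hS
  set c₁ := K₁ ^ 2 * Real.pi with hc₁
  set c₂ := 2 * Real.pi * (3 * (K₁ ^ 2 + 4 * K₁ ^ 4 * Real.pi) / edgeSin E ^ 2) with hc₂
  set c₃ := 2 * (K₂ ^ 2 + K₃ ^ 2) * Real.pi with hc₃
  have hc₁0 : 0 ≤ c₁ := by positivity
  have hc₂0 : 0 ≤ c₂ := by positivity
  have hc₃0 : 0 ≤ c₃ := by positivity
  refine ⟨c₁ + c₂ + c₃, by positivity, fun a p hp j => ?_⟩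
  obtain ⟨u, u', u'', hu, h1, h2⟩ := hp
  have hv := fun j => vertexValue_eq hu h1 h2 E j
  set g := p.2 - (E : ℂ) • p.1 with hg
  set L : Fin 2 → ℤ → ℝ := fun s j => ∫ t in (j * Real.pi)..((j + 1) * Real.pi),
    ‖u'' s j t + E * u s j t‖ with hL
  have hL0 : ∀ s j, 0 ≤ L s j := fun s j =>
    intervalIntegral.integral_nonneg (vertex_le j) fun _ _ => norm_nonneg _
  have hLg : ∀ s j, L s j ^ 2 ≤ Real.pi * ∫ t in edge j, ‖g s t‖ ^ 2 := by
    intro s j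
    have e1 := sq_integral_norm_le (((hu.sobolev s j).memLp).add
      ((hu.sobolev s j).memLp_zero_one.1.const_mul (E : ℂ)))
    refine e1.trans (le_of_eq ?_)
    congr 1
    refine integral_congr_ae ?_
    filter_upwards [source_ae h1 h2 E s j] with x hx
    rw [hx, norm_neg]
    rfl
  have hgs : ∀ s j, ∫ t in edge j, ‖g s t‖ ^ 2 ≤ edgeSq g j := fun s j =>
    Finset.single_le_sum (f := fun s => ∫ t in edge j, ‖g s t‖ ^ 2)
      (fun _ _ => integral_nonneg fun _ => sq_nonneg _) (Finset.mem_univ s)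
  have hg0 := edgeSq_nonneg g
  have hp0 := edgeSq_nonneg p.1
  have htr : ∀ (k : ℤ) (t : ℝ), t ∈ Set.Icc (k * Real.pi) ((k + 1) * Real.pi) →
      t - k * Real.pi ∈ Set.Icc 0 Real.pi := fun k t ht =>
    ⟨by linarith [ht.1], by linarith [ht.2]⟩
  have htr' : ∀ (k : ℤ) (t : ℝ), t ∈ Set.Icc (k * Real.pi) ((k + 1) * Real.pi) →
      (k + 1) * Real.pi - t ∈ Set.Icc 0 Real.pi := fun k t ht =>
    ⟨by linarith [ht.2], by linarith [ht.1]⟩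
  have hr := hu.residual E j
  have hR : ‖u 0 (j + 1) ((j + 1 : ℤ) * Real.pi) + u 0 (j - 1) ((j - 1 : ℤ) * Real.pi)
      - (2 * edgeCos E + a j * edgeSin E / 2 : ℝ) * u 0 j (j * Real.pi)‖ ^ 2
      ≤ c₁ * (edgeSq g j + edgeSq g (j - 1)) := by
    have n1 : ∀ s k, ‖∫ t in (k * Real.pi)..((k + 1) * Real.pi),
        (u'' s k t + E * u s k t) * sinE E ((k + 1) * Real.pi - t)‖ ≤ K₁ * L s k :=
      fun s k => norm_integral_mul_le (φ := fun t => sinE E ((k + 1) * Real.pi - t))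
        ((hu.sobolev s k).intervalIntegrable_source E)
        (fun t ht => hK₁ _ (htr' k t ht)) (Set.left_mem_Icc.2 (vertex_le k))
        (Set.right_mem_Icc.2 (vertex_le k)) (vertex_le k)
    have n2 : ∀ s k, ‖∫ t in (k * Real.pi)..((k + 1) * Real.pi),
        (u'' s k t + E * u s k t) * sinE E (t - k * Real.pi)‖ ≤ K₁ * L s k :=
      fun s k => norm_integral_mul_le (φ := fun t => sinE E (t - k * Real.pi))
        ((hu.sobolev s k).intervalIntegrable_source E)
        (fun t ht => hK₁ _ (htr k t ht)) (Set.left_mem_Icc.2 (vertex_le k))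
        (Set.right_mem_Icc.2 (vertex_le k)) (vertex_le k)
    have n3 := congrArg norm hr
    rw [norm_mul, Complex.norm_ofNat] at n3
    set X := ‖u 0 (j + 1) ((j + 1 : ℤ) * Real.pi) + u 0 (j - 1) ((j - 1 : ℤ) * Real.pi)
      - (2 * edgeCos E + a j * edgeSin E / 2 : ℝ) * u 0 j (j * Real.pi)‖ with hX
    have n4 : 2 * X ≤ K₁ * (L 0 j + L 0 (j - 1) + (L 1 j + L 1 (j - 1))) := by
      rw [n3, Fin.sum_univ_two]
      refine (norm_add_le _ _).trans ?_
      have m0 := (norm_add_le _ _).trans (add_le_add (n1 0 j) (n2 0 (j - 1)))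
      have m1 := (norm_add_le _ _).trans (add_le_add (n1 1 j) (n2 1 (j - 1)))
      refine (add_le_add m0 m1).trans (le_of_eq ?_)
      ring
    have n5 : (2 * X) ^ 2 ≤ (K₁ * (L 0 j + L 0 (j - 1) + (L 1 j + L 1 (j - 1)))) ^ 2 := by
      have : 0 ≤ X := norm_nonneg _
      gcongr
    have n6 : (L 0 j + L 0 (j - 1) + (L 1 j + L 1 (j - 1))) ^ 2
        ≤ 4 * (L 0 j ^ 2 + L 0 (j - 1) ^ 2 + (L 1 j ^ 2 + L 1 (j - 1) ^ 2)) := by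
      nlinarith [sq_nonneg (L 0 j - L 0 (j - 1)), sq_nonneg (L 0 j - L 1 j),
        sq_nonneg (L 0 j - L 1 (j - 1)), sq_nonneg (L 0 (j - 1) - L 1 j),
        sq_nonneg (L 0 (j - 1) - L 1 (j - 1)), sq_nonneg (L 1 j - L 1 (j - 1))]
    have n7 : L 0 j ^ 2 + L 0 (j - 1) ^ 2 + (L 1 j ^ 2 + L 1 (j - 1) ^ 2)
        ≤ Real.pi * (edgeSq g j + edgeSq g (j - 1)) := by
      have e1 := hLg 0 j
      have e2 := hLg 1 j
      have e3 := hLg 0 (j - 1)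
      have e4 := hLg 1 (j - 1)
      rw [edgeSq, edgeSq, Fin.sum_univ_two, Fin.sum_univ_two]
      linarith
    have n8 := mul_le_mul_of_nonneg_left (n6.trans (mul_le_mul_of_nonneg_left n7 zero_le_four))
      (sq_nonneg K₁)
    rw [hc₁]
    nlinarith
  have hV : ‖u 0 j (j * Real.pi)‖ ^ 2 ≤ c₃ * (edgeSq p.1 j + edgeSq g j) := by
    set M := ∫ t in (j * Real.pi)..((j + 1) * Real.pi), ‖u 0 j t‖ with hM
    have hM0 : 0 ≤ M := intervalIntegral.integral_nonneg (vertex_le j) fun _ _ => norm_nonneg _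
    have hM2 : M ^ 2 ≤ Real.pi * edgeSq p.1 j := by
      have e1 := sq_integral_norm_le (hu.sobolev 0 j).memLp_zero_one.1
      refine e1.trans (mul_le_mul_of_nonneg_left ?_ hpi.le)
      have e2 : ∫ t in edge j, ‖u 0 j t‖ ^ 2 = ∫ t in edge j, ‖p.1 0 t‖ ^ 2 := by
        refine integral_congr_ae ?_
        filter_upwards [h1 0 j] with x hx
        rw [hx]
      rw [e2]
      exact Finset.single_le_sum (f := fun s => ∫ t in edge j, ‖p.1 s t‖ ^ 2)
        (fun _ _ => integral_nonneg fun _ => sq_nonneg _) (Finset.mem_univ 0)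
    have n1 := norm_integral_mul_le (φ := fun t => testFun (t - j * Real.pi))
      ((hu.sobolev 0 j).intervalIntegrable_source E) (fun t ht => hK₂ _ (htr j t ht))
      (Set.left_mem_Icc.2 (vertex_le j)) (Set.right_mem_Icc.2 (vertex_le j)) (vertex_le j)
    have n2 := norm_integral_mul_le
      (φ := fun t => E * testFun (t - j * Real.pi) + testFunDerivTwo (t - j * Real.pi))
      ((hu.sobolev 0 j).intervalIntegrable_zero) (fun t ht => hK₃ _ (htr j t ht))
      (Set.left_mem_Icc.2 (vertex_le j)) (Set.right_mem_Icc.2 (vertex_le j)) (vertex_le j)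
    have n3 : ‖u 0 j (j * Real.pi)‖ ≤ K₂ * L 0 j + K₃ * M := by
      rw [(hu.sobolev 0 j).left_value E]
      exact (norm_sub_le _ _).trans (add_le_add n1 n2)
    have n4 : ‖u 0 j (j * Real.pi)‖ ^ 2 ≤ (K₂ * L 0 j + K₃ * M) ^ 2 := by gcongr
    have n5 : (K₂ * L 0 j + K₃ * M) ^ 2 ≤ 2 * (K₂ ^ 2 * L 0 j ^ 2 + K₃ ^ 2 * M ^ 2) := by
      nlinarith [sq_nonneg (K₂ * L 0 j - K₃ * M)]
    have n6 : K₂ ^ 2 * L 0 j ^ 2 ≤ K₂ ^ 2 * (Real.pi * edgeSq g j) := by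
      refine mul_le_mul_of_nonneg_left ((hLg 0 j).trans ?_) (sq_nonneg _)
      exact mul_le_mul_of_nonneg_left (hgs 0 j) hpi.le
    have n7 : K₃ ^ 2 * M ^ 2 ≤ K₃ ^ 2 * (Real.pi * edgeSq p.1 j) :=
      mul_le_mul_of_nonneg_left hM2 (sq_nonneg _)
    have n8 : 0 ≤ K₂ ^ 2 * (Real.pi * edgeSq p.1 j) := by have := hp0 j; positivity
    have n9 : 0 ≤ K₃ ^ 2 * (Real.pi * edgeSq g j) := by have := hg0 j; positivity
    rw [hc₃]
    linarith
  have hF : edgeSq p.1 j ≤ c₂ * (‖u 0 j (j * Real.pi)‖ ^ 2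
      + ‖u 0 (j + 1) ((j + 1 : ℤ) * Real.pi)‖ ^ 2 + edgeSq g j) := by
    set Y := ‖u 0 j (j * Real.pi)‖ with hY
    set Z := ‖u 0 (j + 1) ((j + 1 : ℤ) * Real.pi)‖ with hZ
    have hpt : ∀ s, ∀ x ∈ edge j, ‖u s j x‖ ^ 2
        ≤ 3 * (K₁ ^ 2 + 4 * K₁ ^ 4 * Real.pi) / edgeSin E ^ 2 * (Y ^ 2 + Z ^ 2 + edgeSq g j) := by
      intro s x hx
      have n1 := (hu.sobolev s j).norm_mul_edgeSin_le E hK₁ (Set.Ioo_subset_Icc_self hx)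
      rw [hu.continuous_right s j, hu.right_value s j, ← hY, ← hZ] at n1
      have n2 : (‖u s j x‖ * |edgeSin E|) ^ 2 ≤ (K₁ * (Y + Z) + 2 * K₁ ^ 2 * L s j) ^ 2 := by
        gcongr
      have n3 : (K₁ * (Y + Z) + 2 * K₁ ^ 2 * L s j) ^ 2
          ≤ 3 * (K₁ ^ 2 * Y ^ 2 + K₁ ^ 2 * Z ^ 2 + 4 * K₁ ^ 4 * L s j ^ 2) := by
        nlinarith [sq_nonneg (K₁ * Y - K₁ * Z), sq_nonneg (K₁ * Y - 2 * K₁ ^ 2 * L s j),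
          sq_nonneg (K₁ * Z - 2 * K₁ ^ 2 * L s j)]
      have n4 : L s j ^ 2 ≤ Real.pi * edgeSq g j :=
        (hLg s j).trans (mul_le_mul_of_nonneg_left (hgs s j) hpi.le)
      have n5 : 4 * K₁ ^ 4 * L s j ^ 2 ≤ 4 * K₁ ^ 4 * (Real.pi * edgeSq g j) := by gcongr
      rw [mul_pow, sq_abs] at n2
      rw [div_mul_eq_mul_div, le_div_iff₀ (by positivity)]
      have n6 : 0 ≤ K₁ ^ 2 * edgeSq g j := by have := hg0 j; positivity
      have n7 : 0 ≤ 4 * K₁ ^ 4 * Real.pi * (Y ^ 2 + Z ^ 2) := by positivity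
      linarith
    have hint : ∀ s, ∫ x in edge j, ‖p.1 s x‖ ^ 2
        ≤ Real.pi * (3 * (K₁ ^ 2 + 4 * K₁ ^ 4 * Real.pi) / edgeSin E ^ 2
          * (Y ^ 2 + Z ^ 2 + edgeSq g j)) := by
      intro s
      have hf : IsFiniteMeasure ((volume : Measure ℝ).restrict (edge j)) := ⟨by simp [edge]⟩
      rw [← volume_real_edge j, ← smul_eq_mul, ← setIntegral_const]
      refine integral_mono_ae (integrable_norm_sq_Lp _).integrableOn (integrable_const _) ?_
      filter_upwards [h1 s j, ae_restrict_mem (measurableSet_edge j)] with x e1 e2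
      rw [e1, volume_real_edge]
      exact hpt s x e2
    rw [edgeSq, Fin.sum_univ_two]
    have e0 := hint 0
    have e1 := hint 1
    rw [hc₂]
    linarith
  rw [hv, hv, hv]
  have m1 := hg0 j
  have m2 := hg0 (j - 1)
  have m3 := hp0 j
  refine ⟨hR.trans ?_, hF.trans ?_, hV.trans ?_⟩
  · exact mul_le_mul_of_nonneg_right (by linarith) (by positivity)
  · exact mul_le_mul_of_nonneg_right (by linarith) (by positivity)
  · exact mul_le_mul_of_nonneg_right (by linarith) (by positivity)

/-! ### Construction of states from edge functions -/

theorem floor_of_mem_edge {j : ℤ} {x : ℝ} (hx : x ∈ edge j) : ⌊x / Real.pi⌋ = j := by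
  rw [Int.floor_eq_iff]
  exact ⟨(le_div_iff₀ Real.pi_pos).2 hx.1.le, (div_lt_iff₀ Real.pi_pos).2 hx.2⟩

theorem exists_Lp_of_edges {f : ℤ → ℝ → ℂ} {B : ℤ → ℝ} (hf : ∀ j, Continuous (f j))
    (hB : ∀ j, ∀ x ∈ edge j, ‖f j x‖ ≤ B j) (hs : Summable fun j => B j ^ 2) :
    ∃ F : Lp ℂ 2 (volume : Measure ℝ), ∀ j, F =ᵐ[volume.restrict (edge j)] f j := by
  set G : ℝ → ℂ := fun x => f ⌊x / Real.pi⌋ x with hG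
  have hmeas : Measurable G := by
    have h1 : Measurable fun p : ℤ × ℝ => f p.1 p.2 :=
      measurable_from_prod_countable_right fun j => (hf j).measurable
    exact h1.comp ((Int.measurable_floor.comp (measurable_id.div_const _)).prodMk measurable_id)
  have hedge : ∀ j, ∀ x ∈ edge j, G x = f j x := by
    intro j x hx
    simp only [hG, floor_of_mem_edge hx]
  have hbd : ∀ j, ∀ x ∈ edge j, ‖G x‖ ^ 2 ≤ B j ^ 2 := by
    intro j x hx
    rw [hedge j x hx]
    have := hB j x hx
    gcongr
  have hint : ∀ j, IntegrableOn (fun x => ‖G x‖ ^ 2) (edge j) volume := by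
    intro j
    have hfin : IsFiniteMeasure ((volume : Measure ℝ).restrict (edge j)) := ⟨by simp [edge]⟩
    refine Integrable.of_bound (C := B j ^ 2)
      ((hmeas.norm.pow_const 2).aestronglyMeasurable) ?_
    refine (ae_restrict_iff' (measurableSet_edge j)).2 (Eventually.of_forall fun x hx => ?_)
    rw [norm_pow, norm_norm]
    exact hbd j x hx
  have hmem : MemLp G 2 volume := by
    rw [memLp_two_iff_integrable_sq_norm hmeas.aestronglyMeasurable]
    have h2 := integrableOn_iUnion_of_summable_integral_norm hint
      (Summable.of_nonneg_of_le (fun j => integral_nonneg fun _ => norm_nonneg _) (fun j => ?_)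
        (hs.mul_left Real.pi))
    · rwa [IntegrableOn, volume_restrict_iUnion_edge] at h2
    · have hfin : IsFiniteMeasure ((volume : Measure ℝ).restrict (edge j)) := ⟨by simp [edge]⟩
      rw [← volume_real_edge j, ← smul_eq_mul, ← setIntegral_const]
      refine integral_mono_ae (hint j).norm (integrable_const _) ?_
      filter_upwards [ae_restrict_mem (measurableSet_edge j)] with x hx
      rw [norm_pow, norm_norm]
      exact hbd j x hx
  refine ⟨hmem.toLp, fun j => ?_⟩
  filter_upwards [ae_restrict_of_ae hmem.coeFn_toLp, ae_restrict_mem (measurableSet_edge j)]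
    with x e1 e2
  rw [e1, hedge j x e2]

theorem edgeSq_le_of_bound {F : StateSpace} {j : ℤ} {B : ℝ}
    (h : ∀ s, ∀ᵐ x ∂(volume.restrict (edge j)), ‖F s x‖ ≤ B) :
    edgeSq F j ≤ 2 * Real.pi * B ^ 2 := by
  have key : ∀ s, ∫ x in edge j, ‖F s x‖ ^ 2 ≤ Real.pi * B ^ 2 := by
    intro s
    have hfin : IsFiniteMeasure ((volume : Measure ℝ).restrict (edge j)) := ⟨by simp [edge]⟩
    rw [← volume_real_edge j, ← smul_eq_mul, ← setIntegral_const]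
    refine integral_mono_ae (integrable_norm_sq_Lp _).integrableOn (integrable_const _) ?_
    filter_upwards [h s] with x hx
    gcongr
  rw [edgeSq, Fin.sum_univ_two]
  have h0 := key 0
  have h1 := key 1
  linarith

theorem isSobolevTwo_of_hasDerivAt {j : ℤ} {u u' u'' : ℝ → ℂ} (h1 : ∀ x, HasDerivAt u (u' x) x)
    (h2 : ∀ x, HasDerivAt u' (u'' x) x) (h3 : Continuous u'') : IsSobolevTwo j u u' u'' := by
  have hc : Continuous u' := continuous_iff_continuousAt.2 fun x => (h2 x).continuousAt
  refine ⟨?_, fun x _ => ?_, fun x _ => ?_⟩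
  · have hfin : IsFiniteMeasure ((volume : Measure ℝ).restrict (edge j)) := ⟨by simp [edge]⟩
    obtain ⟨C, hC⟩ := (isCompact_Icc (a := (j : ℝ) * Real.pi)
      (b := ((j : ℝ) + 1) * Real.pi)).exists_bound_of_continuousOn h3.continuousOn
    exact MemLp.of_bound h3.aestronglyMeasurable C ((ae_restrict_iff' (measurableSet_edge j)).2
      (Eventually.of_forall fun x hx => hC x (Set.Ioo_subset_Icc_self hx)))
  · rw [intervalIntegral.integral_eq_sub_of_hasDerivAt (fun t _ => h1 t)
      (hc.intervalIntegrable _ _)]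
    ring
  · rw [intervalIntegral.integral_eq_sub_of_hasDerivAt (fun t _ => h2 t)
      (h3.intervalIntegrable _ _)]
    ring

/-- Every square summable sequence of vertex values is attained in the domain of the Hamiltonian,
with `H - E` controlled by the residual of the recursion. -/
theorem exists_mem_graph_vertexValue {E : ℝ} (hS : edgeSin E ≠ 0) :
    ∃ K : ℝ, 0 ≤ K ∧ ∀ (a : ℤ → ℝ) (y R : ℤ → ℂ),
      (∀ j, R j = y (j + 1) + y (j - 1) - (2 * edgeCos E + a j * edgeSin E / 2 : ℝ) * y j) →
      (Summable fun j => ‖y j‖ ^ 2) → (Summable fun j => ‖R j‖ ^ 2) →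
      ∃ p ∈ hamiltonianGraph 0 a, (∀ j, vertexValue E p j = y j) ∧
        ‖p.2 - (E : ℂ) • p.1‖ ^ 2 ≤ K * ∑' j, ‖R j‖ ^ 2 ∧
        ∀ j, y j = 0 → y (j + 1) = 0 → R j = 0 → edgeSq p.1 j = 0 := by
  obtain ⟨K₁, hK₁0, hK₁⟩ := exists_bound_edge (continuous_sinE E)
  obtain ⟨K₂, hK₂0, hK₂⟩ := exists_bound_edge continuous_testFun
  obtain ⟨K₃, hK₃0, hK₃⟩ := exists_bound_edge (continuous_edgeTestFun E)
  have hSc : (edgeSin E : ℂ) ≠ 0 := Complex.ofReal_ne_zero.2 hS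
  refine ⟨2 * Real.pi * (K₃ / |edgeSin E|) ^ 2, by have := Real.pi_pos; positivity,
    fun a y R hR hy hRs => ?_⟩
  set u : Fin 2 → ℤ → ℝ → ℂ := fun _ j x =>
    (y j * sinE E ((j + 1) * Real.pi - x) + y (j + 1) * sinE E (x - j * Real.pi)) / edgeSin E
      - R j / edgeSin E * testFun (x - j * Real.pi) with hu
  set u' : Fin 2 → ℤ → ℝ → ℂ := fun _ j x =>
    (y j * (-cosE E ((j + 1) * Real.pi - x) : ℝ) + y (j + 1) * cosE E (x - j * Real.pi))
      / edgeSin E - R j / edgeSin E * testFunDeriv (x - j * Real.pi) with hu'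
  set u'' : Fin 2 → ℤ → ℝ → ℂ := fun _ j x =>
    (y j * (-E * sinE E ((j + 1) * Real.pi - x) : ℝ)
      + y (j + 1) * (-E * sinE E (x - j * Real.pi) : ℝ)) / edgeSin E
      - R j / edgeSin E * testFunDerivTwo (x - j * Real.pi) with hu''
  have d1 : ∀ s j x, HasDerivAt (u s j) (u' s j x) x := by
    intro s j x
    have e1 : HasDerivAt (fun x => sinE E ((j + 1) * Real.pi - x))
        (-cosE E ((j + 1) * Real.pi - x)) x := (hasDerivAt_sinE E _).comp_const_sub _ x
    have e2 : HasDerivAt (fun x => sinE E (x - j * Real.pi)) (cosE E (x - j * Real.pi)) x :=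
      (hasDerivAt_sinE E _).comp_sub_const x _
    have e3 : HasDerivAt (fun x => testFun (x - j * Real.pi)) (testFunDeriv (x - j * Real.pi)) x :=
      (hasDerivAt_testFun _).comp_sub_const x _
    exact (((e1.ofReal_comp.const_mul (y j)).add (e2.ofReal_comp.const_mul (y (j + 1)))).div_const
      _).sub (e3.ofReal_comp.const_mul _)
  have d2 : ∀ s j x, HasDerivAt (u' s j) (u'' s j x) x := by
    intro s j x
    have e1 : HasDerivAt (fun x => -cosE E ((j + 1) * Real.pi - x))
        (-E * sinE E ((j + 1) * Real.pi - x)) x :=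
      ((hasDerivAt_cosE E _).comp_const_sub _ x).neg.congr_deriv (by ring)
    have e2 : HasDerivAt (fun x => cosE E (x - j * Real.pi)) (-E * sinE E (x - j * Real.pi)) x :=
      (hasDerivAt_cosE E _).comp_sub_const x _
    have e3 : HasDerivAt (fun x => testFunDeriv (x - j * Real.pi))
        (testFunDerivTwo (x - j * Real.pi)) x :=
      (hasDerivAt_testFunDeriv _).comp_sub_const x _
    exact (((e1.ofReal_comp.const_mul (y j)).add (e2.ofReal_comp.const_mul (y (j + 1)))).div_const
      _).sub (e3.ofReal_comp.const_mul _)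
  have cs := continuous_sinE E
  have ct := continuous_testFun
  have ct2 := continuous_testFunDerivTwo
  have c3 : ∀ s j, Continuous (u'' s j) := by
    intro s j
    simp only [hu'']
    fun_prop
  have c1 : ∀ s j, Continuous (u s j) := fun s j =>
    continuous_iff_continuousAt.2 fun x => (d1 s j x).continuousAt
  have uleft : ∀ s j, u s j (j * Real.pi) = y j := by
    intro s j
    have e : ((j : ℝ) + 1) * Real.pi - j * Real.pi = Real.pi := by ring
    simp only [hu, e, sub_self, sinE_at_zero]
    rw [show testFun 0 = 0 by simp [testFun]]
    change (y j * (edgeSin E : ℂ) + y (j + 1) * (0 : ℝ)) / edgeSin E - _ = _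
    field_simp
    simp
  have uright : ∀ s j, u s j ((j + 1) * Real.pi) = y (j + 1) := by
    intro s j
    have e : ((j : ℝ) + 1) * Real.pi - j * Real.pi = Real.pi := by ring
    simp only [hu, e, sub_self, sinE_at_zero]
    rw [show testFun Real.pi = 0 by simp [testFun]]
    change (y j * (0 : ℝ) + y (j + 1) * (edgeSin E : ℂ)) / edgeSin E - _ = _
    field_simp
    simp
  have u'left : ∀ s j, u' s j (j * Real.pi) * edgeSin E
      = y (j + 1) - y j * edgeCos E - R j := by
    intro s j
    have e : ((j : ℝ) + 1) * Real.pi - j * Real.pi = Real.pi := by ring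
    simp only [hu', e, sub_self, cosE_at_zero]
    rw [show testFunDeriv 0 = 1 by simp [testFunDeriv, Real.pi_ne_zero], edgeCos]
    push_cast
    field_simp
    ring
  have u'right : ∀ s j, u' s j ((j + 1) * Real.pi) * edgeSin E = y (j + 1) * edgeCos E - y j := by
    intro s j
    have e : ((j : ℝ) + 1) * Real.pi - j * Real.pi = Real.pi := by ring
    simp only [hu', e, sub_self, cosE_at_zero]
    rw [show testFunDeriv Real.pi = 0 by simp [testFunDeriv], edgeCos]
    push_cast
    field_simp
    ring
  have cast1 : ∀ j : ℤ, ((j - 1 : ℤ) : ℝ) + 1 = j := fun j => by push_cast; ring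
  have hcoup : IsDeltaCoupled 0 a u u' u'' := by
    refine ⟨fun s j => isSobolevTwo_of_hasDerivAt (d1 s j) (d2 s j) (c3 s j), fun s j => ?_,
      fun s j => ?_, fun j => ?_⟩
    · exact (uleft s j).trans (uleft 0 j).symm
    · have := uright s (j - 1)
      rw [cast1, sub_add_cancel] at this
      exact this.trans (uleft 0 j).symm
    · have e1 := fun s => u'right s (j - 1)
      simp only [cast1, sub_add_cancel] at e1
      have hq : ∀ (s : Fin 2) (v v' : ℝ → ℂ) (x : ℝ), quasiDeriv 0 s v v' x = v' x := by
        intro s v v' x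
        simp [quasiDeriv]
      simp only [hq, Fin.sum_univ_two, uleft]
      refine mul_right_cancel₀ hSc ?_
      have e2 := u'left 0 j
      have e3 := u'left 1 j
      have e4 := e1 0
      have e5 := e1 1
      have e6 := hR j
      push_cast at e6
      linear_combination e2 + e3 - e4 - e5 - 2 * e6
  have htr : ∀ (k : ℤ) (t : ℝ), t ∈ edge k → t - k * Real.pi ∈ Set.Icc 0 Real.pi := fun k t ht =>
    ⟨by linarith [ht.1], by linarith [ht.2]⟩
  have htr' : ∀ (k : ℤ) (t : ℝ), t ∈ edge k → (k + 1) * Real.pi - t ∈ Set.Icc 0 Real.pi :=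
    fun k t ht => ⟨by linarith [ht.2], by linarith [ht.1]⟩
  have hS0 : 0 < |edgeSin E| := abs_pos.2 hS
  have bu : ∀ s j, ∀ x ∈ edge j, ‖u s j x‖
      ≤ (K₁ * (‖y j‖ + ‖y (j + 1)‖) + K₂ * ‖R j‖) / |edgeSin E| := by
    intro s j x hx
    have e1 := hK₁ _ (htr j x hx)
    have e2 := hK₁ _ (htr' j x hx)
    have e3 := hK₂ _ (htr j x hx)
    refine (norm_sub_le _ _).trans ?_
    rw [norm_div, norm_mul, norm_div, Complex.norm_real, Complex.norm_real, Real.norm_eq_abs,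
      Real.norm_eq_abs, div_mul_eq_mul_div, ← add_div, mul_comm K₂]
    gcongr
    refine (norm_add_le _ _).trans ?_
    rw [norm_mul, norm_mul, Complex.norm_real, Complex.norm_real, Real.norm_eq_abs,
      Real.norm_eq_abs, mul_add, mul_comm K₁, mul_comm K₁]
    gcongr
  have hy1 : Summable fun j => ‖y (j + 1)‖ ^ 2 :=
    (Equiv.addRight (1 : ℤ)).summable_iff (f := fun j => ‖y j‖ ^ 2) |>.2 hy
  have sB : Summable fun j =>
      ((K₁ * (‖y j‖ + ‖y (j + 1)‖) + K₂ * ‖R j‖) / |edgeSin E|) ^ 2 := by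
    refine Summable.of_nonneg_of_le (fun _ => sq_nonneg _) (fun j => ?_)
      (((hy.add hy1).mul_left (3 * K₁ ^ 2 / |edgeSin E| ^ 2)).add
        (hRs.mul_left (3 * K₂ ^ 2 / |edgeSin E| ^ 2)))
    rw [div_pow, div_mul_eq_mul_div, div_mul_eq_mul_div, ← add_div]
    gcongr
    nlinarith [sq_nonneg (K₁ * ‖y j‖ - K₁ * ‖y (j + 1)‖), sq_nonneg (K₁ * ‖y j‖ - K₂ * ‖R j‖),
      sq_nonneg (K₁ * ‖y (j + 1)‖ - K₂ * ‖R j‖)]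
  choose F hF using fun s => exists_Lp_of_edges (c1 s) (bu s) sB
  set w : ℤ → ℝ → ℂ := fun j x => R j / edgeSin E
    * (E * testFun (x - j * Real.pi) + testFunDerivTwo (x - j * Real.pi) : ℝ) with hw
  have bw : ∀ j, ∀ x ∈ edge j, ‖w j x‖ ≤ K₃ / |edgeSin E| * ‖R j‖ := by
    intro j x hx
    have e3 := hK₃ _ (htr j x hx)
    simp only [hw]
    rw [norm_mul, norm_div, Complex.norm_real, Complex.norm_real, Real.norm_eq_abs,
      Real.norm_eq_abs, div_mul_eq_mul_div, div_mul_eq_mul_div, mul_comm K₃]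
    gcongr
  have cw : ∀ j, Continuous (w j) := by
    intro j
    simp only [hw]
    fun_prop
  have sw : Summable fun j => (K₃ / |edgeSin E| * ‖R j‖) ^ 2 :=
    (hRs.mul_left ((K₃ / |edgeSin E|) ^ 2)).congr fun j => by ring
  obtain ⟨G₀, hG₀⟩ := exists_Lp_of_edges cw bw sw
  set f : StateSpace := WithLp.toLp 2 F with hf
  set G : StateSpace := WithLp.toLp 2 (fun _ => G₀) with hG
  have hmemF : ∀ s j, f s =ᵐ[volume.restrict (edge j)] u s j := fun s j => hF s j
  have hmemG : ∀ s j, ((E : ℂ) • f + G) s =ᵐ[volume.restrict (edge j)]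
      fun x => -quasiDerivTwo 0 s (u s j) (u' s j) (u'' s j) x := by
    intro s j
    filter_upwards [hmemF s j, hG₀ j, ae_restrict_of_ae (Lp.coeFn_add ((E : ℂ) • f s) G₀),
      ae_restrict_of_ae (Lp.coeFn_smul (E : ℂ) (f s))] with x e1 e2 e3 e4
    refine e3.trans ?_
    rw [Pi.add_apply, e4, Pi.smul_apply, e1, e2]
    simp only [quasiDerivTwo, quasiDeriv, hu, hu'', hw, smul_eq_mul]
    push_cast
    ring
  refine ⟨(f, (E : ℂ) • f + G), ⟨u, u', u'', hcoup, hmemF, hmemG⟩, fun j => ?_, ?_, ?_⟩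
  · exact (vertexValue_eq hcoup hmemF hmemG E j).trans (uleft 0 j)
  · change ‖(E : ℂ) • f + G - (E : ℂ) • f‖ ^ 2 ≤ _
    rw [add_sub_cancel_left, ← (hasSum_edgeSq G).tsum_eq, ← tsum_mul_left]
    refine (hasSum_edgeSq G).summable.tsum_le_tsum (fun j => ?_) (hRs.mul_left _)
    have hb : ∀ s, ∀ᵐ x ∂(volume.restrict (edge j)), ‖G s x‖ ≤ K₃ / |edgeSin E| * ‖R j‖ := by
      intro s
      filter_upwards [hG₀ j, ae_restrict_mem (measurableSet_edge j)] with x e1 e2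
      exact (congrArg norm e1).trans_le (bw j x e2)
    refine (edgeSq_le_of_bound hb).trans (le_of_eq ?_)
    ring
  · intro j h0 h1 h2
    have hb : ∀ s, ∀ᵐ x ∂(volume.restrict (edge j)), ‖f s x‖ ≤ 0 := by
      intro s
      filter_upwards [hmemF s j] with x e1
      rw [e1]
      simp [hu, h0, h1, h2]
    have := edgeSq_le_of_bound hb
    exact le_antisymm (by simpa using this) (edgeSq_nonneg _ _)

/-- At the ring energies there are eigenfunctions supported on a single ring. -/
theorem exists_ring_eigenfunction {E : ℝ} (hS : edgeSin E = 0) (a : ℤ → ℝ) (i : ℤ) :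
    ∃ f : StateSpace, f ≠ 0 ∧ (f, (E : ℂ) • f) ∈ hamiltonianGraph 0 a ∧
      ∀ j, j ≠ i → edgeSq f j = 0 := by
  obtain ⟨K₁, hK₁0, hK₁⟩ := exists_bound_edge (continuous_sinE E)
  set c : Fin 2 → ℤ → ℝ := fun s j => if j = i then orientation s else 0 with hc
  have hc0 : ∀ j, c 0 j + c 1 j = 0 := by
    intro j
    by_cases h : j = i <;> simp [hc, h, orientation]
  set u : Fin 2 → ℤ → ℝ → ℂ := fun s j x => (c s j * sinE E (x - j * Real.pi) : ℝ) with hu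
  set u' : Fin 2 → ℤ → ℝ → ℂ := fun s j x => (c s j * cosE E (x - j * Real.pi) : ℝ) with hu'
  set u'' : Fin 2 → ℤ → ℝ → ℂ := fun s j x =>
    (c s j * (-E * sinE E (x - j * Real.pi)) : ℝ) with hu''
  have d1 : ∀ s j x, HasDerivAt (u s j) (u' s j x) x := fun s j x =>
    (((hasDerivAt_sinE E _).comp_sub_const x (j * Real.pi)).const_mul (c s j)).ofReal_comp
  have d2 : ∀ s j x, HasDerivAt (u' s j) (u'' s j x) x := fun s j x =>
    (((hasDerivAt_cosE E _).comp_sub_const x (j * Real.pi)).const_mul (c s j)).ofReal_comp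
  have cs := continuous_sinE E
  have c3 : ∀ s j, Continuous (u'' s j) := by
    intro s j
    simp only [hu'']
    fun_prop
  have c1 : ∀ s j, Continuous (u s j) := fun s j =>
    continuous_iff_continuousAt.2 fun x => (d1 s j x).continuousAt
  have uleft : ∀ s j, u s j (j * Real.pi) = 0 := by
    intro s j
    simp [hu, sinE_at_zero]
  have cast1 : ∀ j : ℤ, (j : ℝ) * Real.pi - ((j - 1 : ℤ) : ℝ) * Real.pi = Real.pi :=
    fun j => by push_cast; ring
  have hcoup : IsDeltaCoupled 0 a u u' u'' := by
    refine ⟨fun s j => isSobolevTwo_of_hasDerivAt (d1 s j) (d2 s j) (c3 s j), fun s j => ?_,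
      fun s j => ?_, fun j => ?_⟩
    · rw [uleft, uleft]
    · rw [uleft]
      simp only [hu, cast1]
      rw [show sinE E Real.pi = 0 from hS]
      simp
    · have hq : ∀ (s : Fin 2) (v v' : ℝ → ℂ) (x : ℝ), quasiDeriv 0 s v v' x = v' x := by
        intro s v v' x
        simp [quasiDeriv]
      simp only [hq, Fin.sum_univ_two, uleft, hu', cast1, sub_self]
      rw [← Complex.ofReal_add, ← Complex.ofReal_add, ← add_mul, ← add_mul, hc0, hc0]
      simp
  have bu : ∀ s j, ∀ x ∈ edge j, ‖u s j x‖ ≤ if j = i then K₁ else 0 := by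
    intro s j x hx
    have e1 := hK₁ (x - j * Real.pi) ⟨by linarith [hx.1], by linarith [hx.2]⟩
    simp only [hu]
    rw [Complex.norm_real, Real.norm_eq_abs, abs_mul]
    by_cases h : j = i
    · have : |c s j| = 1 := by
        fin_cases s <;> simp [hc, h, orientation]
      rw [this, if_pos h, one_mul]
      exact e1
    · simp [hc, h]
  have sB : Summable fun j => (if j = i then K₁ else 0) ^ 2 := by
    refine summable_of_ne_finset_zero (s := {i}) fun j hj => ?_
    rw [if_neg (by simpa using hj)]
    simp
  choose F hF using fun s => exists_Lp_of_edges (c1 s) (bu s) sB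
  set f : StateSpace := WithLp.toLp 2 F with hf
  have hmemF : ∀ s j, f s =ᵐ[volume.restrict (edge j)] u s j := fun s j => hF s j
  have hmemG : ∀ s j, ((E : ℂ) • f) s =ᵐ[volume.restrict (edge j)]
      fun x => -quasiDerivTwo 0 s (u s j) (u' s j) (u'' s j) x := by
    intro s j
    filter_upwards [hmemF s j, ae_restrict_of_ae (Lp.coeFn_smul (E : ℂ) (f s))] with x e1 e4
    refine e4.trans ?_
    rw [Pi.smul_apply, e1]
    simp only [quasiDerivTwo, quasiDeriv, hu, hu'', smul_eq_mul]
    push_cast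
    ring
  refine ⟨f, fun h0 => ?_, ⟨u, u', u'', hcoup, hmemF, hmemG⟩, fun j hj => ?_⟩
  · have e1 : u 0 i =ᵐ[volume.restrict (edge i)] 0 := by
      refine (hmemF 0 i).symm.trans ?_
      rw [h0]
      exact ae_restrict_of_ae (Lp.coeFn_zero ℂ 2 (volume : Measure ℝ))
    have hsob := hcoup.sobolev 0 i
    have e2 := primitive_eq_zero (vertex_le i) hsob.intervalIntegrable_one hsob.deriv_one e1
    have e3 : Set.EqOn (u' 0 i) 0 (Set.Ioo (i * Real.pi) ((i + 1) * Real.pi)) :=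
      Measure.eqOn_Ioo_of_ae_eq (μ := volume) e2
        (continuous_iff_continuousAt.2 fun x => (d2 0 i x).continuousAt).continuousOn
        continuousOn_const
    have e4 : Set.EqOn (u 0 i) 0 (Set.Ioo (i * Real.pi) ((i + 1) * Real.pi)) :=
      Measure.eqOn_Ioo_of_ae_eq (μ := volume) e1 (c1 0 i).continuousOn continuousOn_const
    have hx : (i : ℝ) * Real.pi + Real.pi / 2 ∈ Set.Ioo (i * Real.pi) ((i + 1) * Real.pi) := by
      have := Real.pi_pos
      constructor <;> linarith
    have f1 := e3 hx
    have f2 := e4 hx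
    simp only [hu, hu', hc, if_true, orientation, Matrix.cons_val_zero, one_mul, Pi.zero_apply,
      Complex.ofReal_eq_zero] at f1 f2
    have := cosE_sq_add E (i * Real.pi + Real.pi / 2 - i * Real.pi)
    rw [f1, f2] at this
    norm_num at this
  · have hb : ∀ s, ∀ᵐ x ∂(volume.restrict (edge j)), ‖f s x‖ ≤ 0 := by
      intro s
      filter_upwards [hmemF s j] with x e1
      rw [e1]
      simp [hu, hc, hj]
    have := edgeSq_le_of_bound hb
    exact le_antisymm (by simpa using this) (edgeSq_nonneg _ _)

/-! ### The essential spectrum -/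

theorem norm_inner_le_tail {v f : StateSpace} {N : ℤ} (hf : ∀ j < N, edgeSq f j = 0) {η : ℝ}
    (hη : 0 < η) :
    ‖inner ℂ v f‖ ≤ η / 2 * ‖f‖ ^ 2
      + 1 / (2 * η) * ∑' j, if N ≤ j then edgeSq v j else 0 := by
  have hint : ∀ s, Integrable fun x => ‖v s x‖ * ‖f s x‖ := fun s =>
    (Lp.memLp (v s)).norm.integrable_mul (Lp.memLp (f s)).norm
  have h1 : ‖inner ℂ v f‖ ≤ ∑ s, ∫ x, ‖v s x‖ * ‖f s x‖ := by
    rw [PiLp.inner_apply]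
    refine (norm_sum_le _ _).trans (Finset.sum_le_sum fun s _ => ?_)
    rw [L2.inner_def]
    refine (norm_integral_le_integral_norm _).trans ?_
    exact integral_mono_of_nonneg (Eventually.of_forall fun _ => norm_nonneg _) (hint s)
      (Eventually.of_forall fun x => norm_inner_le_norm _ _)
  have h2 : HasSum (fun j => ∑ s, ∫ x in edge j, ‖v s x‖ * ‖f s x‖)
      (∑ s, ∫ x, ‖v s x‖ * ‖f s x‖) := hasSum_sum fun s _ => hasSum_integral_edge (hint s)
  have hv : Summable fun j => if N ≤ j then edgeSq v j else 0 := by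
    refine Summable.of_nonneg_of_le (fun j => ?_) (fun j => ?_) (hasSum_edgeSq v).summable
    · split_ifs
      exacts [edgeSq_nonneg _ _, le_rfl]
    · split_ifs
      exacts [le_rfl, edgeSq_nonneg _ _]
  have h3 := ((hasSum_edgeSq f).mul_left (η / 2)).add (hv.hasSum.mul_left (1 / (2 * η)))
  refine h1.trans (hasSum_le (fun j => ?_) h2 h3)
  have key : ∀ s, ∫ x in edge j, ‖v s x‖ * ‖f s x‖ ≤ η / 2 * (∫ x in edge j, ‖f s x‖ ^ 2)
      + 1 / (2 * η) * ∫ x in edge j, ‖v s x‖ ^ 2 := by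
    intro s
    have i1 := (integrable_norm_sq_Lp (f s)).integrableOn (s := edge j)
    have i2 := (integrable_norm_sq_Lp (v s)).integrableOn (s := edge j)
    rw [← integral_const_mul, ← integral_const_mul,
      ← integral_add (i1.const_mul _) (i2.const_mul _)]
    refine integral_mono (hint s).integrableOn ((i1.const_mul _).add (i2.const_mul _)) fun x => ?_
    have h4 : η / 2 * ‖f s x‖ ^ 2 + 1 / (2 * η) * ‖v s x‖ ^ 2 - ‖v s x‖ * ‖f s x‖
        = 1 / (2 * η) * (η * ‖f s x‖ - ‖v s x‖) ^ 2 := by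
      field_simp
      ring
    have h5 : 0 ≤ 1 / (2 * η) * (η * ‖f s x‖ - ‖v s x‖) ^ 2 := by positivity
    change ‖v s x‖ * ‖f s x‖ ≤ η / 2 * ‖f s x‖ ^ 2 + 1 / (2 * η) * ‖v s x‖ ^ 2
    linarith
  by_cases hj : N ≤ j
  · rw [if_pos hj, edgeSq, edgeSq, Finset.mul_sum, Finset.mul_sum, ← Finset.sum_add_distrib]
    exact Finset.sum_le_sum fun s _ => key s
  · rw [if_neg hj, hf j (not_le.1 hj)]
    have hz : ∀ s, ∫ x in edge j, ‖f s x‖ ^ 2 = 0 := fun s =>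
      (Finset.sum_eq_zero_iff_of_nonneg
        (fun _ _ => integral_nonneg fun _ => sq_nonneg _)).1 (hf j (not_le.1 hj)) s
        (Finset.mem_univ s)
    have hz' : ∀ s, ∫ x in edge j, ‖v s x‖ * ‖f s x‖ = 0 := by
      intro s
      have := (integral_eq_zero_iff_of_nonneg (fun _ => sq_nonneg _)
        ((integrable_norm_sq_Lp (f s)).integrableOn (s := edge j))).1 (hz s)
      refine integral_eq_zero_of_ae ?_
      filter_upwards [this] with x hx
      have h0 : ‖f s x‖ = 0 := by simpa using hx
      simp [h0]
    simp [hz']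

theorem tendsto_tail (v : StateSpace) :
    Tendsto (fun n : ℕ => ∑' j, if (n : ℤ) ≤ j then edgeSq v j else 0) atTop (𝓝 0) := by
  have h := tendsto_tsum_of_dominated_convergence (𝓕 := atTop)
    (f := fun (n : ℕ) (j : ℤ) => if (n : ℤ) ≤ j then edgeSq v j else 0) (g := fun _ => (0 : ℝ))
    (bound := edgeSq v) (hasSum_edgeSq v).summable (fun j => ?_)
    (Eventually.of_forall fun n j => ?_)
  · simpa using h
  · refine tendsto_const_nhds.congr' ?_
    filter_upwards [eventually_gt_atTop j.toNat] with n hn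
    rw [if_neg (by omega)]
  · split_ifs
    · rw [Real.norm_of_nonneg (edgeSq_nonneg _ _)]
    · simpa using edgeSq_nonneg v j

/-- Approximate eigenfunctions escaping to infinity give a point of the essential spectrum. -/
theorem mem_essentialSpectrum_of_escaping {a : ℤ → ℝ} {E : ℝ}
    (h : ∀ δ : ℝ, 0 < δ → ∀ N : ℕ, ∃ p ∈ hamiltonianGraph 0 a, p.1 ≠ 0 ∧
      ‖p.2 - (E : ℂ) • p.1‖ ≤ δ * ‖p.1‖ ∧ ∀ j < (N : ℤ), edgeSq p.1 j = 0) :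
    E ∈ essentialSpectrum (hamiltonian 0 a) := by
  rw [mem_essentialSpectrum_iff]
  choose p hp hp0 hpE hpN using fun n : ℕ => h (1 / ((n : ℝ) + 1)) (by positivity) n
  have hn0 : ∀ n, ‖(p n).1‖ ≠ 0 := fun n => norm_ne_zero_iff.2 (hp0 n)
  set c : ℕ → ℂ := fun n => ((‖(p n).1‖⁻¹ : ℝ) : ℂ) with hc
  have hcn : ∀ n, ‖c n‖ = ‖(p n).1‖⁻¹ := fun n => by
    rw [hc, Complex.norm_real, Real.norm_of_nonneg (inv_nonneg.2 (norm_nonneg _))]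
  have hnorm : ∀ n, ‖c n • (p n).1‖ = 1 := fun n => by
    rw [norm_smul, hcn, inv_mul_cancel₀ (hn0 n)]
  have hsq : ∀ n : ℕ, ∀ j < (n : ℤ), edgeSq (c n • (p n).1) j = 0 := by
    intro n j hj
    have h1 : edgeSq (c n • (p n).1) j = ‖c n‖ ^ 2 * edgeSq (p n).1 j := by
      rw [edgeSq, edgeSq, Finset.mul_sum]
      refine Finset.sum_congr rfl fun s _ => ?_
      rw [← integral_const_mul]
      refine integral_congr_ae (ae_restrict_of_ae ?_)
      filter_upwards [Lp.coeFn_smul (c n) ((p n).1 s)] with x hx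
      change ‖(c n • (p n).1 s : Lp ℂ 2 (volume : Measure ℝ)) x‖ ^ 2 = _
      rw [hx, Pi.smul_apply, norm_smul, mul_pow]
    rw [h1, hpN n j hj, mul_zero]
  refine ⟨fun n => c n • p n, fun n => Submodule.smul_mem _ _ (hp n), hnorm, fun v => ?_, ?_⟩
  · rw [Metric.tendsto_atTop]
    intro η hη
    have h1 := (tendsto_tail v).eventually (gt_mem_nhds (show 0 < η ^ 2 by positivity))
    obtain ⟨n₀, hn₀⟩ := eventually_atTop.1 h1
    refine ⟨n₀, fun n hn => ?_⟩
    rw [dist_zero_right]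
    have h2 := norm_inner_le_tail (v := v) (hsq n) hη
    rw [hnorm n] at h2
    refine lt_of_le_of_lt h2 ?_
    have h3 : 1 / (2 * η) * (∑' j, if (n : ℤ) ≤ j then edgeSq v j else 0)
        < 1 / (2 * η) * η ^ 2 := mul_lt_mul_of_pos_left (hn₀ n hn) (by positivity)
    have h4 : 1 / (2 * η) * η ^ 2 = η / 2 := by field_simp
    linarith
  · refine squeeze_zero_norm (fun n => ?_) tendsto_one_div_add_atTop_nhds_zero_nat
    have h1 : (c n • p n).2 - (E : ℂ) • (c n • p n).1 = c n • ((p n).2 - (E : ℂ) • (p n).1) := by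
      rw [Prod.smul_fst, Prod.smul_snd, smul_sub, smul_comm]
    rw [h1, norm_smul, hcn]
    have h2 := mul_le_mul_of_nonneg_left (hpE n) (inv_nonneg.2 (norm_nonneg (p n).1))
    refine h2.trans (le_of_eq ?_)
    have := hn0 n
    field_simp

/-- Half of the trace of the transfer matrix over one ring. -/
def discriminant (α E : ℝ) : ℝ := edgeCos E + α * edgeSin E / 4

theorem continuous_discriminant (α : ℝ) : Continuous (discriminant α) := by
  have h1 := continuous_edgeCos
  have h2 := continuous_edgeSin
  unfold discriminant
  fun_prop

theorem mem_essentialSpectrum_of_band {a : ℤ → ℝ} {α E : ℝ} {m : ℕ} (hα : ∀ j > (m : ℤ), a j = α)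
    (hE : |discriminant α E| ≤ 1) : E ∈ essentialSpectrum (hamiltonian 0 a) := by
  refine mem_essentialSpectrum_of_escaping fun δ hδ N => ?_
  by_cases hS : edgeSin E = 0
  · obtain ⟨f, hf0, hf, hfs⟩ := exists_ring_eigenfunction hS a N
    refine ⟨_, hf, hf0, ?_, fun j hj => hfs j hj.ne⟩
    simp only [sub_self, norm_zero]
    positivity
  obtain ⟨K, hK0, hK⟩ := exists_vertexValue_bounds hS
  obtain ⟨K', hK'0, hK'⟩ := exists_mem_graph_vertexValue hS
  set ω : ℂ := Complex.exp (Real.arccos (discriminant α E) * Complex.I) with hω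
  have hω0 : ω ≠ 0 := Complex.exp_ne_zero _
  have hω1 : ‖ω‖ = 1 := Complex.norm_exp_ofReal_mul_I _
  have hω2 : ω + ω⁻¹ = (2 * discriminant α E : ℝ) := by
    obtain ⟨h1, h2⟩ := abs_le.1 hE
    rw [hω, ← Complex.exp_neg, ← neg_mul, ← Complex.two_cos, ← Complex.ofReal_cos,
      Real.cos_arccos h1 h2]
    push_cast
    rfl
  obtain ⟨n, hn⟩ := exists_nat_gt (K * (16 * K' + 16 * K' / δ ^ 2))
  set M : ℤ := N + m + 3 with hM
  set χ : ℤ → ℂ := fun j => if M ≤ j ∧ j < M + n then 1 else 0 with hχ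
  set y : ℤ → ℂ := fun j => χ j * ω ^ j with hy
  set R : ℤ → ℂ := fun j => y (j + 1) + y (j - 1)
    - (2 * edgeCos E + a j * edgeSin E / 2 : ℝ) * y j with hR
  have hχn : ∀ i j, ‖χ i - χ j‖ ≤ 1 := by
    intro i j
    simp only [hχ]
    split_ifs <;> simp
  have hRform : ∀ j, R j = (χ (j + 1) - χ j) * ω ^ (j + 1) + (χ (j - 1) - χ j) * ω ^ (j - 1) := by
    intro j
    have h1 : ((2 * edgeCos E + a j * edgeSin E / 2 : ℝ) : ℂ) * y j = (ω + ω⁻¹) * y j := by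
      by_cases hj : M ≤ j ∧ j < M + n
      · rw [hα j (by omega), hω2, discriminant]
        push_cast
        ring
      · simp [hy, hχ, hj]
    simp only [hR]
    rw [h1]
    simp only [hy]
    rw [zpow_add_one₀ hω0, zpow_sub_one₀ hω0]
    ring
  have hR2 : ∀ j, ‖R j‖ ^ 2 ≤ 4 := by
    intro j
    have h1 : ‖R j‖ ≤ 2 := by
      rw [hRform]
      refine (norm_add_le _ _).trans ?_
      rw [norm_mul, norm_mul, norm_zpow, norm_zpow, hω1, one_zpow, one_zpow]
      linarith [hχn (j + 1) j, hχn (j - 1) j]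
    nlinarith [norm_nonneg (R j)]
  have hR0 : ∀ j, j ∉ ({M - 1, M, M + n - 1, M + n} : Finset ℤ) → R j = 0 := by
    intro j hj
    simp only [Finset.mem_insert, Finset.mem_singleton, not_or] at hj
    have h1 : χ (j + 1) = χ j := by
      simp only [hχ]
      exact if_congr (by omega) rfl rfl
    have h2 : χ (j - 1) = χ j := by
      simp only [hχ]
      exact if_congr (by omega) rfl rfl
    rw [hRform, h1, h2]
    ring
  have hRsum : HasSum (fun j => ‖R j‖ ^ 2)
      (∑ j ∈ ({M - 1, M, M + n - 1, M + n} : Finset ℤ), ‖R j‖ ^ 2) :=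
    hasSum_sum_of_ne_finset_zero fun j hj => by rw [hR0 j hj]; simp
  have hRle : ∑' j, ‖R j‖ ^ 2 ≤ 16 := by
    rw [hRsum.tsum_eq]
    refine (Finset.sum_le_card_nsmul _ _ 4 fun j _ => hR2 j).trans ?_
    rw [nsmul_eq_mul]
    have h1 : (({M - 1, M, M + n - 1, M + n} : Finset ℤ).card : ℝ) ≤ 4 := by
      exact_mod_cast Finset.card_le_four
    linarith
  have hynorm : ∀ j, ‖y j‖ ^ 2 = if j ∈ Finset.Ico M (M + n) then 1 else 0 := by
    intro j
    simp only [hy, hχ, Finset.mem_Ico]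
    rw [norm_mul, norm_zpow, hω1, one_zpow]
    split_ifs <;> simp
  have hysum : HasSum (fun j => ‖y j‖ ^ 2) n := by
    have h1 : HasSum (fun j => ‖y j‖ ^ 2) (∑ j ∈ Finset.Ico M (M + n), ‖y j‖ ^ 2) :=
      hasSum_sum_of_ne_finset_zero fun j hj => by rw [hynorm, if_neg hj]
    have h2 : ∑ j ∈ Finset.Ico M (M + n), ‖y j‖ ^ 2 = n := by
      rw [Finset.sum_congr rfl fun j hj => by rw [hynorm, if_pos hj]]
      simp
    rwa [h2] at h1
  obtain ⟨p, hp, hpv, hpn, hp0⟩ := hK' a y R (fun _ => rfl) hysum.summable hRsum.summable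
  set g := p.2 - (E : ℂ) • p.1 with hg
  have hgn : ‖g‖ ^ 2 ≤ 16 * K' := hpn.trans (by nlinarith)
  have hlow : (n : ℝ) ≤ K * (‖p.1‖ ^ 2 + ‖g‖ ^ 2) := by
    refine hasSum_le (fun j => ?_) hysum
      (((hasSum_edgeSq p.1).add (hasSum_edgeSq g)).mul_left K)
    rw [← hpv]
    exact (hK a p hp j).2.2
  have hlow2 : 16 * K' / δ ^ 2 < ‖p.1‖ ^ 2 := by
    by_contra! hcon
    have : K * (‖p.1‖ ^ 2 + ‖g‖ ^ 2) ≤ K * (16 * K' + 16 * K' / δ ^ 2) :=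
      mul_le_mul_of_nonneg_left (by linarith) hK0
    linarith
  have hge : ‖g‖ ^ 2 ≤ (δ * ‖p.1‖) ^ 2 := by
    rw [div_lt_iff₀ (by positivity)] at hlow2
    rw [mul_pow]
    linarith
  refine ⟨p, hp, fun h0 => ?_, ?_, fun j hj => hp0 j ?_ ?_ ?_⟩
  · rw [h0, norm_zero] at hlow2
    have : 0 ≤ 16 * K' / δ ^ 2 := by positivity
    norm_num at hlow2
    linarith
  · exact (sq_le_sq₀ (norm_nonneg _) (by positivity)).1 hge
  · simp only [hy, hχ]
    rw [if_neg (by omega), zero_mul]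
  · simp only [hy, hχ]
    rw [if_neg (by omega), zero_mul]
  · refine hR0 j ?_
    simp only [Finset.mem_insert, Finset.mem_singleton, not_or]
    omega

/-- Coercivity of the free discrete operator off its spectrum. -/
theorem tsum_norm_sq_le {x : ℝ} (hx : 1 < |x|) : ∃ K : ℝ, 0 ≤ K ∧ ∀ y : ℤ → ℂ,
    (Summable fun j => ‖y j‖ ^ 2) → (Summable fun j => ‖y (j + 1) + y (j - 1) - (2 * x : ℝ) * y j‖ ^ 2) →
    ∑' j, ‖y j‖ ^ 2 ≤ K * ∑' j, ‖y (j + 1) + y (j - 1) - (2 * x : ℝ) * y j‖ ^ 2 := by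
  have hx2 : 1 < x ^ 2 := by rw [← sq_abs]; nlinarith
  set η := (x ^ 2 - 1) / 2 with hη
  have hη0 : 0 < η := by rw [hη]; linarith
  set c := 1 + 1 / η with hc
  have hc0 : 0 ≤ c := by positivity
  refine ⟨c / (4 * η), by positivity, fun y hy hR => ?_⟩
  set R : ℤ → ℂ := fun j => y (j + 1) + y (j - 1) - (2 * x : ℝ) * y j with hRdef
  have h1 : HasSum (fun j => ‖y j‖ ^ 2) (∑' j, ‖y j‖ ^ 2) := hy.hasSum
  have h2 : HasSum (fun j => ‖y (j + 1)‖ ^ 2) (∑' j, ‖y j‖ ^ 2) :=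
    (Equiv.addRight (1 : ℤ)).hasSum_iff (f := fun j => ‖y j‖ ^ 2) |>.2 h1
  have h3 : HasSum (fun j => ‖y (j - 1)‖ ^ 2) (∑' j, ‖y j‖ ^ 2) :=
    (Equiv.subRight (1 : ℤ)).hasSum_iff (f := fun j => ‖y j‖ ^ 2) |>.2 h1
  have h4 := hasSum_le (fun j => ?_) (h1.mul_left (4 * x ^ 2))
    (((h2.add h3).mul_left (2 * (1 + η))).add (hR.hasSum.mul_left c))
  · have h5 : 4 * η * ∑' j, ‖y j‖ ^ 2 ≤ c * ∑' j, ‖R j‖ ^ 2 := by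
      have : x ^ 2 = 1 + 2 * η := by rw [hη]; ring
      rw [this] at h4
      linarith
    rw [div_mul_eq_mul_div, le_div_iff₀ (by positivity)]
    linarith
  · have e1 : ((2 * x : ℝ) : ℂ) * y j = (y (j + 1) + y (j - 1)) - R j := by
      simp only [hRdef]
      ring
    have e2 : 2 * |x| * ‖y j‖ ≤ ‖y (j + 1)‖ + ‖y (j - 1)‖ + ‖R j‖ := by
      have := congrArg norm e1
      rw [norm_mul, Complex.norm_real, Real.norm_eq_abs, abs_mul, abs_two] at this
      rw [this]
      exact (norm_sub_le _ _).trans (add_le_add (norm_add_le _ _) le_rfl)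
    have e3 : (2 * |x| * ‖y j‖) ^ 2 ≤ (‖y (j + 1)‖ + ‖y (j - 1)‖ + ‖R j‖) ^ 2 := by gcongr
    have e4 : ∀ A B : ℝ, (A + B) ^ 2 ≤ (1 + η) * A ^ 2 + c * B ^ 2 := by
      intro A B
      have : (1 + η) * A ^ 2 + c * B ^ 2 - (A + B) ^ 2 = (η * A - B) ^ 2 / η := by
        rw [hc]
        field_simp
        ring
      have h0 : 0 ≤ (η * A - B) ^ 2 / η := by positivity
      linarith
    have e5 := e4 (‖y (j + 1)‖ + ‖y (j - 1)‖) ‖R j‖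
    have e6 : (‖y (j + 1)‖ + ‖y (j - 1)‖) ^ 2 ≤ 2 * (‖y (j + 1)‖ ^ 2 + ‖y (j - 1)‖ ^ 2) := by
      nlinarith [sq_nonneg (‖y (j + 1)‖ - ‖y (j - 1)‖)]
    have e7 := mul_le_mul_of_nonneg_left e6 (show 0 ≤ 1 + η by linarith)
    rw [mul_pow, mul_pow, sq_abs] at e3
    linarith

theorem discriminant_of_edgeSin_eq_zero {α E : ℝ} (hS : edgeSin E = 0) :
    |discriminant α E| = 1 := by
  have h := edgeCos_sq_add E
  rw [hS] at h
  rw [discriminant, hS, mul_zero, zero_div, add_zero]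
  have h1 : |edgeCos E| ^ 2 = 1 := by rw [sq_abs]; linarith
  have h2 : 0 ≤ |edgeCos E| := abs_nonneg _
  nlinarith

theorem edgeSin_ne_zero_of_gap {α E : ℝ} (hE : 1 < |discriminant α E|) : edgeSin E ≠ 0 :=
  fun h => hE.ne' (discriminant_of_edgeSin_eq_zero h)

theorem summable_vertexValue {a : ℤ → ℝ} {E : ℝ} (hS : edgeSin E ≠ 0)
    {p : StateSpace × StateSpace} (hp : p ∈ hamiltonianGraph 0 a) :
    Summable fun j => ‖vertexValue E p j‖ ^ 2 := by
  obtain ⟨K, hK0, hK⟩ := exists_vertexValue_bounds hS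
  exact Summable.of_nonneg_of_le (fun _ => sq_nonneg _) (fun j => (hK a p hp j).2.2)
    (((hasSum_edgeSq _).summable.add (hasSum_edgeSq _).summable).mul_left K)

theorem not_mem_essentialSpectrum_of_gap {a : ℤ → ℝ} {α E : ℝ} {m : ℕ}
    (hα : ∀ j, ¬ (1 ≤ j ∧ j ≤ (m : ℤ)) → a j = α) (hE : 1 < |discriminant α E|) :
    E ∉ essentialSpectrum (hamiltonian 0 a) := by
  have hS := edgeSin_ne_zero_of_gap hE
  obtain ⟨K, hK0, hK⟩ := exists_vertexValue_bounds hS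
  obtain ⟨K', hK'0, hK'⟩ := tsum_norm_sq_le hE
  rw [mem_essentialSpectrum_iff]
  rintro ⟨p, hp, hp1, hpw, hpE⟩
  set g : ℕ → StateSpace := fun n => (p n).2 - (E : ℂ) • (p n).1 with hg
  set c : ℤ → ℝ := fun j => (a j - α) * edgeSin E / 2 with hc
  have hg2 : Tendsto (fun n => ‖g n‖ ^ 2) atTop (𝓝 0) := by
    have := (hpE.norm).pow 2
    simpa using this
  have hval : ∀ j, Tendsto (fun n => ‖vertexValue E (p n) j‖ ^ 2) atTop (𝓝 0) := by
    intro j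
    have h1 : Tendsto (fun n => inner ℂ (edgeTest testFun continuous_testFun j) (g n)) atTop
        (𝓝 0) := by
      have := (tendsto_const_nhds (x := edgeTest testFun continuous_testFun j)).inner
        (𝕜 := ℂ) hpE
      rwa [inner_zero_right] at this
    have h2 := (h1.neg.sub (hpw (edgeTest (fun t => E * testFun t + testFunDerivTwo t)
      (continuous_edgeTestFun E) j))).norm.pow 2
    rw [neg_zero, sub_zero, norm_zero, zero_pow two_ne_zero] at h2
    exact h2
  have hbound : ∀ n, ‖(p n).1‖ ^ 2 ≤ K * (2 * (K' * (4 * K * ‖g n‖ ^ 2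
      + ∑ j ∈ Finset.Icc (1 : ℤ) m, 2 * c j ^ 2 * ‖vertexValue E (p n) j‖ ^ 2)) + ‖g n‖ ^ 2) := by
    intro n
    set y := vertexValue E (p n) with hy
    have hys : Summable fun j => ‖y j‖ ^ 2 := summable_vertexValue hS (hp n)
    have hG := hasSum_edgeSq (g n)
    have hG' : HasSum (fun j => edgeSq (g n) (j - 1)) (‖g n‖ ^ 2) :=
      (Equiv.subRight (1 : ℤ)).hasSum_iff (f := edgeSq (g n)) |>.2 hG
    have hfin : HasSum (fun j => 2 * c j ^ 2 * ‖y j‖ ^ 2)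
        (∑ j ∈ Finset.Icc (1 : ℤ) m, 2 * c j ^ 2 * ‖y j‖ ^ 2) := by
      refine hasSum_sum_of_ne_finset_zero fun j hj => ?_
      simp only [hc]
      rw [hα j (by simpa using hj)]
      ring
    have hle : ∀ j, ‖y (j + 1) + y (j - 1) - (2 * discriminant α E : ℝ) * y j‖ ^ 2
        ≤ 2 * (K * (edgeSq (g n) j + edgeSq (g n) (j - 1))) + 2 * c j ^ 2 * ‖y j‖ ^ 2 := by
      intro j
      have e1 : y (j + 1) + y (j - 1) - (2 * discriminant α E : ℝ) * y j
          = (y (j + 1) + y (j - 1) - (2 * edgeCos E + a j * edgeSin E / 2 : ℝ) * y j)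
            + c j * y j := by
        simp only [hc, discriminant]
        push_cast
        ring
      have e2 := (hK a (p n) (hp n) j).1
      have e3 : ‖y (j + 1) + y (j - 1) - (2 * discriminant α E : ℝ) * y j‖
          ≤ ‖y (j + 1) + y (j - 1) - (2 * edgeCos E + a j * edgeSin E / 2 : ℝ) * y j‖
            + |c j| * ‖y j‖ := by
        rw [e1]
        refine (norm_add_le _ _).trans (le_of_eq ?_)
        rw [norm_mul, Complex.norm_real, Real.norm_eq_abs]
      have e4 : ‖y (j + 1) + y (j - 1) - (2 * discriminant α E : ℝ) * y j‖ ^ 2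
          ≤ (‖y (j + 1) + y (j - 1) - (2 * edgeCos E + a j * edgeSin E / 2 : ℝ) * y j‖
            + |c j| * ‖y j‖) ^ 2 := by gcongr
      have e5 := add_sq_le (a := ‖y (j + 1) + y (j - 1)
        - (2 * edgeCos E + a j * edgeSin E / 2 : ℝ) * y j‖) (b := |c j| * ‖y j‖)
      rw [mul_pow, sq_abs] at e5
      linarith
    have hsum2 := (((hG.add hG').mul_left K).mul_left 2).add hfin
    have hRs : Summable fun j => ‖y (j + 1) + y (j - 1) - (2 * discriminant α E : ℝ) * y j‖ ^ 2 :=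
      Summable.of_nonneg_of_le (fun _ => sq_nonneg _) hle hsum2.summable
    have hRle := hasSum_le hle hRs.hasSum hsum2
    have hN := hK' y hys hRs
    have hy1 : HasSum (fun j => ‖y (j + 1)‖ ^ 2) (∑' j, ‖y j‖ ^ 2) :=
      (Equiv.addRight (1 : ℤ)).hasSum_iff (f := fun j => ‖y j‖ ^ 2) |>.2 hys.hasSum
    have hF := hasSum_le (fun j => (hK a (p n) (hp n) j).2.1) (hasSum_edgeSq (p n).1)
      (((hys.hasSum.add hy1).add hG).mul_left K)
    refine hF.trans (mul_le_mul_of_nonneg_left ?_ hK0)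
    have hRle' := mul_le_mul_of_nonneg_left hRle hK'0
    linarith
  have hlim : Tendsto (fun n => K * (2 * (K' * (4 * K * ‖g n‖ ^ 2
      + ∑ j ∈ Finset.Icc (1 : ℤ) m, 2 * c j ^ 2 * ‖vertexValue E (p n) j‖ ^ 2)) + ‖g n‖ ^ 2))
      atTop (𝓝 (K * (2 * (K' * (4 * K * 0
      + ∑ j ∈ Finset.Icc (1 : ℤ) m, 2 * c j ^ 2 * 0)) + 0))) := by
    refine ((((hg2.const_mul (4 * K)).add (tendsto_finsetSum _ fun j _ =>
      (hval j).const_mul _)).const_mul K').const_mul 2 |>.add hg2).const_mul K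
  simp only [mul_zero, Finset.sum_const_zero, add_zero] at hlim
  have h1 : (1 : ℝ) ≤ 0 := ge_of_tendsto' hlim fun n => by
    have := hbound n
    rwa [hp1 n, one_pow] at this
  linarith

theorem essentialSpectrum_eq {a : ℤ → ℝ} {α : ℝ} {m : ℕ}
    (hα : ∀ j, ¬ (1 ≤ j ∧ j ≤ (m : ℤ)) → a j = α) :
    essentialSpectrum (hamiltonian 0 a) = {E | |discriminant α E| ≤ 1} := by
  ext E
  constructor
  · intro hE
    by_contra hcon
    exact not_mem_essentialSpectrum_of_gap hα (not_le.1 hcon) hE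
  · intro hE
    exact mem_essentialSpectrum_of_band (m := m) (fun j hj => hα j (by omega)) hE

/-! ### Eigenvalues and difference equations -/

/-- The difference equation satisfied by the vertex values of real eigenfunctions. -/
def IsVertexSolution (E : ℝ) (a y : ℤ → ℝ) : Prop :=
  ∀ j, y (j + 1) + y (j - 1) = (2 * edgeCos E + a j * edgeSin E / 2) * y j

theorem edgeSq_zero (j : ℤ) : edgeSq 0 j = 0 := by
  have h := hasSum_edgeSq 0
  rw [norm_zero, zero_pow two_ne_zero] at h
  exact congrFun ((hasSum_zero_iff_of_nonneg fun j => edgeSq_nonneg 0 j).1 h) j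

theorem vertexValue_eigenspace {a : ℤ → ℝ} {E : ℝ} (hS : edgeSin E ≠ 0) {f : StateSpace}
    (hf : f ∈ eigenspace (hamiltonian 0 a) E) :
    (Summable fun j => ‖vertexValue E (f, (E : ℂ) • f) j‖ ^ 2) ∧
    (∀ j, vertexValue E (f, (E : ℂ) • f) (j + 1) + vertexValue E (f, (E : ℂ) • f) (j - 1)
      = (2 * edgeCos E + a j * edgeSin E / 2 : ℝ) * vertexValue E (f, (E : ℂ) • f) j) ∧
    ((∀ j, vertexValue E (f, (E : ℂ) • f) j = 0) → f = 0) := by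
  rw [mem_eigenspace_iff] at hf
  obtain ⟨K, hK0, hK⟩ := exists_vertexValue_bounds hS
  refine ⟨summable_vertexValue hS hf, fun j => ?_, fun h0 => ?_⟩
  · have h := (hK a _ hf j).1
    rw [sub_self, edgeSq_zero, edgeSq_zero, add_zero, mul_zero] at h
    exact sub_eq_zero.1 (norm_eq_zero.1 (pow_eq_zero_iff two_ne_zero |>.1
      (le_antisymm h (sq_nonneg _))))
  · have h1 : ∀ j, edgeSq f j = 0 := fun j => by
      have h := (hK a _ hf j).2.1
      rw [sub_self, edgeSq_zero, h0, h0, norm_zero] at h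
      exact le_antisymm (by simpa using h) (edgeSq_nonneg _ _)
    have h2 := hasSum_edgeSq f
    rw [funext h1] at h2
    exact norm_eq_zero.1 (pow_eq_zero_iff two_ne_zero |>.1 (h2.unique hasSum_zero))

theorem vertexValue_re_im {a : ℤ → ℝ} {E : ℝ} (hS : edgeSin E ≠ 0) {f : StateSpace}
    (hf : f ∈ eigenspace (hamiltonian 0 a) E) :
    (SqSummable fun j => (vertexValue E (f, (E : ℂ) • f) j).re) ∧
    (IsVertexSolution E a fun j => (vertexValue E (f, (E : ℂ) • f) j).re) ∧
    (SqSummable fun j => (vertexValue E (f, (E : ℂ) • f) j).im) ∧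
    (IsVertexSolution E a fun j => (vertexValue E (f, (E : ℂ) • f) j).im) := by
  obtain ⟨h1, h2, -⟩ := vertexValue_eigenspace hS hf
  refine ⟨?_, fun j => ?_, ?_, fun j => ?_⟩
  · refine Summable.of_nonneg_of_le (fun _ => sq_nonneg _) (fun j => ?_) h1
    rw [Complex.sq_norm, Complex.normSq_apply]
    nlinarith [mul_self_nonneg (vertexValue E (f, (E : ℂ) • f) j).im]
  · have := congrArg Complex.re (h2 j)
    rwa [Complex.add_re, Complex.re_ofReal_mul] at this
  · refine Summable.of_nonneg_of_le (fun _ => sq_nonneg _) (fun j => ?_) h1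
    rw [Complex.sq_norm, Complex.normSq_apply]
    nlinarith [mul_self_nonneg (vertexValue E (f, (E : ℂ) • f) j).re]
  · have := congrArg Complex.im (h2 j)
    rwa [Complex.add_im, Complex.im_ofReal_mul] at this

theorem exists_solution_of_mem_pointSpectrum {a : ℤ → ℝ} {E : ℝ} (hS : edgeSin E ≠ 0)
    (hE : E ∈ pointSpectrum (hamiltonian 0 a)) :
    ∃ y : ℤ → ℝ, SqSummable y ∧ IsVertexSolution E a y ∧ ∃ i, y i ≠ 0 := by
  obtain ⟨f, hf, hf0⟩ := Submodule.exists_mem_ne_zero_of_ne_bot hE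
  obtain ⟨h1, h2, h3, h4⟩ := vertexValue_re_im hS hf
  by_contra! hcon
  refine hf0 ((vertexValue_eigenspace hS hf).2.2 fun j => Complex.ext ?_ ?_)
  · exact hcon _ h1 h2 j
  · exact hcon _ h3 h4 j

theorem mem_pointSpectrum_of_solution {a y : ℤ → ℝ} {E : ℝ} (hS : edgeSin E ≠ 0)
    (hy : SqSummable y) (hys : IsVertexSolution E a y) {i : ℤ} (hi : y i ≠ 0) :
    E ∈ pointSpectrum (hamiltonian 0 a) := by
  obtain ⟨K, hK0, hK⟩ := exists_mem_graph_vertexValue hS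
  obtain ⟨p, hp, hpv, hpn, -⟩ := hK a (fun j => (y j : ℂ)) (fun _ => 0) (fun j => by
    rw [← Complex.ofReal_add, hys j]
    push_cast
    ring) (by simpa [SqSummable] using hy) (by simp)
  have h1 : p.2 = (E : ℂ) • p.1 := by
    simp only [norm_zero, ne_eq, OfNat.ofNat_ne_zero, not_false_eq_true, zero_pow, tsum_zero,
      mul_zero] at hpn
    exact sub_eq_zero.1 (norm_eq_zero.1 (pow_eq_zero_iff two_ne_zero |>.1
      (le_antisymm hpn (sq_nonneg _))))
  have hp' : p.1 ∈ eigenspace (hamiltonian 0 a) E := by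
    rw [mem_eigenspace_iff, ← h1]
    exact hp
  refine (Submodule.ne_bot_iff _).2 ⟨p.1, hp', fun h0 => hi ?_⟩
  have h2 := hpv i
  rw [vertexValue, h1, h0] at h2
  simpa using h2.symm

theorem mem_simpleEigenvalues {a : ℤ → ℝ} {E : ℝ} (hS : edgeSin E ≠ 0)
    (hE : E ∈ pointSpectrum (hamiltonian 0 a))
    (h : ∀ y, SqSummable y → IsVertexSolution E a y → y 1 = 0 → ∀ j, y j = 0) :
    E ∈ simpleEigenvalues (hamiltonian 0 a) := by
  set V := eigenspace (hamiltonian 0 a) E with hV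
  have hval : ∀ (f : StateSpace) (j : ℤ), vertexValue E (f, (E : ℂ) • f) j
      = -inner ℂ (edgeTest (fun t => E * testFun t + testFunDerivTwo t)
        (continuous_edgeTestFun E) j) f := by
    intro f j
    rw [vertexValue, sub_self, inner_zero_right, neg_zero, zero_sub]
  let L : V →ₗ[ℂ] ℂ :=
    { toFun := fun f => vertexValue E (f.1, (E : ℂ) • f.1) 1
      map_add' := fun f g => by
        rw [hval, hval, hval, Submodule.coe_add, inner_add_right]
        ring
      map_smul' := fun c f => by
        rw [hval, hval, Submodule.coe_smul, inner_smul_right, RingHom.id_apply, smul_eq_mul]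
        ring }
  have hL : Function.Injective L := by
    rw [← LinearMap.ker_eq_bot, LinearMap.ker_eq_bot']
    intro f hf
    have hf1 : vertexValue E (f.1, (E : ℂ) • f.1) 1 = 0 := hf
    obtain ⟨h1, h2, h3, h4⟩ := vertexValue_re_im hS f.2
    refine Subtype.ext ((vertexValue_eigenspace hS f.2).2.2 fun j => Complex.ext ?_ ?_)
    · exact h _ h1 h2 (congrArg Complex.re hf1) j
    · exact h _ h3 h4 (congrArg Complex.im hf1) j
  have hfin : Module.Finite ℂ V := Module.Finite.of_injective L hL
  have hle := LinearMap.finrank_le_finrank_of_injective hL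
  rw [Module.finrank_self] at hle
  have : Nontrivial V := Submodule.nontrivial_iff_ne_bot.2 hE
  exact le_antisymm hle (Module.finrank_pos (R := ℂ) (M := V))

theorem IsVertexSolution.eq_zero {a y : ℤ → ℝ} {E : ℝ} (h : IsVertexSolution E a y) {k : ℤ}
    (h0 : y k = 0) (h1 : y (k + 1) = 0) (j : ℤ) : y j = 0 := by
  suffices y j = 0 ∧ y (j + 1) = 0 from this.1
  refine Int.inductionOn' (motive := fun j => y j = 0 ∧ y (j + 1) = 0) j k ⟨h0, h1⟩
    (fun i _ ih => ?_) (fun i _ ih => ?_)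
  · have := h (i + 1)
    rw [add_sub_cancel_right, ih.1, ih.2] at this
    exact ⟨ih.2, by linarith⟩
  · have := h i
    rw [ih.1, ih.2] at this
    refine ⟨by linarith, ?_⟩
    rw [sub_add_cancel]
    exact ih.1

/-- There are no square summable solutions in a band. -/
theorem IsVertexSolution.eq_zero_of_band {a y : ℤ → ℝ} {α E : ℝ} {m : ℕ}
    (h : IsVertexSolution E a y) (hα : ∀ j, ¬ (1 ≤ j ∧ j ≤ (m : ℤ)) → a j = α)
    (hE : |discriminant α E| ≤ 1) (hy : SqSummable y) : ∀ j, y j = 0 := by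
  set x := discriminant α E with hx
  have hrec : ∀ j, (m : ℤ) < j → y (j + 1) = 2 * x * y j - y (j - 1) := by
    intro j hj
    have := h j
    rw [hα j (by omega)] at this
    rw [hx, discriminant]
    linarith
  set I : ℕ → ℝ := fun n => y (n + m + 1) ^ 2 + y (n + m) ^ 2 - 2 * x * (y (n + m) * y (n + m + 1))
    with hI
  have hconst : ∀ n, I n = I 0 := by
    intro n
    induction n with
    | zero => rfl
    | succ n ih =>
      rw [← ih]
      simp only [hI]
      have h1 := hrec (n + m + 1) (by omega)
      rw [add_sub_cancel_right] at h1
      have e : ((n + 1 : ℕ) : ℤ) + m = n + m + 1 := by push_cast; ring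
      rw [e, h1]
      ring
  have hx1 : x ^ 2 ≤ 1 := by
    rw [← sq_abs]
    nlinarith [abs_nonneg x]
  have ht0 : Tendsto (fun n : ℕ => y (n + m) ^ 2) atTop (𝓝 0) := (hy.shift m).tendsto
  have ht1 : Tendsto (fun n : ℕ => y (n + m + 1) ^ 2) atTop (𝓝 0) := by
    simpa only [add_assoc] using (hy.shift (m + 1)).tendsto
  have hI0 : I 0 = 0 := by
    have hle : ∀ n, |I n| ≤ 2 * (y (n + m + 1) ^ 2 + y (n + m) ^ 2) := by
      intro n
      have hx2 := abs_le.1 hE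
      simp only [hI]
      rw [abs_le]
      constructor <;>
      nlinarith [sq_nonneg (y (n + m + 1) + x * y (n + m)), sq_nonneg (y (n + m + 1) - x * y (n + m)),
        mul_nonneg (sub_nonneg.2 hx1) (sq_nonneg (y (n + m)))]
    have hlim : Tendsto I atTop (𝓝 0) := squeeze_zero_norm hle (by
      simpa using (ht1.add ht0).const_mul 2)
    exact tendsto_nhds_unique (tendsto_const_nhds.congr fun n => (hconst n).symm) hlim
  have hI1 : ∀ n : ℕ, (y (n + m + 1) - x * y (n + m)) ^ 2 + (1 - x ^ 2) * y (n + m) ^ 2 = 0 := by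
    intro n
    rw [← hI0, ← hconst n]
    simp only [hI]
    ring
  have hstep : ∀ n : ℕ, (1 - x ^ 2) * y (n + m) ^ 2 = 0 ∧ y (n + m + 1) = x * y (n + m) := by
    intro n
    have h1 := mul_nonneg (sub_nonneg.2 hx1) (sq_nonneg (y (n + m)))
    have h2 := sq_nonneg (y (n + m + 1) - x * y (n + m))
    refine ⟨by linarith [hI1 n], sub_eq_zero.1 (pow_eq_zero_iff two_ne_zero |>.1 ?_)⟩
    linarith [hI1 n]
  have hsq : ∀ n : ℕ, y (n + m) ^ 2 = y m ^ 2 := by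
    intro n
    induction n with
    | zero => simp
    | succ n ih =>
      have e : ((n + 1 : ℕ) : ℤ) + m = n + m + 1 := by push_cast; ring
      rw [e, (hstep n).2, ← ih]
      linarith [(hstep n).1]
  have hm0 : y m ^ 2 = 0 := tendsto_nhds_unique
    (tendsto_const_nhds.congr fun n => (hsq n).symm) ht0
  have hm0' : y m = 0 := pow_eq_zero_iff two_ne_zero |>.1 hm0
  refine h.eq_zero hm0' ?_
  have := (hstep 0).2
  simpa [hm0'] using this

theorem mem_ringEnergies_of_band {a : ℤ → ℝ} {α E : ℝ} {m : ℕ}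
    (hα : ∀ j, ¬ (1 ≤ j ∧ j ≤ (m : ℤ)) → a j = α) (hE : |discriminant α E| ≤ 1)
    (h : E ∈ pointSpectrum (hamiltonian 0 a)) : E ∈ ringEnergies := by
  by_contra hS
  rw [← edgeSin_eq_zero_iff] at hS
  obtain ⟨y, hy, hys, i, hi⟩ := exists_solution_of_mem_pointSpectrum hS h
  exact hi (hys.eq_zero_of_band hα hE hy i)

/-! ### The coefficients of the energy form inside a gap -/

/-- The smaller coefficient of the energy form at an energy in a gap. -/
def gapMin (α E : ℝ) : ℝ := (|discriminant α E| - 1) / |edgeSin E|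

/-- The larger coefficient of the energy form at an energy in a gap. -/
def gapMax (α E : ℝ) : ℝ := (|discriminant α E| + 1) / |edgeSin E|

theorem gapMax_sub_gapMin (α E : ℝ) : gapMax α E - gapMin α E = 2 / |edgeSin E| := by
  rw [gapMax, gapMin]
  ring

theorem gapMax_add_gapMin (α E : ℝ) :
    gapMax α E + gapMin α E = 2 * |discriminant α E| / |edgeSin E| := by
  rw [gapMax, gapMin]
  ring

theorem gapMin_pos {α E : ℝ} (hE : 1 < |discriminant α E|) : 0 < gapMin α E :=
  div_pos (sub_pos.2 hE) (abs_pos.2 (edgeSin_ne_zero_of_gap hE))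

theorem gapMin_lt_gapMax {α E : ℝ} (hS : edgeSin E ≠ 0) : gapMin α E < gapMax α E := by
  have h := gapMax_sub_gapMin α E
  have := div_pos two_pos (abs_pos.2 hS)
  linarith

theorem add_div_sub_gap {α E : ℝ} (hS : edgeSin E ≠ 0) :
    (gapMin α E + gapMax α E) / (gapMax α E - gapMin α E) = |discriminant α E| := by
  have := abs_ne_zero.2 hS
  rw [add_comm, gapMax_sub_gapMin, gapMax_add_gapMin]
  field_simp

theorem pos_or_neg_of_ordConnected {f : ℝ → ℝ} {s : Set ℝ} (hs : s.OrdConnected)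
    (hf : ContinuousOn f s) (h0 : ∀ x ∈ s, f x ≠ 0) :
    (∀ x ∈ s, 0 < f x) ∨ ∀ x ∈ s, f x < 0 := by
  by_contra! hcon
  obtain ⟨⟨x, hx, hfx⟩, y, hy, hfy⟩ := hcon
  have hsub := hs.uIcc_subset hx hy
  have h := intermediate_value_uIcc (hf.mono hsub)
  obtain ⟨t, ht, ht0⟩ := h (show (0 : ℝ) ∈ Set.uIcc (f x) (f y) by
    rw [Set.uIcc_of_le (hfx.trans hfy)]
    exact ⟨hfx, hfy⟩)
  exact h0 t (hsub ht) ht0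

/-- The coefficients are monotone in a gap, in a direction `τ` that is the sign of the product of
the discriminant and `edgeSin`. -/
theorem exists_sign_of_gap {α : ℝ} {s : Set ℝ} (hs : s.OrdConnected)
    (hgap : ∀ E ∈ s, 1 < |discriminant α E|) :
    ∃ τ : ℝ, (τ = 1 ∨ τ = -1) ∧ (∀ E ∈ s, 0 < τ * (discriminant α E * edgeSin E)) ∧
      StrictAntiOn (fun E => τ * gapMin α E) s ∧ StrictAntiOn (fun E => τ * gapMax α E) s := by
  have hS : ∀ E ∈ s, edgeSin E ≠ 0 := fun E hE => edgeSin_ne_zero_of_gap (hgap E hE)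
  have hξ : ∀ E ∈ s, discriminant α E ≠ 0 := fun E hE h => by
    have := hgap E hE
    rw [h, abs_zero] at this
    linarith
  have h1 := strictAntiOn_neg_tan hs hS
  have h2 := strictAntiOn_cot hs hS
  have key : ∀ {f g : ℝ → ℝ} {c : ℝ}, StrictAntiOn f s → (∀ E ∈ s, g E = f E + c) →
      StrictAntiOn g s := by
    intro f g c hf hg x hx y hy hxy
    rw [hg x hx, hg y hy]
    linarith [hf hx hy hxy]
  rcases pos_or_neg_of_ordConnected hs (continuous_discriminant α).continuousOn hξ with hp | hp <;>
  rcases pos_or_neg_of_ordConnected hs continuous_edgeSin.continuousOn hS with hq | hq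
  · refine ⟨1, Or.inl rfl, fun E hE => ?_, key (c := α / 4) h1 fun E hE => ?_,
      key (c := α / 4) h2 fun E hE => ?_⟩
    · have := mul_pos (hp E hE) (hq E hE)
      linarith
    all_goals
      have := hS E hE
      simp only [gapMin, gapMax]
      rw [abs_of_pos (hp E hE), abs_of_pos (hq E hE), discriminant]
      field_simp
      ring
  · refine ⟨-1, Or.inr rfl, fun E hE => ?_, key (c := α / 4) h1 fun E hE => ?_,
      key (c := α / 4) h2 fun E hE => ?_⟩
    · have := mul_neg_of_pos_of_neg (hp E hE) (hq E hE)
      linarith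
    all_goals
      have := hS E hE
      simp only [gapMin, gapMax]
      rw [abs_of_pos (hp E hE), abs_of_neg (hq E hE), discriminant]
      field_simp
      ring
  · refine ⟨-1, Or.inr rfl, fun E hE => ?_, key (c := α / 4) h2 fun E hE => ?_,
      key (c := α / 4) h1 fun E hE => ?_⟩
    · have := mul_neg_of_neg_of_pos (hp E hE) (hq E hE)
      linarith
    all_goals
      have := hS E hE
      simp only [gapMin, gapMax]
      rw [abs_of_neg (hp E hE), abs_of_pos (hq E hE), discriminant]
      field_simp
      ring
  · refine ⟨1, Or.inl rfl, fun E hE => ?_, key (c := α / 4) h2 fun E hE => ?_,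
      key (c := α / 4) h1 fun E hE => ?_⟩
    · have := mul_pos_of_neg_of_neg (hp E hE) (hq E hE)
      linarith
    all_goals
      have := hS E hE
      simp only [gapMin, gapMax]
      rw [abs_of_neg (hp E hE), abs_of_neg (hq E hE), discriminant]
      field_simp
      ring

theorem exists_far_below (α : ℝ) : ∃ M ≤ (0 : ℝ), ∀ E ≤ M,
    0 < edgeSin E ∧ 1 < discriminant α E ∧ 1 + |α| ≤ gapMin α E := by
  refine ⟨-(2 + 2 * |α|) ^ 2, by nlinarith [sq_nonneg (2 + 2 * |α|)], fun E hE => ?_⟩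
  have hα := abs_nonneg α
  have hE0 : E ≤ 0 := by nlinarith [sq_nonneg (2 + 2 * |α|)]
  have hS := pi_le_edgeSin hE0
  have hpi := Real.pi_gt_three
  have hC := one_le_edgeCos hE0
  have hCS : (2 + 2 * |α|) * edgeSin E ≤ edgeCos E := by
    refine abs_le_of_sq_le_sq' ?_ (by linarith) |>.2
    have h := edgeCos_sq_add E
    nlinarith [sq_nonneg (edgeSin E)]
  have hξ : edgeSin E * (1 + |α|) + 1 ≤ discriminant α E := by
    rw [discriminant]
    have : -(|α| * edgeSin E) ≤ α * edgeSin E := by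
      rw [← neg_mul]
      exact mul_le_mul_of_nonneg_right (neg_abs_le α) (by linarith)
    nlinarith
  have hξ1 : 1 < discriminant α E := by nlinarith
  refine ⟨by linarith, hξ1, ?_⟩
  rw [gapMin, abs_of_pos (by linarith : 0 < discriminant α E),
    abs_of_pos (by linarith : 0 < edgeSin E), le_div_iff₀ (by linarith)]
  linarith

/-- The larger coefficient is bounded below, uniformly in all gaps and their end points. -/
theorem exists_le_gapMax (α : ℝ) : ∃ Q₀ : ℝ, 0 < Q₀ ∧ ∀ E, 1 ≤ |discriminant α E| →
    edgeSin E ≠ 0 → Q₀ ≤ gapMax α E := by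
  obtain ⟨M, hM, hfar⟩ := exists_far_below α
  obtain ⟨L, hL⟩ := isCompact_Icc.exists_bound_of_continuousOn (s := Set.Icc M 0)
    continuous_edgeSin.continuousOn
  have hpi := Real.pi_pos
  set L' := max L Real.pi with hL'
  have hL'0 : 0 < L' := lt_max_of_lt_right hpi
  refine ⟨min 1 (2 / L'), by positivity, fun E hE hS => ?_⟩
  rcases le_total E M with h | h
  · have h1 := (hfar E h).2.2
    have h2 := gapMin_lt_gapMax (α := α) hS
    exact (min_le_left _ _).trans (by linarith [abs_nonneg α])
  · have h1 : |edgeSin E| ≤ L' := by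
      rcases le_or_gt E 0 with h0 | h0
      · exact (hL E ⟨h, h0⟩).trans (le_max_left _ _)
      · exact (abs_edgeSin_lt h0).le.trans (le_max_right _ _)
    refine (min_le_right _ _).trans ?_
    rw [gapMax]
    exact div_le_div₀ (by linarith) (by linarith) (abs_pos.2 hS) h1

theorem abs_gapMin {α E : ℝ} (hS : edgeSin E ≠ 0) : |gapMin α E|
    = |α * edgeCos E / 2 + (α ^ 2 / 16 - E) * edgeSin E| / (|discriminant α E| + 1) := by
  have h1 : (|discriminant α E| - 1) * (|discriminant α E| + 1)
      = (α * edgeCos E / 2 + (α ^ 2 / 16 - E) * edgeSin E) * edgeSin E := by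
    have h := edgeCos_sq_add E
    have e : (|discriminant α E| - 1) * (|discriminant α E| + 1)
        = |discriminant α E| ^ 2 - 1 := by ring
    rw [e, sq_abs, discriminant]
    linear_combination h
  have h2 := congrArg abs h1
  have h3 : 0 < |discriminant α E| + 1 := by positivity
  rw [abs_mul, abs_mul, abs_of_pos h3] at h2
  rw [gapMin, abs_div, abs_abs, div_eq_div_iff (abs_pos.2 hS).ne' h3.ne', h2]

/-- Near an end point of a gap where `edgeSin` vanishes, the smaller coefficient is not small. -/
theorem eventually_lt_gapMin {α e : ℝ} (hα : α ≠ 0) (he : edgeSin e = 0) :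
    ∀ᶠ E in 𝓝 e, 1 < |discriminant α E| → |α| / 8 < gapMin α E := by
  have hC : |edgeCos e| = 1 := by
    have := discriminant_of_edgeSin_eq_zero (α := α) he
    rwa [discriminant, he, mul_zero, zero_div, add_zero] at this
  have hcont : Continuous fun E =>
      |α * edgeCos E / 2 + (α ^ 2 / 16 - E) * edgeSin E| / (|discriminant α E| + 1) := by
    have h1 := continuous_edgeCos
    have h2 := continuous_edgeSin
    have h3 := continuous_discriminant α
    exact Continuous.div₀ (by fun_prop) (by fun_prop) fun E => by positivity
  have hval : |α| / 8
      < |α * edgeCos e / 2 + (α ^ 2 / 16 - e) * edgeSin e| / (|discriminant α e| + 1) := by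
    rw [discriminant_of_edgeSin_eq_zero he, he, mul_zero, add_zero, abs_div, abs_mul, hC,
      abs_two]
    have := abs_pos.2 hα
    linarith
  filter_upwards [hcont.continuousAt.eventually (lt_mem_nhds hval)] with E hE hgap
  rwa [← abs_gapMin (edgeSin_ne_zero_of_gap hgap), abs_of_pos (gapMin_pos hgap)] at hE

theorem mem_closure_uIoo_right {a b : ℝ} (hab : a ≠ b) : b ∈ closure (Set.uIoo a b) := by
  rw [closure_uIoo hab]
  exact Set.right_mem_uIcc

theorem edgeSin_ne_zero_of_gapMax_le {α E₀ e c : ℝ} (hne : E₀ ≠ e)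
    (hgap : ∀ E ∈ Set.uIoo E₀ e, 1 < |discriminant α E|)
    (hle : ∀ E ∈ Set.uIoo E₀ e, gapMax α E ≤ c) : edgeSin e ≠ 0 := by
  intro he
  have hcont : Continuous fun E => c * |edgeSin E| := by
    have := continuous_edgeSin
    fun_prop
  have hcl : IsClosed {E : ℝ | (2 : ℝ) ≤ c * |edgeSin E|} := isClosed_le continuous_const hcont
  have h : Set.uIoo E₀ e ⊆ {E : ℝ | (2 : ℝ) ≤ c * |edgeSin E|} := by
    intro E hE
    have h1 := hle E hE
    have h2 := hgap E hE
    rw [gapMax, div_le_iff₀ (abs_pos.2 (edgeSin_ne_zero_of_gap h2))] at h1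
    change (2 : ℝ) ≤ c * |edgeSin E|
    linarith
  have h2 := closure_minimal h hcl (mem_closure_uIoo_right hne)
  change (2 : ℝ) ≤ c * |edgeSin e| at h2
  rw [he, abs_zero, mul_zero] at h2
  linarith

theorem edgeSin_eq_zero_of_le_gapMin {α E₀ e c : ℝ} (hne : E₀ ≠ e) (hc : 0 < c)
    (hgap : ∀ E ∈ Set.uIoo E₀ e, 1 < |discriminant α E|)
    (he : |discriminant α e| ≤ 1)
    (hle : ∀ E ∈ Set.uIoo E₀ e, c ≤ gapMin α E) : edgeSin e = 0 := by
  have hcl : IsClosed {E : ℝ | c * |edgeSin E| ≤ |discriminant α E| - 1} := by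
    have h1 := continuous_edgeSin
    have h2 := continuous_discriminant α
    exact isClosed_le (by fun_prop) (by fun_prop)
  have h : Set.uIoo E₀ e ⊆ {E : ℝ | c * |edgeSin E| ≤ |discriminant α E| - 1} := by
    intro E hE
    have h1 := hle E hE
    rwa [gapMin, le_div_iff₀ (abs_pos.2 (edgeSin_ne_zero_of_gap (hgap E hE)))] at h1
  have h2 : c * |edgeSin e| ≤ |discriminant α e| - 1 :=
    closure_minimal h hcl (mem_closure_uIoo_right hne)
  have h3 : |edgeSin e| ≤ 0 := by
    by_contra! h3
    have := mul_pos hc h3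
    linarith
  exact abs_nonpos_iff.1 h3

theorem exists_lt_gapMin_of_edgeSin_eq_zero {α E₀ e : ℝ} (hα : α ≠ 0) (hne : E₀ ≠ e)
    (hgap : ∀ E ∈ Set.uIoo E₀ e, 1 < |discriminant α E|) (he : edgeSin e = 0) :
    ∃ E ∈ Set.uIoo E₀ e, |α| / 8 < gapMin α E := by
  obtain ⟨E, hE, hE'⟩ := mem_closure_iff_nhds.1 (mem_closure_uIoo_right hne) _
    (eventually_lt_gapMin hα he)
  exact ⟨E, hE', hE (hgap E hE')⟩

/-- The first point above `x` where a continuous function drops to the level `1`. -/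
theorem exists_exit_above {f : ℝ → ℝ} (hf : Continuous f) {x y : ℝ} (hxy : x ≤ y) (hx : 1 < f x)
    (hy : f y ≤ 1) : ∃ e, x < e ∧ f e = 1 ∧ ∀ t ∈ Set.Ico x e, 1 < f t := by
  set T : Set ℝ := {t | x ≤ t ∧ f t ≤ 1} with hT
  have hcl : IsClosed T := (isClosed_le continuous_const continuous_id).inter
    (isClosed_le hf continuous_const)
  have hbdd : BddBelow T := ⟨x, fun t ht => ht.1⟩
  obtain ⟨h1, h2⟩ := hcl.csInf_mem ⟨y, hxy, hy⟩ hbdd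
  set e := sInf T with he
  have hgt : ∀ t ∈ Set.Ico x e, 1 < f t := fun t ht => by
    by_contra! h
    exact absurd (csInf_le hbdd (show t ∈ T from ⟨ht.1, h⟩)) (not_le.2 ht.2)
  have hlt : x < e := lt_of_le_of_ne h1 fun h => by
    rw [← h] at h2
    linarith
  refine ⟨e, hlt, le_antisymm h2 ?_, hgt⟩
  have h3 : e ∈ closure (Set.Ico x e) := by
    rw [closure_Ico hlt.ne]
    exact Set.right_mem_Icc.2 hlt.le
  exact closure_minimal (fun t ht => (hgt t ht).le) (isClosed_le continuous_const hf) h3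

theorem exists_exit_below {f : ℝ → ℝ} (hf : Continuous f) {x y : ℝ} (hxy : y ≤ x) (hx : 1 < f x)
    (hy : f y ≤ 1) : ∃ e, e < x ∧ f e = 1 ∧ ∀ t ∈ Set.Ioc e x, 1 < f t := by
  obtain ⟨e, h1, h2, h3⟩ := exists_exit_above (f := fun t => f (-t)) (by fun_prop)
    (neg_le_neg hxy) (by simpa using hx) (by simpa using hy)
  refine ⟨-e, by linarith, h2, fun t ht => ?_⟩
  have := h3 (-t) ⟨by linarith [ht.2], by linarith [ht.1]⟩
  simpa using this

/-! ### The gaps -/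

theorem gap_properties {α : ℝ} {G : Set ℝ} (hG : G ∈ gaps {E | |discriminant α E| ≤ 1}) :
    G.Nonempty ∧ G.OrdConnected ∧ (∀ E ∈ G, 1 < |discriminant α E|) ∧
    ∀ s : Set ℝ, s.OrdConnected → (∀ E ∈ s, 1 < |discriminant α E|) → (s ∩ G).Nonempty →
      s ⊆ G := by
  obtain ⟨E₀, hE₀, rfl⟩ := hG
  refine ⟨⟨E₀, mem_connectedComponentIn hE₀⟩,
    isPreconnected_connectedComponentIn.ordConnected, fun E hE => ?_, fun s hs hsg hne => ?_⟩
  · exact not_le.1 (connectedComponentIn_subset _ _ hE)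
  · obtain ⟨E, hEs, hEG⟩ := hne
    rw [connectedComponentIn_eq hEG]
    exact hs.isPreconnected.subset_connectedComponentIn hEs fun x hx => not_le.2 (hsg x hx)

theorem exists_abs_discriminant_eq_one_above (α E : ℝ) : ∃ e ≥ E, |discriminant α e| = 1 := by
  obtain ⟨k, hk⟩ := exists_nat_ge E
  refine ⟨((k + 1 : ℕ) : ℝ) ^ 2, ?_, discriminant_of_edgeSin_eq_zero
    ((edgeSin_eq_zero_iff _).2 ⟨k + 1, by omega, rfl⟩)⟩
  push_cast
  nlinarith [(Nat.cast_nonneg k : (0 : ℝ) ≤ k)]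

/-- A gap contains a segment from a point where the smaller coefficient is not small to an end point
of the gap where `edgeSin` does not vanish. -/
theorem exists_gap_segment {α : ℝ} (hα : α ≠ 0) {G : Set ℝ}
    (hG : G ∈ gaps {E | |discriminant α E| ≤ 1}) :
    ∃ E₁ ∈ G, ∃ e, |discriminant α e| = 1 ∧ edgeSin e ≠ 0 ∧
      (∀ E ∈ Set.uIcc E₁ e, E ≠ e → E ∈ G) ∧ |α| / 8 < gapMin α E₁ := by
  obtain ⟨⟨E₀, hE₀⟩, hord, hgap, hmax⟩ := gap_properties hG
  obtain ⟨τ, hτ, hsign, hmin, hmaxi⟩ := exists_sign_of_gap hord hgap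
  obtain ⟨M, -, hfar⟩ := exists_far_below α
  have hcont : Continuous fun E => |discriminant α E| := (continuous_discriminant α).abs
  have hout : ∀ {s : Set ℝ}, s.OrdConnected → E₀ ∈ s → (∀ E ∈ s, 1 < |discriminant α E|) →
      s ⊆ G := fun hs hmem hsg => hmax _ hs hsg ⟨E₀, hmem, hE₀⟩
  obtain ⟨k, hk, hk1⟩ := exists_abs_discriminant_eq_one_above α E₀
  obtain ⟨e₂, he₂, he₂1, he₂G⟩ := exists_exit_above hcont hk (hgap E₀ hE₀) hk1.le
  have hup : Set.Ico E₀ e₂ ⊆ G := hout Set.ordConnected_Ico ⟨le_rfl, he₂⟩ he₂G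
  have hupo : Set.uIoo E₀ e₂ ⊆ G := by
    rw [Set.uIoo_of_lt he₂]
    exact Set.Ioo_subset_Ico_self.trans hup
  have hbelow : (∃ e, e < E₀ ∧ |discriminant α e| = 1 ∧ Set.Ioc e E₀ ⊆ G) ∨ Set.Iic E₀ ⊆ G := by
    by_cases hb : ∃ y ≤ E₀, |discriminant α y| ≤ 1
    · obtain ⟨y, hy, hy1⟩ := hb
      obtain ⟨e, he, he1, heG⟩ := exists_exit_below hcont hy (hgap E₀ hE₀) hy1
      exact Or.inl ⟨e, he, he1, hout Set.ordConnected_Ioc ⟨he, le_rfl⟩ heG⟩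
    · push Not at hb
      exact Or.inr (hout Set.ordConnected_Iic Set.self_mem_Iic hb)
  rcases hτ with rfl | rfl
  · simp only [one_mul] at hmin hmaxi
    have hS₂ : edgeSin e₂ ≠ 0 := edgeSin_ne_zero_of_gapMax_le he₂.ne
      (fun E hE => hgap E (hupo hE)) fun E hE => by
        refine hmaxi.antitoneOn hE₀ (hupo hE) ?_
        rw [Set.uIoo_of_lt he₂] at hE
        exact hE.1.le
    have hE₁ : ∃ E₁ ∈ G, E₁ ≤ E₀ ∧ |α| / 8 < gapMin α E₁ := by
      rcases hbelow with ⟨e, he, he1, heG⟩ | hall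
      · have hdo : Set.uIoo E₀ e ⊆ G := by
          rw [Set.uIoo_of_gt he]
          exact Set.Ioo_subset_Ioc_self.trans heG
        have hS : edgeSin e = 0 := edgeSin_eq_zero_of_le_gapMin he.ne'
          (gapMin_pos (hgap E₀ hE₀)) (fun E hE => hgap E (hdo hE)) he1.le fun E hE => by
            refine hmin.antitoneOn (hdo hE) hE₀ ?_
            rw [Set.uIoo_of_gt he] at hE
            exact hE.2.le
        obtain ⟨E₁, hE₁, h⟩ := exists_lt_gapMin_of_edgeSin_eq_zero hα he.ne'
          (fun E hE => hgap E (hdo hE)) hS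
        refine ⟨E₁, hdo hE₁, ?_, h⟩
        rw [Set.uIoo_of_gt he] at hE₁
        exact hE₁.2.le
      · refine ⟨min M E₀, hall (Set.mem_Iic.2 (min_le_right _ _)), min_le_right _ _, ?_⟩
        have := (hfar (min M E₀) (min_le_left _ _)).2.2
        linarith [abs_nonneg α]
    obtain ⟨E₁, hE₁, hle, hlt⟩ := hE₁
    refine ⟨E₁, hE₁, e₂, he₂1, hS₂, fun E hE hne => ?_, hlt⟩
    rw [Set.uIcc_of_le (hle.trans he₂.le)] at hE
    rcases le_total E E₀ with h | h
    · exact hord.out hE₁ hE₀ ⟨hE.1, h⟩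
    · exact hup ⟨h, lt_of_le_of_ne hE.2 hne⟩
  · simp only [neg_one_mul] at hmin hmaxi
    obtain ⟨e, he, he1, heG⟩ : ∃ e, e < E₀ ∧ |discriminant α e| = 1 ∧ Set.Ioc e E₀ ⊆ G := by
      refine hbelow.resolve_right fun hall => ?_
      have h1 := hsign (min M E₀) (hall (Set.mem_Iic.2 (min_le_right _ _)))
      obtain ⟨h2, h3, -⟩ := hfar (min M E₀) (min_le_left _ _)
      have := mul_pos (zero_lt_one.trans h3) h2
      linarith
    have hdo : Set.uIoo E₀ e ⊆ G := by
      rw [Set.uIoo_of_gt he]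
      exact Set.Ioo_subset_Ioc_self.trans heG
    have hS : edgeSin e ≠ 0 := edgeSin_ne_zero_of_gapMax_le he.ne'
      (fun E hE => hgap E (hdo hE)) fun E hE => by
        refine neg_le_neg_iff.1 (hmaxi.antitoneOn (hdo hE) hE₀ ?_)
        rw [Set.uIoo_of_gt he] at hE
        exact hE.2.le
    have hS₂ : edgeSin e₂ = 0 := edgeSin_eq_zero_of_le_gapMin he₂.ne
      (gapMin_pos (hgap E₀ hE₀)) (fun E hE => hgap E (hupo hE)) he₂1.le fun E hE => by
        refine neg_le_neg_iff.1 (hmin.antitoneOn hE₀ (hupo hE) ?_)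
        rw [Set.uIoo_of_lt he₂] at hE
        exact hE.1.le
    obtain ⟨E₁, hE₁, h⟩ := exists_lt_gapMin_of_edgeSin_eq_zero hα he₂.ne
      (fun E hE => hgap E (hupo hE)) hS₂
    refine ⟨E₁, hupo hE₁, e, he1, hS, fun E hE hne => ?_, h⟩
    rw [Set.uIoo_of_lt he₂] at hE₁
    rw [Set.uIcc_of_ge (he.le.trans hE₁.1.le)] at hE
    rcases le_total E E₀ with h | h
    · exact heG ⟨lt_of_le_of_ne hE.1 hne.symm, h⟩
    · exact hord.out hE₀ (hupo (by rw [Set.uIoo_of_lt he₂]; exact hE₁)) ⟨h, hE.2⟩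

/-- The direction of monotonicity is the sign of `α`, except possibly below zero. -/
theorem mul_pos_or_neg_of_gap {α τ E : ℝ} (hE : 1 < |discriminant α E|) (hτ : τ = 1 ∨ τ = -1)
    (hsign : 0 < τ * (discriminant α E * edgeSin E)) :
    0 ≤ τ * α ∨ (E < 0 ∧ τ = 1) := by
  by_contra! hcon
  obtain ⟨h1, h2⟩ := hcon
  have hsq : 1 < discriminant α E ^ 2 := by
    rw [← sq_abs]
    nlinarith
  have h := edgeCos_sq_add E
  have hS := edgeSin_ne_zero_of_gap hE
  have hS2 : 0 < edgeSin E ^ 2 := by positivity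
  rw [discriminant] at hsign hsq
  have hτ2 : τ ^ 2 = 1 := by rcases hτ with rfl | rfl <;> norm_num
  have hE0 : E < 0 := by
    have h3 := mul_neg_of_neg_of_pos h1 hsign
    have h4 : τ * α * (τ * ((edgeCos E + α * edgeSin E / 4) * edgeSin E))
        = α * edgeCos E * edgeSin E + α ^ 2 * edgeSin E ^ 2 / 4 := by
      linear_combination (α * (edgeCos E + α * edgeSin E / 4) * edgeSin E) * hτ2
    rw [h4] at h3
    have h5 : 0 < -E * edgeSin E ^ 2 := by nlinarith [sq_nonneg (α * edgeSin E)]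
    have := pos_of_mul_pos_left h5 hS2.le
    linarith
  have hC := one_lt_edgeCos hE0
  have hSp := pi_lt_edgeSin hE0
  have hpi := Real.pi_pos
  rcases hτ with rfl | rfl
  · exact h2 hE0 rfl
  · have hα : 0 < α := by linarith
    have hS0 : 0 < edgeSin E := by linarith
    have : 0 < (edgeCos E + α * edgeSin E / 4) * edgeSin E := by positivity
    linarith

theorem mem_firstGap_iff {α E : ℝ} : E ∈ firstGap {E | |discriminant α E| ≤ 1} ↔
    ∀ x ≤ E, 1 < |discriminant α x| := by
  constructor
  · intro h x hx
    by_contra! hcon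
    exact absurd (h x hcon) (not_lt.2 hx)
  · intro h x hx
    by_contra! hcon
    exact absurd (h x hcon) (not_lt.2 hx)

theorem firstGap_nonempty (α : ℝ) : (firstGap {E | |discriminant α E| ≤ 1}).Nonempty := by
  obtain ⟨M, -, hM⟩ := exists_far_below α
  exact ⟨M, mem_firstGap_iff.2 fun x hx => (hM x hx).2.1.trans_le (le_abs_self _)⟩

theorem sign_of_mem_firstGap {α E : ℝ} (hE : E ∈ firstGap {E | |discriminant α E| ≤ 1}) :
    0 < discriminant α E * edgeSin E := by
  rw [mem_firstGap_iff] at hE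
  obtain ⟨τ, hτ, hsign, -⟩ := exists_sign_of_gap Set.ordConnected_Iic hE
  obtain ⟨M, -, hM⟩ := exists_far_below α
  rcases hτ with rfl | rfl
  · simpa using hsign E Set.self_mem_Iic
  · have h1 := hsign (min M E) (Set.mem_Iic.2 (min_le_right _ _))
    obtain ⟨h2, h3, -⟩ := hM (min M E) (min_le_left _ _)
    have := mul_pos (zero_lt_one.trans h3) h2
    linarith

theorem mem_firstGap_of_sign {α E : ℝ} (hα : α < 0) (hE : 1 < |discriminant α E|)
    (hsign : 0 < discriminant α E * edgeSin E) : E ∈ firstGap {E | |discriminant α E| ≤ 1} := by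
  have hE0 : E < 0 := by
    rcases mul_pos_or_neg_of_gap hE (Or.inl rfl) (by simpa using hsign) with h | h
    · linarith
    · exact h.1
  have hpi := Real.pi_pos
  have hS := pi_lt_edgeSin hE0
  have hξ : 0 < discriminant α E := pos_of_mul_pos_left hsign (by linarith)
  rw [abs_of_pos hξ] at hE
  rw [mem_firstGap_iff]
  intro x hx
  have hx0 : x < 0 := hx.trans_lt hE0
  have hSx := pi_lt_edgeSin hx0
  have hanti := (strictAntiOn_neg_tan (s := Set.Iic 0) Set.ordConnected_Iic fun y hy => by
    have := pi_le_edgeSin hy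
    linarith).antitoneOn (show x ∈ Set.Iic 0 from hx0.le) (show E ∈ Set.Iic 0 from hE0.le) hx
  have h1 : -(α / 4) < (edgeCos E - 1) / edgeSin E := by
    rw [lt_div_iff₀ (by linarith)]
    rw [discriminant] at hE
    linarith
  have h2 := h1.trans_le hanti
  rw [lt_div_iff₀ (by linarith)] at h2
  refine lt_of_lt_of_le ?_ (le_abs_self _)
  rw [discriminant]
  linarith

theorem eq_firstGap_of_sign {α E : ℝ} (hα : α < 0) {G : Set ℝ}
    (hG : G ∈ gaps {E | |discriminant α E| ≤ 1}) (hE : E ∈ G)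
    (hsign : 0 < discriminant α E * edgeSin E) : G = firstGap {E | |discriminant α E| ≤ 1} := by
  obtain ⟨-, hord, hgap, hmax⟩ := gap_properties hG
  refine Set.Subset.antisymm (fun x hx => ?_) fun x hx => ?_
  · obtain ⟨τ, hτ, hs, -⟩ := exists_sign_of_gap hord hgap
    refine mem_firstGap_of_sign hα (hgap x hx) ?_
    rcases hτ with rfl | rfl
    · simpa using hs x hx
    · have := hs E hE
      linarith
  · have hEf := mem_firstGap_iff.1 (mem_firstGap_of_sign hα (hgap E hE) hsign)
    rcases le_total x E with h | h
    · exact hmax _ Set.ordConnected_Iic hEf ⟨E, Set.self_mem_Iic, hE⟩ h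
    · exact hmax _ Set.ordConnected_Iic (mem_firstGap_iff.1 hx) ⟨E, h, hE⟩ (Set.self_mem_Iic)

theorem firstGap_mem_gaps {α : ℝ} (hα : α < 0) :
    firstGap {E | |discriminant α E| ≤ 1} ∈ gaps {E | |discriminant α E| ≤ 1} := by
  obtain ⟨E, hE⟩ := firstGap_nonempty α
  have hc : E ∈ {E | |discriminant α E| ≤ 1}ᶜ :=
    not_le.2 (mem_firstGap_iff.1 hE E le_rfl)
  have hG : connectedComponentIn {E | |discriminant α E| ≤ 1}ᶜ E
      ∈ gaps {E | |discriminant α E| ≤ 1} := ⟨E, hc, rfl⟩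
  rw [← eq_firstGap_of_sign hα hG (mem_connectedComponentIn hc) (sign_of_mem_firstGap hE)]
  exact hG

/-! ### Eigenvalues in the gaps -/

/-- At an energy in a gap, the vertex solutions correspond, up to alternating signs, to the
stationary points of the energy form. -/
theorem exists_isVertexSolution_iff {α τ E : ℝ} {a W : ℤ → ℝ} (hE : 1 < |discriminant α E|)
    (hτ : τ = 1 ∨ τ = -1) (hsign : 0 < τ * (discriminant α E * edgeSin E))
    (ha : ∀ j, a j = α + τ * W j) : ∃ σ : ℝ, σ ^ 2 = 1 ∧ ∀ y : ℤ → ℝ,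
      IsVertexSolution E a y ↔
        IsStationary (gapMin α E) (gapMax α E) W fun j => σ ^ j * y j := by
  have hS := edgeSin_ne_zero_of_gap hE
  have hS' := abs_pos.2 hS
  have hτ2 : τ ^ 2 = 1 := by rcases hτ with rfl | rfl <;> norm_num
  have hτa : |τ| = 1 := by rcases hτ with rfl | rfl <;> simp
  obtain ⟨σ, hσ, hσξ⟩ : ∃ σ : ℝ, σ ^ 2 = 1 ∧ σ * |discriminant α E| = discriminant α E := by
    rcases le_total 0 (discriminant α E) with h | h
    · exact ⟨1, by norm_num, by rw [abs_of_nonneg h, one_mul]⟩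
    · exact ⟨-1, by norm_num, by rw [abs_of_nonpos h]; ring⟩
  have hσ0 : σ ≠ 0 := by
    rintro rfl
    norm_num at hσ
  have hσi : σ⁻¹ = σ := inv_eq_of_mul_eq_one_left (by rw [← sq, hσ])
  have hτS : τ * |edgeSin E| = σ * edgeSin E := by
    have h1 : τ * (discriminant α E * edgeSin E) = |discriminant α E| * |edgeSin E| := by
      rw [← abs_of_pos hsign, abs_mul, abs_mul, hτa, one_mul]
    have h2 : |discriminant α E| ≠ 0 := by linarith [hE]
    have h3 : τ * σ * edgeSin E = |edgeSin E| := by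
      refine mul_left_cancel₀ h2 ?_
      rw [← h1]
      linear_combination (τ * edgeSin E) * hσξ
    linear_combination (-τ) * h3 + σ * edgeSin E * hτ2
  refine ⟨σ, hσ, fun y => ?_⟩
  rw [isStationary_iff (gapMin_lt_gapMax hS), add_div_sub_gap hS, gapMax_sub_gapMin]
  refine forall_congr' fun j => ?_
  have hj : σ ^ j ≠ 0 := zpow_ne_zero _ hσ0
  have hW : W j / (2 / |edgeSin E|) = W j * |edgeSin E| / 2 := by
    field_simp
  rw [zpow_add_one₀ hσ0, zpow_sub_one₀ hσ0, hσi, ha j, hW]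
  have hcoef : 2 * edgeCos E + (α + τ * W j) * edgeSin E / 2
      = σ * (2 * |discriminant α E| + W j * |edgeSin E| / 2) := by
    have e1 : σ * |discriminant α E| = edgeCos E + α * edgeSin E / 4 := hσξ
    have e2 : σ * |edgeSin E| = τ * edgeSin E := by
      linear_combination (-σ * |edgeSin E|) * hτ2 + σ * τ * hτS + τ * edgeSin E * hσ
    linear_combination (-2) * e1 - W j / 2 * e2
  rw [hcoef]
  constructor
  · intro h
    linear_combination (σ ^ j * σ) * h
      + (σ ^ j * (2 * |discriminant α E| + W j * |edgeSin E| / 2) * y j) * hσ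
  · intro h
    have h1 : σ ^ j * (y (j + 1) + y (j - 1)) = σ ^ j
        * (σ * (2 * |discriminant α E| + W j * |edgeSin E| / 2) * y j) := by
      linear_combination σ * h - σ ^ j * (y (j + 1) + y (j - 1)) * hσ
    exact mul_left_cancel₀ hj h1

theorem SqSummable.alternate {y : ℤ → ℝ} (hy : SqSummable y) {σ : ℝ} (hσ : σ ^ 2 = 1) :
    SqSummable fun j => σ ^ j * y j := by
  refine Summable.congr hy fun j => ?_
  rw [mul_pow, sq (σ ^ j), ← mul_zpow, ← sq σ, hσ, one_zpow, one_mul]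

theorem exists_stationary_of_mem_pointSpectrum {α τ E : ℝ} {a W : ℤ → ℝ}
    (hE : 1 < |discriminant α E|) (hτ : τ = 1 ∨ τ = -1)
    (hsign : 0 < τ * (discriminant α E * edgeSin E)) (ha : ∀ j, a j = α + τ * W j)
    (h : E ∈ pointSpectrum (hamiltonian 0 a)) :
    ∃ v, SqSummable v ∧ IsStationary (gapMin α E) (gapMax α E) W v ∧ ∃ i, v i ≠ 0 := by
  obtain ⟨y, hy, hys, i, hi⟩ := exists_solution_of_mem_pointSpectrum (edgeSin_ne_zero_of_gap hE) h
  obtain ⟨σ, hσ, hiff⟩ := exists_isVertexSolution_iff hE hτ hsign ha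
  have hσ0 : σ ≠ 0 := by
    rintro rfl
    norm_num at hσ
  exact ⟨_, hy.alternate hσ, (hiff y).1 hys, i, mul_ne_zero (zpow_ne_zero _ hσ0) hi⟩

theorem mem_pointSpectrum_of_stationary {α τ E : ℝ} {a W v : ℤ → ℝ}
    (hE : 1 < |discriminant α E|) (hτ : τ = 1 ∨ τ = -1)
    (hsign : 0 < τ * (discriminant α E * edgeSin E)) (ha : ∀ j, a j = α + τ * W j)
    (hv : SqSummable v) (hvs : IsStationary (gapMin α E) (gapMax α E) W v) {i : ℤ}
    (hi : v i ≠ 0) : E ∈ pointSpectrum (hamiltonian 0 a) := by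
  obtain ⟨σ, hσ, hiff⟩ := exists_isVertexSolution_iff hE hτ hsign ha
  have hσ0 : σ ≠ 0 := by
    rintro rfl
    norm_num at hσ
  have hsq : ∀ j : ℤ, σ ^ j * σ ^ j = 1 := fun j => by
    rw [← mul_zpow, ← sq, hσ, one_zpow]
  refine mem_pointSpectrum_of_solution (edgeSin_ne_zero_of_gap hE) (hv.alternate hσ)
    ((hiff _).2 ?_) (mul_ne_zero (zpow_ne_zero i hσ0) hi)
  have : (fun j => σ ^ j * (σ ^ j * v j)) = v := funext fun j => by
    rw [← mul_assoc, hsq, one_mul]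
  rwa [this]

theorem IsStationary.eq_zero_of_node {P Q : ℝ} {m : ℕ} {W v : ℤ → ℝ}
    (hvs : IsStationary P Q W v) (hW : ∀ j, ¬ (1 ≤ j ∧ j ≤ (m : ℤ)) → W j = 0) (hP : 0 < P)
    (hQ : m * ∑ j ∈ Finset.Icc (1 : ℤ) m, |W j| ≤ Q) (hv : SqSummable v) (h1 : v 1 = 0) (i : ℤ) :
    v i = 0 := by
  by_contra hi
  exact (energyForm_pos_of_node hP hQ hv h1 hi).ne' (energyForm_eq_zero hW hv hv hvs)

theorem mem_simpleEigenvalues_of_gap {α τ E : ℝ} {m : ℕ} {a W : ℤ → ℝ}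
    (hE : 1 < |discriminant α E|) (hτ : τ = 1 ∨ τ = -1)
    (hsign : 0 < τ * (discriminant α E * edgeSin E)) (ha : ∀ j, a j = α + τ * W j)
    (hW : ∀ j, ¬ (1 ≤ j ∧ j ≤ (m : ℤ)) → W j = 0)
    (hQ : m * ∑ j ∈ Finset.Icc (1 : ℤ) m, |W j| ≤ gapMax α E)
    (h : E ∈ pointSpectrum (hamiltonian 0 a)) : E ∈ simpleEigenvalues (hamiltonian 0 a) := by
  refine mem_simpleEigenvalues (edgeSin_ne_zero_of_gap hE) h fun y hy hys h1 j => ?_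
  obtain ⟨σ, hσ, hiff⟩ := exists_isVertexSolution_iff hE hτ hsign ha
  have hσ0 : σ ≠ 0 := by
    rintro rfl
    norm_num at hσ
  have := ((hiff y).1 hys).eq_zero_of_node hW (gapMin_pos hE) hQ (hy.alternate hσ)
    (by rw [h1, mul_zero]) j
  exact (mul_eq_zero.1 this).resolve_left (zpow_ne_zero _ hσ0)

theorem not_mem_pointSpectrum_of_gap {α τ ε E : ℝ} {m : ℕ} {a δ : ℤ → ℝ}
    (hE : 1 < |discriminant α E|) (hτ : τ = 1 ∨ τ = -1)
    (hsign : 0 < τ * (discriminant α E * edgeSin E)) (ha : ∀ j, a j = α + τ * (ε * δ j))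
    (hδ : ∀ j, ¬ (1 ≤ j ∧ j ≤ (m : ℤ)) → δ j = 0) (hε : 0 < ε)
    (hsum : 0 < ∑ j ∈ Finset.Icc (1 : ℤ) m, δ j)
    (hQ : ε * ((∑ j ∈ Finset.Icc (1 : ℤ) m, |δ j|) ^ 2 / (∑ j ∈ Finset.Icc (1 : ℤ) m, δ j)
      + ∑ j ∈ Finset.Icc (1 : ℤ) m, |δ j|) * m ≤ gapMax α E) :
    E ∉ pointSpectrum (hamiltonian 0 a) := by
  intro h
  obtain ⟨v, hv, hvs, i, hi⟩ := exists_stationary_of_mem_pointSpectrum hE hτ hsign ha h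
  exact (energyForm_pos_of_sum_pos (gapMin_pos hE) hε hsum hQ hv hi).ne'
    (energyForm_eq_zero (fun j hj => by rw [hδ j hj, mul_zero]) hv hv hvs)

theorem exists_normalized_stationary {α τ E : ℝ} {m : ℕ} {a W : ℤ → ℝ}
    (hE : 1 < |discriminant α E|) (hτ : τ = 1 ∨ τ = -1)
    (hsign : 0 < τ * (discriminant α E * edgeSin E)) (ha : ∀ j, a j = α + τ * W j)
    (hW : ∀ j, ¬ (1 ≤ j ∧ j ≤ (m : ℤ)) → W j = 0)
    (hQ : m * ∑ j ∈ Finset.Icc (1 : ℤ) m, |W j| ≤ gapMax α E)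
    (h : E ∈ pointSpectrum (hamiltonian 0 a)) :
    ∃ v, SqSummable v ∧ IsStationary (gapMin α E) (gapMax α E) W v ∧ v 1 = 1 := by
  obtain ⟨v, hv, hvs, i, hi⟩ := exists_stationary_of_mem_pointSpectrum hE hτ hsign ha h
  have h1 : v 1 ≠ 0 := fun h1 => hi (hvs.eq_zero_of_node hW (gapMin_pos hE) hQ hv h1 i)
  refine ⟨fun j => (v 1)⁻¹ * v j, hv.const_mul _, fun j => ?_, inv_mul_cancel₀ h1⟩
  linear_combination (v 1)⁻¹ * hvs j

theorem eq_of_mem_gap {α : ℝ} {m : ℕ} {a W : ℤ → ℝ} {τ : ℝ} {G : Set ℝ} (hG : G.OrdConnected)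
    (hgap : ∀ E ∈ G, 1 < |discriminant α E|) (hτ : τ = 1 ∨ τ = -1)
    (hsign : ∀ E ∈ G, 0 < τ * (discriminant α E * edgeSin E)) (ha : ∀ j, a j = α + τ * W j)
    (hW : ∀ j, ¬ (1 ≤ j ∧ j ≤ (m : ℤ)) → W j = 0)
    (hQ : ∀ E ∈ G, m * ∑ j ∈ Finset.Icc (1 : ℤ) m, |W j| ≤ gapMax α E) {E E' : ℝ} (hE : E ∈ G)
    (hE' : E' ∈ G) (hp : E ∈ pointSpectrum (hamiltonian 0 a))
    (hp' : E' ∈ pointSpectrum (hamiltonian 0 a)) : E = E' := by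
  have key : ∀ x ∈ G, ∀ y ∈ G, x ∈ pointSpectrum (hamiltonian 0 a) →
      y ∈ pointSpectrum (hamiltonian 0 a) → gapMin α x < gapMin α y →
      gapMax α x ≤ gapMax α y → False := by
    intro x hx y hy hpx hpy h1 h2
    obtain ⟨v, hv, hvs, hv1⟩ :=
      exists_normalized_stationary (hgap x hx) hτ (hsign x hx) ha hW (hQ x hx) hpx
    obtain ⟨w, hw, hws, hw1⟩ :=
      exists_normalized_stationary (hgap y hy) hτ (hsign y hy) ha hW (hQ y hy) hpy
    exact not_stationary_of_lt hW h1 h2 (gapMin_pos (hgap x hx)) (hQ x hx) hw hv hw1 hv1 hws hvs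
  have hlt : ∀ x ∈ G, ∀ y ∈ G, x ∈ pointSpectrum (hamiltonian 0 a) →
      y ∈ pointSpectrum (hamiltonian 0 a) → ¬ x < y := by
    intro x hx y hy hpx hpy hxy
    obtain ⟨τ', hτ', -, h1, h2⟩ := exists_sign_of_gap hG hgap
    have h1 := h1 hx hy hxy
    have h2 := h2 hx hy hxy
    rcases hτ' with rfl | rfl
    · exact key y hy x hx hpy hpx (by linarith) (by linarith)
    · exact key x hx y hy hpx hpy (by linarith) (by linarith)
  exact le_antisymm (not_lt.1 (hlt E' hE' E hE hp' hp)) (not_lt.1 (hlt E hE E' hE' hp hp'))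

/-- The root `z ≤ 1` of `z + 1 / z = 2 |ξ|`, where `ξ` is the discriminant. -/
def decayRate (α E : ℝ) : ℝ := |discriminant α E| - √(discriminant α E ^ 2 - 1)

theorem continuous_decayRate (α : ℝ) : Continuous (decayRate α) := by
  have := continuous_discriminant α
  unfold decayRate
  fun_prop

theorem decayRate_eq_one {α E : ℝ} (hE : |discriminant α E| = 1) : decayRate α E = 1 := by
  rw [decayRate, ← sq_abs, hE]
  simp

theorem decayRate_properties {α E : ℝ} (hE : 1 < |discriminant α E|) :
    0 < decayRate α E ∧ decayRate α E < 1 ∧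
      decayRate α E + (decayRate α E)⁻¹ = 2 * |discriminant α E| := by
  rw [decayRate, ← sq_abs]
  set x := |discriminant α E| with hx
  set r := √(x ^ 2 - 1) with hr
  have h0 : 0 ≤ r := Real.sqrt_nonneg _
  have h1 : r ^ 2 = x ^ 2 - 1 := Real.sq_sqrt (by nlinarith)
  have h2 : r < x := by nlinarith
  have h3 : x - 1 < r := by nlinarith
  refine ⟨by linarith, by linarith, ?_⟩
  have h4 : (x - r)⁻¹ = x + r := inv_eq_of_mul_eq_one_right (by linear_combination -h1)
  rw [h4]
  ring

theorem exists_stationary_of_segment {α ε E₁ e : ℝ} {m : ℕ} {δ : ℤ → ℝ} (hm : 1 ≤ m)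
    (hδ : ∀ j, ¬ (1 ≤ j ∧ j ≤ (m : ℤ)) → δ j = 0) (hε : 0 < ε)
    (he1 : |discriminant α e| = 1) (hSe : edgeSin e ≠ 0)
    (hseg : ∀ E ∈ Set.uIcc E₁ e, E ≠ e → 1 < |discriminant α E|) (hE₁ : E₁ ≠ e)
    (hP : ε * ∑ j ∈ Finset.Icc (1 : ℤ) m, |δ j| < 4 * gapMin α E₁)
    (h1 : ε / gapMax α e * (2 * m * ∑ j ∈ Finset.Icc (1 : ℤ) m, |δ j|) ≤ 1)
    (h2 : ε / gapMax α e * (2 * m * (∑ j ∈ Finset.Icc (1 : ℤ) m, |δ j|) ^ 2)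
      < -∑ j ∈ Finset.Icc (1 : ℤ) m, δ j) :
    ∃ E ∈ Set.uIcc E₁ e, E ≠ e ∧ ∃ v, SqSummable v ∧ v 1 = 1 ∧
      IsStationary (gapMin α E) (gapMax α E) (fun j => ε * δ j) v := by
  set J : ℝ → ℝ := fun E => jostFun (decayRate α E) (fun j => ε * |edgeSin E| / 2 * δ j) m with hJ
  have hSc := continuous_edgeSin
  have hβ : ∀ E, edgeSin E ≠ 0 → (fun j => ε * |edgeSin E| / 2 * δ j)
      = fun j => ε * δ j / (gapMax α E - gapMin α E) := fun E hE => by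
    have := abs_pos.2 hE
    rw [gapMax_sub_gapMin]
    ext j
    field_simp
  have hJcont : ContinuousOn J (Set.uIcc E₁ e) := by
    refine continuousOn_jostFun (continuous_decayRate α).continuousOn (fun E hE => ?_)
      (fun j => Continuous.continuousOn (by fun_prop)) m
    by_cases h : E = e
    · rw [h, decayRate_eq_one he1]
      exact one_ne_zero
    · exact (decayRate_properties (hseg E hE h)).1.ne'
  have hJe : J e < 0 := by
    simp only [hJ]
    rw [decayRate_eq_one he1]
    have hl : ε * |edgeSin e| / 2 = ε / gapMax α e := by
      have := abs_pos.2 hSe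
      rw [gapMax, he1]
      field_simp
      norm_num
    rw [hl]
    refine jostFun_one_neg (div_pos hε ?_) h1 h2
    rw [gapMax, he1]
    have := abs_pos.2 hSe
    positivity
  have hg₁ := hseg E₁ Set.left_mem_uIcc hE₁
  have hJ₁ : 0 < J E₁ := by
    have hS := edgeSin_ne_zero_of_gap hg₁
    obtain ⟨z0, z1, z2⟩ := decayRate_properties hg₁
    simp only [hJ]
    rw [hβ E₁ hS]
    refine jostFun_pos hm (W := fun j => ε * δ j) (fun j hj => by rw [hδ j hj, mul_zero]) z0 z1
      (gapMin_lt_gapMax hS) (by rw [z2, add_div_sub_gap hS]) ?_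
    simp only [abs_mul, abs_of_pos hε]
    rwa [← Finset.mul_sum]
  obtain ⟨E, hE, hE0⟩ := intermediate_value_uIcc hJcont (show (0 : ℝ) ∈ Set.uIcc (J E₁) (J e) by
    rw [Set.uIcc_of_ge (hJe.trans hJ₁).le]
    exact ⟨hJe.le, hJ₁.le⟩)
  have hne : E ≠ e := by
    rintro rfl
    exact hJe.ne hE0
  have hg := hseg E hE hne
  have hS := edgeSin_ne_zero_of_gap hg
  obtain ⟨z0, z1, z2⟩ := decayRate_properties hg
  simp only [hJ] at hE0
  rw [hβ E hS] at hE0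
  obtain ⟨v, hv, hv1, hvr⟩ := exists_decaying_of_jostFun_eq_zero z0 z1 hm
    (fun j hj => by rw [hδ j hj, mul_zero, zero_div]) hE0
  refine ⟨E, hE, hne, v, hv, hv1, ?_⟩
  rw [isStationary_iff (gapMin_lt_gapMax hS), add_div_sub_gap hS]
  intro j
  rw [hvr j, z2]

/-- The coupling constant `ε` is small compared to the perturbation profile `δ`, to a lower bound
`Q₀` of the larger coefficient of the energy form, and to the unperturbed coupling `α`. -/
structure IsWeak (α Q₀ : ℝ) (m : ℕ) (δ : ℤ → ℝ) (ε : ℝ) : Prop where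
  pos : 0 < ε
  node : m * (ε * ∑ j ∈ Finset.Icc (1 : ℤ) m, |δ j|) ≤ Q₀
  sum : ε * ((∑ j ∈ Finset.Icc (1 : ℤ) m, |δ j|) ^ 2 / (∑ j ∈ Finset.Icc (1 : ℤ) m, δ j)
      + ∑ j ∈ Finset.Icc (1 : ℤ) m, |δ j|) * m ≤ Q₀
  coupling : ε * ∑ j ∈ Finset.Icc (1 : ℤ) m, |δ j| < 4 * (|α| / 8)
  edge_one : ε / Q₀ * (2 * m * ∑ j ∈ Finset.Icc (1 : ℤ) m, |δ j|) ≤ 1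
  edge_two : ε / Q₀ * (2 * m * (∑ j ∈ Finset.Icc (1 : ℤ) m, |δ j|) ^ 2)
      < |∑ j ∈ Finset.Icc (1 : ℤ) m, δ j|

theorem eventually_isWeak {α Q₀ : ℝ} {m : ℕ} {δ : ℤ → ℝ} (hα : α ≠ 0) (hQ₀ : 0 < Q₀)
    (hδ : ∑ j ∈ Finset.Icc (1 : ℤ) m, δ j ≠ 0) : ∀ᶠ ε in 𝓝[>] (0 : ℝ), IsWeak α Q₀ m δ ε := by
  have key : ∀ {f : ℝ → ℝ} {c : ℝ}, Continuous f → f 0 = 0 → 0 < c →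
      ∀ᶠ ε in 𝓝[>] (0 : ℝ), f ε < c := fun hf h0 hc =>
    (hf.continuousAt.eventually (gt_mem_nhds (by rwa [h0]))).filter_mono nhdsWithin_le_nhds
  have hα' := abs_pos.2 hα
  filter_upwards [self_mem_nhdsWithin,
    key (f := fun ε => m * (ε * ∑ j ∈ Finset.Icc (1 : ℤ) m, |δ j|)) (by fun_prop) (by simp) hQ₀,
    key (f := fun ε => ε * ((∑ j ∈ Finset.Icc (1 : ℤ) m, |δ j|) ^ 2
      / (∑ j ∈ Finset.Icc (1 : ℤ) m, δ j) + ∑ j ∈ Finset.Icc (1 : ℤ) m, |δ j|) * m)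
      (by fun_prop) (by simp) hQ₀,
    key (f := fun ε => ε * ∑ j ∈ Finset.Icc (1 : ℤ) m, |δ j|) (c := 4 * (|α| / 8)) (by fun_prop)
      (by simp) (by positivity),
    key (f := fun ε => ε / Q₀ * (2 * m * ∑ j ∈ Finset.Icc (1 : ℤ) m, |δ j|)) (by fun_prop)
      (by simp) one_pos,
    key (f := fun ε => ε / Q₀ * (2 * m * (∑ j ∈ Finset.Icc (1 : ℤ) m, |δ j|) ^ 2)) (by fun_prop)
      (by simp) (abs_pos.2 hδ)] with ε h0 h1 h2 h3 h4 h5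
  exact ⟨h0, h1.le, h2.le, h3, h4.le, h5⟩

theorem one_le_of_sum_ne_zero {m : ℕ} {δ : ℤ → ℝ}
    (h : ∑ j ∈ Finset.Icc (1 : ℤ) m, δ j ≠ 0) : 1 ≤ m := by
  by_contra! hm
  obtain rfl : m = 0 := by omega
  simp at h

/-- A gap in which the perturbation is attractive contains precisely one eigenvalue, and it is
simple. -/
theorem exists_unique_eigenvalue_of_gap {α Q₀ τ ε : ℝ} {m : ℕ} {a δ : ℤ → ℝ} {G : Set ℝ}
    (hα : α ≠ 0) (hQ₀ : 0 < Q₀)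
    (hQ : ∀ E, 1 ≤ |discriminant α E| → edgeSin E ≠ 0 → Q₀ ≤ gapMax α E)
    (hG : G ∈ gaps {E | |discriminant α E| ≤ 1}) (hτ : τ = 1 ∨ τ = -1)
    (hsign : ∀ E ∈ G, 0 < τ * (discriminant α E * edgeSin E))
    (ha : ∀ j, a j = α + τ * (ε * δ j)) (hδ : ∀ j, ¬ (1 ≤ j ∧ j ≤ (m : ℤ)) → δ j = 0)
    (hsum : ∑ j ∈ Finset.Icc (1 : ℤ) m, δ j < 0) (hε : IsWeak α Q₀ m δ ε) :
    ∃ E ∈ simpleEigenvalues (hamiltonian 0 a), G ∩ discreteSpectrum (hamiltonian 0 a) = {E} := by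
  obtain ⟨-, hord, hgap, -⟩ := gap_properties hG
  have hW : ∀ j, ¬ (1 ≤ j ∧ j ≤ (m : ℤ)) → ε * δ j = 0 := fun j hj => by rw [hδ j hj, mul_zero]
  have haα : ∀ j, ¬ (1 ≤ j ∧ j ≤ (m : ℤ)) → a j = α := fun j hj => by
    rw [ha, hW j hj, mul_zero, add_zero]
  have hQG : ∀ E ∈ G, Q₀ ≤ gapMax α E := fun E hE =>
    hQ E (hgap E hE).le (edgeSin_ne_zero_of_gap (hgap E hE))
  have hnode : ∀ E ∈ G, m * ∑ j ∈ Finset.Icc (1 : ℤ) m, |ε * δ j| ≤ gapMax α E := fun E hE => by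
    simp only [abs_mul, abs_of_pos hε.pos]
    rw [← Finset.mul_sum]
    exact hε.node.trans (hQG E hE)
  obtain ⟨E₁, hE₁, e, he1, hSe, hseg, hlt⟩ := exists_gap_segment hα hG
  have hle : ε / gapMax α e ≤ ε / Q₀ :=
    div_le_div_of_nonneg_left hε.pos.le hQ₀ (hQ e he1.ge hSe)
  have habs : 0 ≤ ∑ j ∈ Finset.Icc (1 : ℤ) m, |δ j| := Finset.sum_nonneg fun _ _ => abs_nonneg _
  obtain ⟨E, hE, hne, v, hv, hv1, hvs⟩ := exists_stationary_of_segment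
    (one_le_of_sum_ne_zero hsum.ne) hδ hε.pos he1 hSe
    (fun E hE hne => hgap E (hseg E hE hne)) (by
      rintro rfl
      exact (hgap _ hE₁).ne' he1)
    (hε.coupling.trans (by linarith))
    ((mul_le_mul_of_nonneg_right hle (by positivity)).trans hε.edge_one)
    ((mul_le_mul_of_nonneg_right hle (by positivity)).trans_lt
      (hε.edge_two.trans_eq (abs_of_neg hsum)))
  have hEG := hseg E hE hne
  have hEp : E ∈ pointSpectrum (hamiltonian 0 a) := mem_pointSpectrum_of_stationary (hgap E hEG) hτ
    (hsign E hEG) ha hv hvs (i := 1) (by rw [hv1]; exact one_ne_zero)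
  refine ⟨E, mem_simpleEigenvalues_of_gap (hgap E hEG) hτ (hsign E hEG) ha hW (hnode E hEG) hEp, ?_⟩
  ext x
  constructor
  · rintro ⟨hx, hxp, -⟩
    exact eq_of_mem_gap hord hgap hτ hsign ha hW hnode hx hEG hxp hEp
  · rintro rfl
    exact ⟨hEG, hEp, not_mem_essentialSpectrum_of_gap haα (hgap _ hEG)⟩

/-! ### Weak perturbations -/

theorem discriminant_mul_edgeSin_ne_zero {α E : ℝ} (hE : 1 < |discriminant α E|) :
    discriminant α E * edgeSin E ≠ 0 :=
  mul_ne_zero (abs_pos.1 (zero_lt_one.trans hE)) (edgeSin_ne_zero_of_gap hE)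

theorem sign_pos_of_gap {α E : ℝ} (hα : 0 < α) (hE : 1 < |discriminant α E|) :
    0 < discriminant α E * edgeSin E := by
  refine lt_of_le_of_ne (not_lt.1 fun hneg => ?_) (discriminant_mul_edgeSin_ne_zero hE).symm
  rcases mul_pos_or_neg_of_gap hE (Or.inr rfl) (by linarith) with h | ⟨-, h⟩ <;> linarith

theorem sign_neg_of_gap {α E : ℝ} (hα : α < 0) (hE : 1 < |discriminant α E|)
    (hf : E ∉ firstGap {E | |discriminant α E| ≤ 1}) : discriminant α E * edgeSin E < 0 :=
  lt_of_le_of_ne (not_lt.1 fun hpos => hf (mem_firstGap_of_sign hα hE hpos))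
    (discriminant_mul_edgeSin_ne_zero hE)

theorem pointSpectrum_subset_of_eq_const {a : ℤ → ℝ} {α : ℝ} {m : ℕ}
    (hα : ∀ j, ¬ (1 ≤ j ∧ j ≤ (m : ℤ)) → a j = α) :
    pointSpectrum (hamiltonian 0 a) ⊆ discreteSpectrum (hamiltonian 0 a) ∪ ringEnergies := by
  intro E hE
  rw [discreteSpectrum, essentialSpectrum_eq hα]
  by_cases h : |discriminant α E| ≤ 1
  · exact Or.inr (mem_ringEnergies_of_band hα h hE)
  · exact Or.inl ⟨hE, h⟩

theorem perturbed_eq (α ε : ℝ) (m : ℕ) (γ : ℤ → ℝ) (j : ℤ) :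
    perturbed α m (ε • γ) j = α + ε * if 1 ≤ j ∧ j ≤ (m : ℤ) then γ j else 0 := by
  unfold perturbed
  split_ifs <;> simp

theorem perturbed_of_not {α ε : ℝ} {m : ℕ} {γ : ℤ → ℝ} (j : ℤ) (hj : ¬ (1 ≤ j ∧ j ≤ (m : ℤ))) :
    perturbed α m (ε • γ) j = α := if_neg hj

theorem sum_truncate (m : ℕ) (γ : ℤ → ℝ) :
    ∑ j ∈ Finset.Icc (1 : ℤ) m, (if 1 ≤ j ∧ j ≤ (m : ℤ) then γ j else 0)
      = ∑ j ∈ Finset.Icc (1 : ℤ) m, γ j :=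
  Finset.sum_congr rfl fun _ hj => if_pos (Finset.mem_Icc.1 hj)

theorem eventually_not_mem_pointSpectrum {α : ℝ} {m : ℕ} {γ : ℤ → ℝ} (hα : α ≠ 0)
    (hγ : 0 < ∑ j ∈ Finset.Icc (1 : ℤ) m, γ j) :
    ∀ᶠ ε in 𝓝[>] (0 : ℝ), ∀ E, 1 < |discriminant α E| → 0 < discriminant α E * edgeSin E →
      E ∉ pointSpectrum (hamiltonian 0 (perturbed α m (ε • γ))) := by
  obtain ⟨Q₀, hQ₀, hQ⟩ := exists_le_gapMax α
  rw [← sum_truncate] at hγ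
  filter_upwards [eventually_isWeak hα hQ₀ hγ.ne'] with ε hε E hE hsign
  exact not_mem_pointSpectrum_of_gap hE (Or.inl rfl) (by rwa [one_mul])
    (fun j => by rw [perturbed_eq, one_mul]) (fun j hj => if_neg hj) hε.pos hγ
    (hε.sum.trans (hQ E hE.le (edgeSin_ne_zero_of_gap hE)))

theorem eventually_not_mem_pointSpectrum_of_neg {α : ℝ} {m : ℕ} {γ : ℤ → ℝ} (hα : α ≠ 0)
    (hγ : ∑ j ∈ Finset.Icc (1 : ℤ) m, γ j < 0) :
    ∀ᶠ ε in 𝓝[>] (0 : ℝ), ∀ E, 1 < |discriminant α E| → discriminant α E * edgeSin E < 0 →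
      E ∉ pointSpectrum (hamiltonian 0 (perturbed α m (ε • γ))) := by
  obtain ⟨Q₀, hQ₀, hQ⟩ := exists_le_gapMax α
  have hγ' : 0 < ∑ j ∈ Finset.Icc (1 : ℤ) m, -(if 1 ≤ j ∧ j ≤ (m : ℤ) then γ j else 0) := by
    rw [Finset.sum_neg_distrib, sum_truncate]
    linarith
  filter_upwards [eventually_isWeak hα hQ₀ hγ'.ne'] with ε hε E hE hsign
  exact not_mem_pointSpectrum_of_gap hE (Or.inr rfl) (by linarith)
    (fun j => by rw [perturbed_eq]; ring) (fun j hj => by rw [if_neg hj, neg_zero]) hε.pos hγ'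
    (hε.sum.trans (hQ E hE.le (edgeSin_ne_zero_of_gap hE)))

theorem eventually_exists_unique_of_neg {α : ℝ} {m : ℕ} {γ : ℤ → ℝ} (hα : α ≠ 0)
    (hγ : ∑ j ∈ Finset.Icc (1 : ℤ) m, γ j < 0) :
    ∀ᶠ ε in 𝓝[>] (0 : ℝ), ∀ G ∈ gaps {E | |discriminant α E| ≤ 1},
      (∀ E ∈ G, 0 < discriminant α E * edgeSin E) →
      ∃ E ∈ simpleEigenvalues (hamiltonian 0 (perturbed α m (ε • γ))),
        G ∩ discreteSpectrum (hamiltonian 0 (perturbed α m (ε • γ))) = {E} := by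
  obtain ⟨Q₀, hQ₀, hQ⟩ := exists_le_gapMax α
  rw [← sum_truncate] at hγ
  filter_upwards [eventually_isWeak hα hQ₀ hγ.ne] with ε hε G hG hsign
  exact exists_unique_eigenvalue_of_gap hα hQ₀ hQ hG (Or.inl rfl)
    (fun E hE => by rw [one_mul]; exact hsign E hE)
    (fun j => by rw [perturbed_eq, one_mul]) (fun j hj => if_neg hj) hγ hε

theorem eventually_exists_unique_of_pos {α : ℝ} {m : ℕ} {γ : ℤ → ℝ} (hα : α ≠ 0)
    (hγ : 0 < ∑ j ∈ Finset.Icc (1 : ℤ) m, γ j) :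
    ∀ᶠ ε in 𝓝[>] (0 : ℝ), ∀ G ∈ gaps {E | |discriminant α E| ≤ 1},
      (∀ E ∈ G, discriminant α E * edgeSin E < 0) →
      ∃ E ∈ simpleEigenvalues (hamiltonian 0 (perturbed α m (ε • γ))),
        G ∩ discreteSpectrum (hamiltonian 0 (perturbed α m (ε • γ))) = {E} := by
  obtain ⟨Q₀, hQ₀, hQ⟩ := exists_le_gapMax α
  have hγ' : ∑ j ∈ Finset.Icc (1 : ℤ) m, -(if 1 ≤ j ∧ j ≤ (m : ℤ) then γ j else 0) < 0 := by
    rw [Finset.sum_neg_distrib, sum_truncate]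
    linarith
  filter_upwards [eventually_isWeak hα hQ₀ hγ'.ne] with ε hε G hG hsign
  exact exists_unique_eigenvalue_of_gap hα hQ₀ hQ hG (Or.inr rfl)
    (fun E hE => by linarith [hsign E hE])
    (fun j => by rw [perturbed_eq]; ring) (fun j hj => by rw [if_neg hj, neg_zero]) hγ' hε

end ChainGraph

end

open ChainGraph in
theorem mainTheorem10 (A : ℤ) (α : ℝ) (m : ℕ) (γ : ℤ → ℝ) :
    -- the essential spectrum is that of the unperturbed chain
    (∀ ε : ℝ, essentialSpectrum (hamiltonian A (perturbed α m (ε • γ)))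
      = essentialSpectrum (hamiltonian A (fun _ => α))) ∧
    -- `α > 0`, `∑ γ_j > 0`
    (0 < α → 0 < ∑ j ∈ Finset.Icc (1 : ℤ) m, γ j →
      ∀ᶠ ε in 𝓝[>] (0 : ℝ),
        discreteSpectrum (hamiltonian A (perturbed α m (ε • γ))) = ∅ ∧
        pointSpectrum (hamiltonian A (perturbed α m (ε • γ))) ⊆ ringEnergies) ∧
    -- `α > 0`, `∑ γ_j < 0`
    (0 < α → ∑ j ∈ Finset.Icc (1 : ℤ) m, γ j < 0 →
      ∀ᶠ ε in 𝓝[>] (0 : ℝ),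
        ∀ G ∈ gaps (essentialSpectrum (hamiltonian A (perturbed α m (ε • γ)))),
          ∃ E ∈ simpleEigenvalues (hamiltonian A (perturbed α m (ε • γ))),
            G ∩ discreteSpectrum (hamiltonian A (perturbed α m (ε • γ))) = {E}) ∧
    -- `α < 0`, `∑ γ_j > 0`
    (α < 0 → 0 < ∑ j ∈ Finset.Icc (1 : ℤ) m, γ j →
      ∀ᶠ ε in 𝓝[>] (0 : ℝ),
        firstGap (essentialSpectrum (hamiltonian A (perturbed α m (ε • γ)))) ∩
          discreteSpectrum (hamiltonian A (perturbed α m (ε • γ))) = ∅ ∧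
        ∀ G ∈ gaps (essentialSpectrum (hamiltonian A (perturbed α m (ε • γ)))),
          G ≠ firstGap (essentialSpectrum (hamiltonian A (perturbed α m (ε • γ)))) →
          ∃ E ∈ simpleEigenvalues (hamiltonian A (perturbed α m (ε • γ))),
            G ∩ discreteSpectrum (hamiltonian A (perturbed α m (ε • γ))) = {E}) ∧
    -- `α < 0`, `∑ γ_j < 0`
    (α < 0 → ∑ j ∈ Finset.Icc (1 : ℤ) m, γ j < 0 →
      ∀ᶠ ε in 𝓝[>] (0 : ℝ),
        ∃ E ∈ simpleEigenvalues (hamiltonian A (perturbed α m (ε • γ))),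
          E ∈ firstGap (essentialSpectrum (hamiltonian A (perturbed α m (ε • γ)))) ∧
          discreteSpectrum (hamiltonian A (perturbed α m (ε • γ))) = {E} ∧
          pointSpectrum (hamiltonian A (perturbed α m (ε • γ))) ⊆ {E} ∪ ringEnergies) := by
  have hess : ∀ ε : ℝ, essentialSpectrum (hamiltonian A (perturbed α m (ε • γ)))
      = {E | |discriminant α E| ≤ 1} := fun ε => by
    rw [essentialSpectrum_gauge, essentialSpectrum_eq perturbed_of_not]
  have hess₀ : essentialSpectrum (hamiltonian A (fun _ => α)) = {E | |discriminant α E| ≤ 1} := by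
    rw [essentialSpectrum_gauge, essentialSpectrum_eq (m := 0) fun _ _ => rfl]
  simp only [hess, hess₀, discreteSpectrum_gauge, pointSpectrum_gauge, simpleEigenvalues_gauge]
  have hgap : ∀ (ε E : ℝ), E ∈ discreteSpectrum (hamiltonian 0 (perturbed α m (ε • γ))) →
      E ∈ pointSpectrum (hamiltonian 0 (perturbed α m (ε • γ))) ∧ 1 < |discriminant α E| := by
    intro ε E hE
    rw [discreteSpectrum, essentialSpectrum_eq perturbed_of_not] at hE
    exact ⟨hE.1, not_le.1 hE.2⟩
  refine ⟨fun _ => trivial, fun hα hγ => ?_, fun hα hγ => ?_, fun hα hγ => ?_, fun hα hγ => ?_⟩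
  · filter_upwards [eventually_not_mem_pointSpectrum hα.ne' hγ] with ε hε
    have h : discreteSpectrum (hamiltonian 0 (perturbed α m (ε • γ))) = ∅ := by
      refine Set.eq_empty_of_forall_notMem fun E hE => ?_
      obtain ⟨h1, h2⟩ := hgap ε E hE
      exact hε E h2 (sign_pos_of_gap hα h2) h1
    refine ⟨h, ?_⟩
    have h1 := pointSpectrum_subset_of_eq_const (perturbed_of_not (α := α) (ε := ε) (m := m)
      (γ := γ))
    rwa [h, Set.empty_union] at h1
  · filter_upwards [eventually_exists_unique_of_neg hα.ne' hγ] with ε hε G hG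
    exact hε G hG fun E hE => sign_pos_of_gap hα ((gap_properties hG).2.2.1 E hE)
  · filter_upwards [eventually_exists_unique_of_pos hα.ne hγ,
      eventually_not_mem_pointSpectrum hα.ne hγ] with ε hε hε'
    refine ⟨Set.eq_empty_of_forall_notMem fun E hE => ?_, fun G hG hne => ?_⟩
    · obtain ⟨h1, h2⟩ := hgap ε E hE.2
      exact hε' E h2 (sign_of_mem_firstGap hE.1) h1
    · refine hε G hG fun E hE => ?_
      have h1 := (gap_properties hG).2.2.1 E hE
      refine lt_of_le_of_ne (not_lt.1 fun hpos => hne ?_) (discriminant_mul_edgeSin_ne_zero h1)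
      exact eq_firstGap_of_sign hα hG hE hpos
  · filter_upwards [eventually_exists_unique_of_neg hα.ne hγ,
      eventually_not_mem_pointSpectrum_of_neg hα.ne hγ] with ε hε hε'
    obtain ⟨E, hEs, hE⟩ := hε _ (firstGap_mem_gaps hα) fun E hE => sign_of_mem_firstGap hE
    have hmem : E ∈ firstGap {E | |discriminant α E| ≤ 1}
        ∩ discreteSpectrum (hamiltonian 0 (perturbed α m (ε • γ))) := hE ▸ Set.mem_singleton E
    have hsub : discreteSpectrum (hamiltonian 0 (perturbed α m (ε • γ))) = {E} := by
      rw [← hE]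
      refine (Set.inter_eq_right.2 fun x hx => ?_).symm
      obtain ⟨h1, h2⟩ := hgap ε x hx
      by_contra hf
      exact hε' x h2 (sign_neg_of_gap hα h2 hf) h1
    refine ⟨E, hEs, hmem.1, hsub, ?_⟩
    have h1 := pointSpectrum_subset_of_eq_const (perturbed_of_not (α := α) (ε := ε) (m := m)
      (γ := γ))
    rwa [hsub] at h1
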